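/- Let $k$ be a commutative ring. For a small $k$-linear category $\mathcal E$ let $\mathcal E\text{-Mod}$ be the category of $k$-linear functors $\mathcal E\to k\text{-Mod}$. An object of $\mathcal E\text{-Mod}$ is Gorenstein projective if it is isomorphic to $\operatorname{Ker}(Q_0\to Q_{-1})$ for an acyclic complex $Q_\bullet$ of projective objects such that $\operatorname{Hom}(Q_\bullet,Q)$ is acyclic for every projective $Q$. The category $\mathcal E$ is called left $m$-Gorenstein ($m\in\mathbb N$) if $\operatorname{gl.Gpdim}\,\mathcal E\text{-Mod}=m$, i.e. if $m$ is the supremum, over all objects $M$ of $\mathcal E\text{-Mod}$, of the smallest length $r$ of an exact sequence $0\to G_r\to\cdots\to G_0\to M\to 0$ with all $G_i$ Gorenstein projective. Let $\mathcal C$ be a small $k$-linear category that is locally bounded (every object has nonzero morphisms to, and from, only finitely many objects) and Hom-finite (every $\mathcal C(c,c')$ is a finitely generated projective $k$-module). Let $i_!\dashv i^*$ be the adjunction with $i^*\colon \mathcal C\text{-Mod}\to\prod_{c\in\mathcal C}k\text{-Mod}$, $F\mapsto (F(c))_{c}$, put $P_{\mathcal C\text{-Mod}}=i_!\circ i^*$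 and $D=\operatorname{Hom}_k(-,k)$, and let $\nu\colon \mathcal C\text{-Mod}\to \mathcal C\text{-Mod}$, $\nu(F)(c)=D(\mathcal C(c,-))\otimes_{\mathcal C}F$, be the Nakayama functor, with right adjoint $\nu^-$, $\nu^-(G)(c)=\operatorname{Hom}_{\mathcal C\text{-Mod}}(D(\mathcal C(-,c)),G)$. The endofunctor $P_{\mathcal C\text{-Mod}}$ is called $n$-Gorenstein ($n\in\mathbb N$) if $L_i\nu=0$ and $R^i\nu^-=0$ for all sufficiently large $i$, and $n$ is the smallest natural number with $L_i\nu=0$ for all $i>n$. **Theorem.** Let $\mathcal C'$ be a small $k$-linear category that is left $m$-Gorenstein, and let $\mathcal C$ be a small, $k$-linear, locally bounded and Hom-finite category such that $P_{\mathcal C\text{-Mod}}$ is $n$-Gorenstein. Then $\mathcal C'\otimes_k\mathcal C$ (with pairs of objects as objects and $(\mathcal C'\otimes_k\mathcal C)((a,c),(b,d))=\mathcal C'(a,b)\otimes_k\mathcal C(c,d)$) is left $p$-Gorenstein for some $p\le m+n$. -/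

import Mathlib

open CategoryTheory Limits Opposite
open scoped TensorProduct DirectSum

universe v u

noncomputable section

namespace GorensteinModules

section Abelian

variable {A : Type u} [Category.{v} A] [Abelian A]

/-- A totally acyclic complex: an acyclic complex of projectives `Q` such that `Hom(Q, P)` is
acyclic for every projective object `P`. -/
structure IsTotallyAcyclic (Q : ChainComplex A ℤ) : Prop where
  projective : ∀ i, Projective (Q.X i)
  acyclic : Q.Acyclic
  hom_acyclic : ∀ (P : A), Projective P → ∀ (i : ℤ) (g : Q.X i ⟶ P), Q.d (i + 1) i ≫ g = 0 →
    ∃ h : Q.X (i - 1) ⟶ P, Q.d i (i - 1) ≫ h = g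

variable (A) in
/-- Gorenstein projective objects: the objects `Z₀(Q) = Ker (Q₀ ⟶ Q₋₁)` for `Q` totally acyclic. -/
def gorensteinProjective : ObjectProperty A := fun X =>
  ∃ Q : ChainComplex A ℤ, IsTotallyAcyclic Q ∧ Nonempty (Q.cycles 0 ≅ X)

/-- There is an exact sequence `0 ⟶ X_n ⟶ ⋯ ⟶ X_0 ⟶ M ⟶ 0` with all `X_i` in `X`
(given as a splice of `n` short exact sequences). -/
def HasResolution (X : ObjectProperty A) : ℕ → A → Prop
  | 0, M => ∃ X₀ : A, X X₀ ∧ Nonempty (X₀ ≅ M)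
  | n + 1, M => ∃ (K X₀ : A) (i : K ⟶ X₀) (p : X₀ ⟶ M) (w : i ≫ p = 0),
      X X₀ ∧ (ShortComplex.mk i p w).ShortExact ∧ HasResolution X n K

/-- The resolution dimension of `M` with respect to `X` (`⊤` if there is no finite resolution). -/
def resolutionDim (X : ObjectProperty A) (M : A) : ℕ∞ :=
  ⨅ (n : ℕ) (_ : HasResolution X n M), (n : ℕ∞)

variable (A) in
/-- The global Gorenstein projective dimension. -/
def glGpdim : ℕ∞ := ⨆ M : A, resolutionDim (gorensteinProjective A) M

end Abelian

section LMod

variable (k : Type u) [CommRing k] (C : Type u) [SmallCategory C] [Preadditive C] [Linear k C]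

/-- The functors `C ⥤ ModuleCat k` that are `k`-linear. -/
def isLinear : ObjectProperty (C ⥤ ModuleCat.{u} k) := fun F => F.Additive ∧ F.Linear k

/-- The category `C-Mod` of left `C`-modules, i.e. of `k`-linear functors `C ⥤ ModuleCat k`. -/
abbrev LMod := (isLinear k C).FullSubcategory

variable {k C}

instance (F : LMod k C) : F.obj.Additive := F.property.1

instance (F : LMod k C) : F.obj.Linear k := F.property.2

instance {J : Type*} [Category* J] [HasLimitsOfShape J (ModuleCat.{u} k)] :
    (isLinear k C).IsClosedUnderLimitsOfShape J where
  limitsOfShape_le := by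
    rintro F ⟨p⟩
    have hl (Y : C) : IsLimit (((evaluation C (ModuleCat.{u} k)).obj Y).mapCone p.cone) :=
      isLimitOfPreserves _ p.isLimit
    have nat {X Y : C} (f : X ⟶ Y) (j : J) :
        F.map f ≫ (p.π.app j).app Y = (p.π.app j).app X ≫ (p.diag.obj j).map f :=
      (p.π.app j).naturality f
    refine ⟨⟨fun {X Y f g} => (hl Y).hom_ext fun j => ?_⟩,
      ⟨fun {X Y} f r => (hl Y).hom_ext fun j => ?_⟩⟩
    · have := (p.prop_diag_obj j).1
      change F.map (f + g) ≫ (p.π.app j).app Y = (F.map f + F.map g) ≫ (p.π.app j).app Y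
      rw [nat, Preadditive.add_comp, nat, nat, Functor.map_add, Preadditive.comp_add]
    · have := (p.prop_diag_obj j).2
      change F.map (r • f) ≫ (p.π.app j).app Y = (r • F.map f) ≫ (p.π.app j).app Y
      rw [nat, Linear.smul_comp, nat, Functor.map_smul, Linear.comp_smul]

instance {J : Type*} [Category* J] [HasColimitsOfShape J (ModuleCat.{u} k)] :
    (isLinear k C).IsClosedUnderColimitsOfShape J where
  colimitsOfShape_le := by
    rintro F ⟨p⟩
    have hl (X : C) : IsColimit (((evaluation C (ModuleCat.{u} k)).obj X).mapCocone p.cocone) :=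
      isColimitOfPreserves _ p.isColimit
    have nat {X Y : C} (f : X ⟶ Y) (j : J) :
        (p.ι.app j).app X ≫ F.map f = (p.diag.obj j).map f ≫ (p.ι.app j).app Y :=
      ((p.ι.app j).naturality f).symm
    refine ⟨⟨fun {X Y f g} => (hl X).hom_ext fun j => ?_⟩,
      ⟨fun {X Y} f r => (hl X).hom_ext fun j => ?_⟩⟩
    · have := (p.prop_diag_obj j).1
      change (p.ι.app j).app X ≫ F.map (f + g) = (p.ι.app j).app X ≫ (F.map f + F.map g)
      rw [nat, Preadditive.comp_add, nat, nat, Functor.map_add, Preadditive.add_comp]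
    · have := (p.prop_diag_obj j).2
      change (p.ι.app j).app X ≫ F.map (r • f) = (p.ι.app j).app X ≫ (r • F.map f)
      rw [nat, Linear.comp_smul, nat, Functor.map_smul, Linear.smul_comp]

instance : (isLinear k C).IsClosedUnderFiniteProducts where

instance : (isLinear k C).ContainsZero where
  exists_zero := by
    obtain ⟨Z, hZ⟩ := HasZeroObject.zero (C := C ⥤ ModuleCat.{u} k)
    exact ⟨Z, hZ, ⟨fun {_ _ _ _} => (hZ.obj _).eq_of_src _ _⟩,
      ⟨fun {_ _} _ _ => (hZ.obj _).eq_of_src _ _⟩⟩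

instance : (isLinear k C).IsClosedUnderKernels where
  kernels_le := by
    rintro _ ⟨f, c, hc, h₁, h₂⟩
    exact (isLinear k C).prop_of_isLimit hc (by rintro (_ | _) <;> assumption)

instance : (isLinear k C).IsClosedUnderCokernels where
  cokernels_le := by
    rintro _ ⟨f, c, hc, h₁, h₂⟩
    exact (isLinear k C).prop_of_isColimit hc (by rintro (_ | _) <;> assumption)


lemma LMod.surjective_of_epi {F G : LMod k C} (f : F ⟶ G) [Epi f] (c : C) :
    Function.Surjective (f.hom.app c) := by
  have := (isLinear k C).preservesEpimorphisms_ι_of_isNormalMonoCategory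
  have : Epi f.hom := inferInstanceAs (Epi ((isLinear k C).ι.map f))
  exact (ModuleCat.epi_iff_surjective _).1 inferInstance

lemma LMod.injective_of_mono {F G : LMod k C} (f : F ⟶ G) [Mono f] (c : C) :
    Function.Injective (f.hom.app c) := by
  have := (isLinear k C).preservesMonomorphisms_ι_of_isNormalEpiCategory
  have : Mono f.hom := inferInstanceAs (Mono ((isLinear k C).ι.map f))
  exact (ModuleCat.mono_iff_injective _).1 inferInstance

lemma LMod.epi_of_surjective {F G : LMod k C} (f : F ⟶ G)
    (hf : ∀ c, Function.Surjective (f.hom.app c)) : Epi f := by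
  have (c : C) : Epi (f.hom.app c) := (ModuleCat.epi_iff_surjective _).2 (hf c)
  have : Epi ((isLinear k C).ι.map f) := NatTrans.epi_of_epi_app f.hom
  exact (isLinear k C).ι.epi_of_epi_map this

lemma LMod.mono_of_injective {F G : LMod k C} (f : F ⟶ G)
    (hf : ∀ c, Function.Injective (f.hom.app c)) : Mono f := by
  have (c : C) : Mono (f.hom.app c) := (ModuleCat.mono_iff_injective _).2 (hf c)
  have : Mono ((isLinear k C).ι.map f) := NatTrans.mono_of_mono_app f.hom
  exact (isLinear k C).ι.mono_of_mono_map this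

variable (k) in
/-- The representable module `C(c, -)`. -/
def LMod.free (c : C) : LMod k C :=
  ⟨(linearCoyoneda k C).obj (op c),
    ⟨fun {_ _ f g} => ModuleCat.hom_ext (LinearMap.ext fun x => Preadditive.comp_add _ _ _ x f g)⟩,
    ⟨fun {_ _} f r => ModuleCat.hom_ext (LinearMap.ext fun x => Linear.comp_smul _ _ _ x r f)⟩⟩

/-- The morphism `C(c, -) ⟶ F` given by an element of `F(c)`. -/
def LMod.freeDesc {c : C} {F : LMod k C} (x : F.obj.obj c) : LMod.free k c ⟶ F :=
  ObjectProperty.homMk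
    { app := fun d => ModuleCat.ofHom (X := (c ⟶ d)) (Y := F.obj.obj d)
        { toFun := fun g => F.obj.map g x
          map_add' := fun g h => by rw [Functor.map_add]; rfl
          map_smul' := fun r g => by rw [Functor.map_smul]; rfl }
      naturality := fun d e f => by
        ext g
        exact congr($(F.obj.map_comp g f) x) }

lemma LMod.freeDesc_apply {c : C} {F : LMod k C} (x : F.obj.obj c) {d : C} (g : c ⟶ d) :
    (LMod.freeDesc x).hom.app d g = F.obj.map g x := rfl

lemma LMod.free_hom_ext {c : C} {F : LMod k C} {f g : LMod.free k c ⟶ F}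
    (h : f.hom.app c (𝟙 c) = g.hom.app c (𝟙 c)) : f = g := by
  ext d x
  have key (f : LMod.free k c ⟶ F) : f.hom.app d x = F.obj.map x (f.hom.app c (𝟙 c)) := by
    have := congr($(f.hom.naturality x) (𝟙 c))
    exact Eq.trans (congrArg (f.hom.app d) (Category.id_comp (show c ⟶ d from x)).symm) this
  exact (key f).trans (h ▸ (key g).symm)

instance (c : C) : Projective (LMod.free k c) where
  factors {F G} f e _ := by
    obtain ⟨y, hy⟩ := LMod.surjective_of_epi e c (f.hom.app c (𝟙 c))
    refine ⟨LMod.freeDesc y, LMod.free_hom_ext ?_⟩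
    change e.hom.app c (F.obj.map (𝟙 c) y) = _
    rw [F.obj.map_id]
    exact hy

instance : EnoughProjectives (LMod k C) where
  presentation F := ⟨{
    p := ∐ fun i : (Σ c : C, F.obj.obj c) => LMod.free k i.1
    f := Sigma.desc fun i => LMod.freeDesc i.2
    epi := by
      refine LMod.epi_of_surjective _ fun c x => ?_
      refine ⟨(Sigma.ι (fun i : (Σ c : C, F.obj.obj c) => LMod.free k i.1) ⟨c, x⟩).hom.app c (𝟙 c), ?_⟩
      have := congr(($(Sigma.ι_desc (fun i : (Σ c : C, F.obj.obj c) => LMod.freeDesc i.2)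
        ⟨c, x⟩)).hom.app c (𝟙 c))
      refine Eq.trans this ?_
      change F.obj.map (𝟙 c) x = x
      rw [F.obj.map_id]
      rfl }⟩

/-- The coinduced module `d ↦ Hom_k(C(d, c), E)`. -/
def LMod.cofree (c : C) (E : ModuleCat.{u} k) : LMod k C :=
  ⟨{ obj := fun d => ModuleCat.of k ((d ⟶ c) →ₗ[k] E)
     map := fun f => ModuleCat.ofHom (LinearMap.lcomp k E (Linear.leftComp k c f)) },
    ⟨fun {_ _ _ _} => by ext; simp⟩, ⟨fun {_ _} _ _ => by ext; simp⟩⟩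

/-- The morphism `F ⟶ Hom_k(C(-, c), E)` given by a morphism `F(c) ⟶ E`. -/
def LMod.cofreeLift {c : C} {E : ModuleCat.{u} k} {F : LMod k C} (φ : F.obj.obj c ⟶ E) :
    F ⟶ LMod.cofree c E :=
  ObjectProperty.homMk
    { app := fun d => ModuleCat.ofHom (X := F.obj.obj d) (Y := ((d ⟶ c) →ₗ[k] E))
        (LinearMap.mk₂ k (fun x g => φ (F.obj.map g x))
          (by simp) (by simp) (by simp [Functor.map_add]) (by simp [Functor.map_smul]))
      naturality := fun d e f => by
        ext x
        refine LinearMap.ext fun g => ?_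
        change φ (F.obj.map g (F.obj.map f x)) = φ (F.obj.map (f ≫ g) x)
        rw [F.obj.map_comp]; rfl }

lemma LMod.cofree_hom_ext {c : C} {E : ModuleCat.{u} k} {F : LMod k C}
    {f g : F ⟶ LMod.cofree c E}
    (h : ∀ x : F.obj.obj c, (show (c ⟶ c) →ₗ[k] E from f.hom.app c x) (𝟙 c) =
      (show (c ⟶ c) →ₗ[k] E from g.hom.app c x) (𝟙 c)) : f = g := by
  ext d x
  refine LinearMap.ext fun (a : d ⟶ c) => ?_
  have key (f : F ⟶ LMod.cofree c E) : (show (d ⟶ c) →ₗ[k] E from f.hom.app d x) a =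
      (show (c ⟶ c) →ₗ[k] E from f.hom.app c (F.obj.map a x)) (𝟙 c) := by
    have := congr((show (c ⟶ c) →ₗ[k] E from $(f.hom.naturality a) x) (𝟙 c))
    refine Eq.trans ?_ this.symm
    change _ = (show (d ⟶ c) →ₗ[k] E from f.hom.app d x) (a ≫ 𝟙 c)
    rw [Category.comp_id]
  exact (key f).trans ((h _).trans (key g).symm)

instance (c : C) (E : ModuleCat.{u} k) [Injective E] : Injective (LMod.cofree c E) where
  factors {F G} f e _ := by
    have : Mono (e.hom.app c) := (ModuleCat.mono_iff_injective _).2 (LMod.injective_of_mono e c)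
    let φ : F.obj.obj c ⟶ E := f.hom.app c ≫ ModuleCat.ofHom (X := ((c ⟶ c) →ₗ[k] E)) (Y := E)
      (LinearMap.applyₗ (𝟙 c))
    refine ⟨LMod.cofreeLift (Injective.factorThru φ (e.hom.app c)), LMod.cofree_hom_ext fun x => ?_⟩
    change Injective.factorThru φ (e.hom.app c) (G.obj.map (𝟙 c) (e.hom.app c x)) = _
    rw [G.obj.map_id]
    exact congr($(Injective.comp_factorThru φ (e.hom.app c)) x)

instance : EnoughInjectives (LMod k C) where
  presentation F := ⟨{
    J := ∏ᶜ fun c : C => LMod.cofree c (Injective.under (F.obj.obj c))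
    f := Pi.lift fun c => LMod.cofreeLift (Injective.ι (F.obj.obj c))
    mono := by
      refine LMod.mono_of_injective _ fun c => ?_
      have h := congr(($(Pi.lift_π (fun c => LMod.cofreeLift (Injective.ι (F.obj.obj c))) c)).hom.app c)
      have inj : Function.Injective
          ((LMod.cofreeLift (Injective.ι (F.obj.obj c))).hom.app c) := by
        intro x y hxy
        have h2 := congr((show (c ⟶ c) →ₗ[k] ((Injective.under (F.obj.obj c) : ModuleCat.{u} k)) from $hxy) (𝟙 c))
        change Injective.ι (F.obj.obj c) (F.obj.map (𝟙 c) x) =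
          Injective.ι (F.obj.obj c) (F.obj.map (𝟙 c) y) at h2
        rw [F.obj.map_id] at h2
        exact (ModuleCat.mono_iff_injective _).1 inferInstance h2
      rw [← h] at inj
      exact Function.Injective.of_comp inj }⟩

/-! ### The tensor product over `C` and the Nakayama functor -/

section Tensor

variable {k : Type u} [CommRing k] {C : Type u} [SmallCategory C]

open scoped Classical in
/-- The relations `(m · f) ⊗ x = m ⊗ (f · x)`, for `f : c ⟶ c'`, `m ∈ M(c')` and `x ∈ F(c)`. -/
def tensorRel (M : Cᵒᵖ ⥤ ModuleCat.{u} k) (F : C ⥤ ModuleCat.{u} k) :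
    Submodule k (⨁ c : C, (M.obj (op c) ⊗[k] F.obj c)) :=
  Submodule.span k {z | ∃ (c c' : C) (f : c ⟶ c') (m : M.obj (op c')) (x : F.obj c),
    z = DirectSum.lof k C (fun c => M.obj (op c) ⊗[k] F.obj c) c (M.map f.op m ⊗ₜ[k] x) -
      DirectSum.lof k C (fun c => M.obj (op c) ⊗[k] F.obj c) c' (m ⊗ₜ[k] F.map f x)}

/-- The tensor product `M ⊗_C F` of a right `C`-module `M` and a left `C`-module `F`. -/
def tensorOver (M : Cᵒᵖ ⥤ ModuleCat.{u} k) (F : C ⥤ ModuleCat.{u} k) : ModuleCat.{u} k :=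
  ModuleCat.of k ((⨁ c : C, (M.obj (op c) ⊗[k] F.obj c)) ⧸ tensorRel M F)

open scoped Classical in
/-- The class of `m ⊗ x` in `M ⊗_C F`, for `m ∈ M(c)` and `x ∈ F(c)`. -/
def tensorMk (M : Cᵒᵖ ⥤ ModuleCat.{u} k) (F : C ⥤ ModuleCat.{u} k) (c : C) :
    M.obj (op c) →ₗ[k] F.obj c →ₗ[k] tensorOver M F :=
  (TensorProduct.mk k (M.obj (op c)) (F.obj c)).compr₂
    ((tensorRel M F).mkQ ∘ₗ DirectSum.lof k C (fun c => M.obj (op c) ⊗[k] F.obj c) c)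

lemma tensorMk_balanced (M : Cᵒᵖ ⥤ ModuleCat.{u} k) (F : C ⥤ ModuleCat.{u} k) {c c' : C}
    (f : c ⟶ c') (m : M.obj (op c')) (x : F.obj c) :
    tensorMk M F c (M.map f.op m) x = tensorMk M F c' m (F.map f x) :=
  (Submodule.Quotient.eq _).2 (Submodule.subset_span ⟨c, c', f, m, x, rfl⟩)

lemma tensor_hom_ext {M : Cᵒᵖ ⥤ ModuleCat.{u} k} {F : C ⥤ ModuleCat.{u} k}
    {N : Type*} [AddCommGroup N] [Module k N] {f g : tensorOver M F →ₗ[k] N}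
    (h : ∀ c m x, f (tensorMk M F c m x) = g (tensorMk M F c m x)) : f = g := by
  classical
  refine Submodule.linearMap_qext _ (DirectSum.linearMap_ext _ fun c => TensorProduct.ext' ?_)
  intro m x
  exact h c m x

open scoped Classical in
/-- The universal property of `M ⊗_C F`. -/
def tensorLift {M : Cᵒᵖ ⥤ ModuleCat.{u} k} {F : C ⥤ ModuleCat.{u} k}
    {N : Type*} [AddCommGroup N] [Module k N] (φ : ∀ c, M.obj (op c) →ₗ[k] F.obj c →ₗ[k] N)
    (h : ∀ {c c' : C} (f : c ⟶ c') (m : M.obj (op c')) (x : F.obj c),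
      φ c (M.map f.op m) x = φ c' m (F.map f x)) : tensorOver M F →ₗ[k] N :=
  (tensorRel M F).liftQ (DirectSum.toModule k C N fun c => TensorProduct.lift (φ c)) <| by
    refine Submodule.span_le.2 ?_
    rintro _ ⟨c, c', f, m, x, rfl⟩
    simp [h f m x]

lemma tensorLift_mk {M : Cᵒᵖ ⥤ ModuleCat.{u} k} {F : C ⥤ ModuleCat.{u} k}
    {N : Type*} [AddCommGroup N] [Module k N] (φ : ∀ c, M.obj (op c) →ₗ[k] F.obj c →ₗ[k] N)
    (h : ∀ {c c' : C} (f : c ⟶ c') (m : M.obj (op c')) (x : F.obj c),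
      φ c (M.map f.op m) x = φ c' m (F.map f x)) (c : C) (m : M.obj (op c)) (x : F.obj c) :
    tensorLift φ h (tensorMk M F c m x) = φ c m x := by
  classical
  change DirectSum.toModule k C N (fun c => TensorProduct.lift (φ c))
    (DirectSum.lof k C (fun c => M.obj (op c) ⊗[k] F.obj c) c (m ⊗ₜ[k] x)) = _
  simp

lemma tensorMap_aux {M M' : Cᵒᵖ ⥤ ModuleCat.{u} k} {F F' : C ⥤ ModuleCat.{u} k}
    (α : M ⟶ M') (β : F ⟶ F') {c c' : C} (f : c ⟶ c') (m : M.obj (op c')) (x : F.obj c) :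
    tensorMk M' F' c (α.app (op c) (M.map f.op m)) (β.app c x) =
      tensorMk M' F' c' (α.app (op c') m) (β.app c' (F.map f x)) := by
  have h₁ : α.app (op c) (M.map f.op m) = M'.map f.op (α.app (op c') m) :=
    congr($(α.naturality f.op) m)
  have h₂ : β.app c' (F.map f x) = F'.map f (β.app c x) := congr($(β.naturality f) x)
  rw [h₁, h₂, tensorMk_balanced]

/-- The functoriality of `M ⊗_C F`. -/
def tensorMap {M M' : Cᵒᵖ ⥤ ModuleCat.{u} k} {F F' : C ⥤ ModuleCat.{u} k}
    (α : M ⟶ M') (β : F ⟶ F') : tensorOver M F ⟶ tensorOver M' F' :=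
  ModuleCat.ofHom <| tensorLift (N := tensorOver M' F')
    (fun c => (tensorMk M' F' c).compl₁₂ (α.app (op c)).hom (β.app c).hom) (tensorMap_aux α β)

lemma tensorMap_mk {M M' : Cᵒᵖ ⥤ ModuleCat.{u} k} {F F' : C ⥤ ModuleCat.{u} k}
    (α : M ⟶ M') (β : F ⟶ F') (c : C) (m : M.obj (op c)) (x : F.obj c) :
    tensorMap α β (tensorMk M F c m x) = tensorMk M' F' c (α.app (op c) m) (β.app c x) :=
  tensorLift_mk (fun c => (tensorMk M' F' c).compl₁₂ (α.app (op c)).hom (β.app c).hom)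
    (tensorMap_aux α β) c m x

lemma tensorOver_hom_ext {M : Cᵒᵖ ⥤ ModuleCat.{u} k} {F : C ⥤ ModuleCat.{u} k}
    {N : ModuleCat.{u} k} {f g : tensorOver M F ⟶ N}
    (h : ∀ c m x, f (tensorMk M F c m x) = g (tensorMk M F c m x)) : f = g :=
  ModuleCat.hom_ext (tensor_hom_ext h)

lemma tensorMap_id (M : Cᵒᵖ ⥤ ModuleCat.{u} k) (F : C ⥤ ModuleCat.{u} k) :
    tensorMap (𝟙 M) (𝟙 F) = 𝟙 _ :=
  tensorOver_hom_ext fun c m x => tensorMap_mk _ _ c m x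

lemma tensorMap_comp {M M' M'' : Cᵒᵖ ⥤ ModuleCat.{u} k} {F F' F'' : C ⥤ ModuleCat.{u} k}
    (α : M ⟶ M') (α' : M' ⟶ M'') (β : F ⟶ F') (β' : F' ⟶ F'') :
    tensorMap (α ≫ α') (β ≫ β') = tensorMap α β ≫ tensorMap α' β' :=
  tensorOver_hom_ext fun c m x =>
    (tensorMap_mk _ _ c m x).trans
      ((congrArg (tensorMap α' β') (tensorMap_mk α β c m x)).trans (tensorMap_mk _ _ c _ _)).symm

lemma tensorMap_add_left {M M' : Cᵒᵖ ⥤ ModuleCat.{u} k} {F F' : C ⥤ ModuleCat.{u} k}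
    (α α' : M ⟶ M') (β : F ⟶ F') :
    tensorMap (α + α') β = tensorMap α β + tensorMap α' β :=
  tensorOver_hom_ext fun c m x => by
    refine (tensorMap_mk _ _ c m x).trans ?_
    refine Eq.trans ?_ congr($(tensorMap_mk α β c m x) + $(tensorMap_mk α' β c m x)).symm
    exact LinearMap.map_add₂ (tensorMk M' F' c) _ _ _

lemma tensorMap_add_right {M M' : Cᵒᵖ ⥤ ModuleCat.{u} k} {F F' : C ⥤ ModuleCat.{u} k}
    (α : M ⟶ M') (β β' : F ⟶ F') :
    tensorMap α (β + β') = tensorMap α β + tensorMap α β' :=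
  tensorOver_hom_ext fun c m x => by
    refine (tensorMap_mk _ _ c m x).trans ?_
    refine Eq.trans ?_ congr($(tensorMap_mk α β c m x) + $(tensorMap_mk α β' c m x)).symm
    exact (tensorMk M' F' c _).map_add _ _

lemma tensorMap_smul_left {M M' : Cᵒᵖ ⥤ ModuleCat.{u} k} {F F' : C ⥤ ModuleCat.{u} k}
    (r : k) (α : M ⟶ M') (β : F ⟶ F') :
    tensorMap (r • α) β = r • tensorMap α β :=
  tensorOver_hom_ext fun c m x => by
    refine (tensorMap_mk _ _ c m x).trans ?_
    refine Eq.trans ?_ congr(r • $(tensorMap_mk α β c m x)).symm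
    exact LinearMap.map_smul₂ (tensorMk M' F' c) _ _ _

end Tensor

variable (k C)

/-- The functor `c ↦ D(C(c, -))` to right `C`-modules, where `D = Hom_k(-, k)`. -/
def dualRight : C ⥤ Cᵒᵖ ⥤ ModuleCat.{u} k where
  obj c :=
    { obj := fun d => ModuleCat.of k (Module.Dual k (c ⟶ d.unop))
      map := fun f => ModuleCat.ofHom (Linear.rightComp k c f.unop).dualMap
      map_id := fun d => ModuleCat.hom_ext <| LinearMap.ext
        fun (φ : Module.Dual k (c ⟶ d.unop)) => LinearMap.ext fun (g : c ⟶ d.unop) =>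
          congrArg φ (Category.comp_id g)
      map_comp := fun {d _ d'} f f' => ModuleCat.hom_ext <| LinearMap.ext
        fun (φ : Module.Dual k (c ⟶ d.unop)) => LinearMap.ext fun (g : c ⟶ d'.unop) =>
          congrArg φ (Category.assoc g f'.unop f.unop).symm }
  map {c c'} h :=
    { app := fun d => ModuleCat.ofHom (X := Module.Dual k (c ⟶ d.unop))
        (Y := Module.Dual k (c' ⟶ d.unop)) (Linear.leftComp k d.unop h).dualMap
      naturality := fun d d' f => ModuleCat.hom_ext <| LinearMap.ext
        fun (φ : Module.Dual k (c ⟶ d.unop)) => LinearMap.ext fun (g : c' ⟶ d'.unop) =>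
          congrArg φ (Category.assoc h g f.unop) }
  map_id c := by
    ext d : 2
    exact ModuleCat.hom_ext <| LinearMap.ext fun (φ : Module.Dual k (c ⟶ d.unop)) =>
      LinearMap.ext fun (g : c ⟶ d.unop) => congrArg φ (Category.id_comp g)
  map_comp {c _ c''} h h' := by
    ext d : 2
    exact ModuleCat.hom_ext <| LinearMap.ext fun (φ : Module.Dual k (c ⟶ d.unop)) =>
      LinearMap.ext fun (g : c'' ⟶ d.unop) => congrArg φ (Category.assoc h h' g)

/-- The functor `c ↦ D(C(-, c))` to left `C`-modules, where `D = Hom_k(-, k)`. -/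
def dualLeft : Cᵒᵖ ⥤ LMod k C where
  obj c :=
    ⟨{ obj := fun d => ModuleCat.of k (Module.Dual k (d ⟶ c.unop))
       map := fun f => ModuleCat.ofHom (Linear.leftComp k c.unop f).dualMap
       map_id := fun d => ModuleCat.hom_ext <| LinearMap.ext
        fun (φ : Module.Dual k (d ⟶ c.unop)) => LinearMap.ext fun (g : d ⟶ c.unop) =>
          congrArg φ (Category.id_comp g)
       map_comp := fun {d _ d'} f f' => ModuleCat.hom_ext <| LinearMap.ext
        fun (φ : Module.Dual k (d ⟶ c.unop)) => LinearMap.ext fun (g : d' ⟶ c.unop) =>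
          congrArg φ (Category.assoc f f' g) },
      ⟨fun {d d' f f'} => ModuleCat.hom_ext <| LinearMap.ext
        fun (φ : Module.Dual k (d ⟶ c.unop)) => LinearMap.ext fun (g : d' ⟶ c.unop) =>
          (congrArg φ (Preadditive.add_comp _ _ _ f f' g)).trans (map_add φ _ _)⟩,
      ⟨fun {d d'} f r => ModuleCat.hom_ext <| LinearMap.ext
        fun (φ : Module.Dual k (d ⟶ c.unop)) => LinearMap.ext fun (g : d' ⟶ c.unop) =>
          (congrArg φ (Linear.smul_comp _ _ _ r f g)).trans (map_smul φ _ _)⟩⟩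
  map {c c'} h := ObjectProperty.homMk
    { app := fun d => ModuleCat.ofHom (X := Module.Dual k (d ⟶ c.unop))
        (Y := Module.Dual k (d ⟶ c'.unop)) (Linear.rightComp k d h.unop).dualMap
      naturality := fun d d' f => ModuleCat.hom_ext <| LinearMap.ext
        fun (φ : Module.Dual k (d ⟶ c.unop)) => LinearMap.ext fun (g : d' ⟶ c'.unop) =>
          congrArg φ (Category.assoc f g h.unop).symm }
  map_id c := by
    ext d : 3
    exact ModuleCat.hom_ext <| LinearMap.ext fun (φ : Module.Dual k (d ⟶ c.unop)) =>
      LinearMap.ext fun (g : d ⟶ c.unop) => congrArg φ (Category.comp_id g)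
  map_comp {c _ c''} h h' := by
    ext d : 3
    exact ModuleCat.hom_ext <| LinearMap.ext fun (φ : Module.Dual k (d ⟶ c.unop)) =>
      LinearMap.ext fun (g : d ⟶ c''.unop) =>
        congrArg φ (Category.assoc g h'.unop h.unop).symm

lemma dualRight_map_add {c c' : C} (h h' : c ⟶ c') :
    (dualRight k C).map (h + h') = (dualRight k C).map h + (dualRight k C).map h' := by
  ext d : 2
  exact ModuleCat.hom_ext <| LinearMap.ext fun (φ : Module.Dual k (c ⟶ d.unop)) =>
    LinearMap.ext fun (g : c' ⟶ d.unop) =>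
      (congrArg φ (Preadditive.add_comp _ _ _ h h' g)).trans (map_add φ _ _)

lemma dualRight_map_smul {c c' : C} (r : k) (h : c ⟶ c') :
    (dualRight k C).map (r • h) = r • (dualRight k C).map h := by
  ext d : 2
  exact ModuleCat.hom_ext <| LinearMap.ext fun (φ : Module.Dual k (c ⟶ d.unop)) =>
    LinearMap.ext fun (g : c' ⟶ d.unop) =>
      (congrArg φ (Linear.smul_comp _ _ _ r h g)).trans (map_smul φ _ _)

lemma dualLeft_map_add {c c' : C} (h h' : c ⟶ c') :
    (dualLeft k C).map (h + h').op = (dualLeft k C).map h.op + (dualLeft k C).map h'.op := by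
  ext d : 3
  exact ModuleCat.hom_ext <| LinearMap.ext fun (φ : Module.Dual k (d ⟶ c')) =>
    LinearMap.ext fun (g : d ⟶ c) =>
      (congrArg φ (Preadditive.comp_add _ _ _ g h h')).trans (map_add φ _ _)

lemma dualLeft_map_smul {c c' : C} (r : k) (h : c ⟶ c') :
    (dualLeft k C).map (r • h).op = r • (dualLeft k C).map h.op := by
  ext d : 3
  exact ModuleCat.hom_ext <| LinearMap.ext fun (φ : Module.Dual k (d ⟶ c')) =>
    LinearMap.ext fun (g : d ⟶ c) =>
      (congrArg φ (Linear.comp_smul _ _ _ g r h)).trans (map_smul φ _ _)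

/-- The Nakayama functor `ν(F) = D(C) ⊗_C F`, i.e. `ν(F)(c) = D(C(c, -)) ⊗_C F`. -/
def nakayama : LMod k C ⥤ LMod k C where
  obj F :=
    ⟨{ obj := fun c => tensorOver ((dualRight k C).obj c) F.obj
       map := fun h => tensorMap ((dualRight k C).map h) (𝟙 F.obj)
       map_id := fun c => by rw [CategoryTheory.Functor.map_id, tensorMap_id]
       map_comp := fun f g => by
        rw [CategoryTheory.Functor.map_comp, ← tensorMap_comp, Category.comp_id] },
      ⟨fun {_ _ f g} => (congrArg (tensorMap · (𝟙 F.obj)) (dualRight_map_add k C f g)).trans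
        (tensorMap_add_left _ _ _)⟩,
      ⟨fun {_ _} f r => (congrArg (tensorMap · (𝟙 F.obj)) (dualRight_map_smul k C r f)).trans
        (tensorMap_smul_left _ _ _)⟩⟩
  map {F G} β := ObjectProperty.homMk
    { app := fun c => tensorMap (𝟙 ((dualRight k C).obj c)) β.hom
      naturality := fun c d f => by
        rw [← tensorMap_comp, ← tensorMap_comp]
        simp only [Category.comp_id, Category.id_comp] }
  map_id F := by
    ext c : 3; exact tensorMap_id _ _
  map_comp {F G H} β γ := by
    ext c : 3
    exact (congrArg (tensorMap · (β.hom ≫ γ.hom))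
      (Category.comp_id (𝟙 ((dualRight k C).obj c))).symm).trans (tensorMap_comp _ _ _ _)

instance : (nakayama k C).Additive where
  map_add {F G β γ} := by
    ext c : 3; exact tensorMap_add_right _ _ _

/-- The right adjoint `ν⁻(G)(c) = Hom_C(D(C(-, c)), G)` of the Nakayama functor. -/
def nakayamaInv : LMod k C ⥤ LMod k C where
  obj G := ⟨(dualLeft k C).rightOp ⋙ (linearYoneda k (LMod k C)).obj G,
    ⟨fun {c c' f g} => ModuleCat.hom_ext <| LinearMap.ext
      fun (φ : (dualLeft k C).obj (op c) ⟶ G) =>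
        (congrArg (· ≫ φ) (dualLeft_map_add k C f g)).trans (Preadditive.add_comp _ _ _ _ _ φ)⟩,
    ⟨fun {c c'} f r => ModuleCat.hom_ext <| LinearMap.ext
      fun (φ : (dualLeft k C).obj (op c) ⟶ G) =>
        (congrArg (· ≫ φ) (dualLeft_map_smul k C r f)).trans (Linear.smul_comp _ _ _ r _ φ)⟩⟩
  map {G G'} g := ObjectProperty.homMk
    (Functor.whiskerLeft (dualLeft k C).rightOp ((linearYoneda k (LMod k C)).map g))

instance : (nakayamaInv k C).Additive where
  map_add {F G β γ} := by
    ext c : 3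
    exact ModuleCat.hom_ext <| LinearMap.ext fun (φ : (dualLeft k C).obj (op c) ⟶ F) =>
      Preadditive.comp_add _ _ _ φ β γ

variable {k C}

lemma nakayama_map_app_mk {F G : LMod k C} (β : F ⟶ G) (d c : C) (φ : Module.Dual k (d ⟶ c))
    (x : F.obj.obj c) :
    ((nakayama k C).map β).hom.app d (tensorMk ((dualRight k C).obj d) F.obj c φ x) =
      tensorMk ((dualRight k C).obj d) G.obj c φ (β.hom.app c x) :=
  tensorMap_mk _ _ c _ x

lemma nakayama_obj_map_mk (F : LMod k C) {d d' : C} (h : d ⟶ d') (c : C)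
    (φ : Module.Dual k (d ⟶ c)) (x : F.obj.obj c) :
    ((nakayama k C).obj F).obj.map h (tensorMk ((dualRight k C).obj d) F.obj c φ x) =
      tensorMk ((dualRight k C).obj d') F.obj c ((dualRight k C).map h |>.app (op c) φ) x :=
  tensorMap_mk _ _ c _ x

/-- The bilinear maps `D(C(d, c)) × F(c) ⟶ G(d)` given by a morphism `F ⟶ ν⁻ G`. -/
def nakayamaBilin {F G : LMod k C} (b : F ⟶ (nakayamaInv k C).obj G) (d c : C) :
    Module.Dual k (d ⟶ c) →ₗ[k] F.obj.obj c →ₗ[k] G.obj.obj d :=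
  LinearMap.mk₂ k (fun φ x => (show (dualLeft k C).obj (op c) ⟶ G from b.hom.app c x).hom.app d φ)
    (fun φ ψ x =>
      map_add ((show (dualLeft k C).obj (op c) ⟶ G from b.hom.app c x).hom.app d).hom φ ψ)
    (fun r φ x =>
      map_smul ((show (dualLeft k C).obj (op c) ⟶ G from b.hom.app c x).hom.app d).hom r φ)
    (fun φ x y => congr((show (dualLeft k C).obj (op c) ⟶ G from
      $(map_add (b.hom.app c).hom x y)).hom.app d φ))
    (fun r φ x => congr((show (dualLeft k C).obj (op c) ⟶ G from
      $(map_smul (b.hom.app c).hom r x)).hom.app d φ))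

lemma nakayamaBilin_balanced {F G : LMod k C} (b : F ⟶ (nakayamaInv k C).obj G) (d : C)
    {c c' : C} (f : c ⟶ c') (φ : Module.Dual k (d ⟶ c')) (x : F.obj.obj c) :
    nakayamaBilin b d c (((dualRight k C).obj d).map f.op φ) x =
      nakayamaBilin b d c' φ (F.obj.map f x) :=
  congr((show (dualLeft k C).obj (op c') ⟶ G from $(b.hom.naturality f) x).hom.app d φ).symm

/-- The components of the morphism `ν F ⟶ G` given by a morphism `F ⟶ ν⁻ G`. -/
def nakayamaDesc {F G : LMod k C} (b : F ⟶ (nakayamaInv k C).obj G) (d : C) :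
    ((nakayama k C).obj F).obj.obj d ⟶ G.obj.obj d :=
  ModuleCat.ofHom <| tensorLift (M := (dualRight k C).obj d) (F := F.obj) (N := G.obj.obj d)
    (nakayamaBilin b d) (nakayamaBilin_balanced b d)

lemma nakayamaDesc_mk {F G : LMod k C} (b : F ⟶ (nakayamaInv k C).obj G) (d c : C)
    (φ : Module.Dual k (d ⟶ c)) (x : F.obj.obj c) :
    nakayamaDesc b d (tensorMk ((dualRight k C).obj d) F.obj c φ x) = nakayamaBilin b d c φ x :=
  tensorLift_mk (M := (dualRight k C).obj d) (nakayamaBilin b d) (nakayamaBilin_balanced b d) c φ x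

lemma nakayamaBilin_naturality {F G : LMod k C} (b : F ⟶ (nakayamaInv k C).obj G) {d d' : C}
    (h : d ⟶ d') (c : C) (φ : Module.Dual k (d ⟶ c)) (x : F.obj.obj c) :
    nakayamaBilin b d' c (((dualRight k C).map h).app (op c) φ) x =
      G.obj.map h (nakayamaBilin b d c φ x) :=
  congr($((show (dualLeft k C).obj (op c) ⟶ G from b.hom.app c x).hom.naturality h) φ)

/-- The bijection `Hom(ν F, G) ≃ Hom(F, ν⁻ G)`. -/
def nakayamaHomEquiv (F G : LMod k C) :
    ((nakayama k C).obj F ⟶ G) ≃ (F ⟶ (nakayamaInv k C).obj G) where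
  toFun a := ObjectProperty.homMk
    { app := fun c => ModuleCat.ofHom (Y := (dualLeft k C).obj (op c) ⟶ G)
        { toFun := fun x => ObjectProperty.homMk
            { app := fun d => ModuleCat.ofHom (X := Module.Dual k (d ⟶ c)) (Y := G.obj.obj d)
                ((a.hom.app d).hom ∘ₗ (tensorMk ((dualRight k C).obj d) F.obj c).flip x)
              naturality := fun d d' h => ModuleCat.hom_ext <| LinearMap.ext
                fun (φ : Module.Dual k (d ⟶ c)) =>
                  (congrArg (a.hom.app d') (nakayama_obj_map_mk F h c φ x)).symm.trans
                  congr($(a.hom.naturality h) (tensorMk ((dualRight k C).obj d) F.obj c φ x)) }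
          map_add' := fun x y => by
            ext d : 3
            exact ModuleCat.hom_ext <| LinearMap.ext fun (φ : Module.Dual k (d ⟶ c)) =>
              (congrArg (a.hom.app d) (map_add (tensorMk ((dualRight k C).obj d) F.obj c φ) x y)).trans
                (map_add (a.hom.app d).hom _ _)
          map_smul' := fun r x => by
            ext d : 3
            exact ModuleCat.hom_ext <| LinearMap.ext fun (φ : Module.Dual k (d ⟶ c)) =>
              (congrArg (a.hom.app d) (map_smul (tensorMk ((dualRight k C).obj d) F.obj c φ) r x)).trans
                (map_smul (a.hom.app d).hom _ _) }
      naturality := fun c c' h => ModuleCat.hom_ext <| LinearMap.ext fun x => by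
        refine InducedCategory.hom_ext (NatTrans.ext (funext fun d => ?_))
        exact ModuleCat.hom_ext <| LinearMap.ext fun (φ : Module.Dual k (d ⟶ c')) =>
          congrArg (a.hom.app d)
            (tensorMk_balanced ((dualRight k C).obj d) F.obj h φ x).symm }
  invFun b := ObjectProperty.homMk
    { app := nakayamaDesc b
      naturality := fun d d' h => tensorOver_hom_ext fun c (φ : Module.Dual k (d ⟶ c)) x =>
        (congrArg (nakayamaDesc b d') (nakayama_obj_map_mk F h c φ x)).trans <|
        (nakayamaDesc_mk b d' c _ x).trans <|
        (nakayamaBilin_naturality b h c φ x).trans <|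
        (congrArg (G.obj.map h) (nakayamaDesc_mk b d c φ x)).symm }
  left_inv a := by
    ext d : 3
    exact tensorOver_hom_ext fun c φ x => nakayamaDesc_mk _ d c φ x
  right_inv b := by
    ext c : 3
    refine ModuleCat.hom_ext <| LinearMap.ext fun x => ?_
    refine InducedCategory.hom_ext (NatTrans.ext (funext fun d => ?_))
    exact ModuleCat.hom_ext <| LinearMap.ext fun (φ : Module.Dual k (d ⟶ c)) =>
      nakayamaDesc_mk b d c φ x

variable (k C) in
/-- The functor `ν⁻` is right adjoint to `ν`. -/
def nakayamaAdjunction : nakayama k C ⊣ nakayamaInv k C :=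
  Adjunction.mkOfHomEquiv
    { homEquiv := nakayamaHomEquiv
      homEquiv_naturality_left_symm := fun f g => by
        ext d : 3
        exact tensorOver_hom_ext fun c φ x =>
          (nakayamaDesc_mk (f ≫ g) d c φ x).trans <|
          (nakayamaDesc_mk g d c φ _).symm.trans
            (congrArg (nakayamaDesc g d) (nakayama_map_app_mk f d c φ x)).symm
      homEquiv_naturality_right := fun f g => rfl }

end LMod

/-! ### The Gorenstein conditions -/

section Gorenstein

/-- Each object has nonzero morphisms to, and from, only finitely many objects. -/
def IsLocallyBounded (C : Type u) [SmallCategory C] [Preadditive C] : Prop :=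
  ∀ c : C, {c' : C | ∃ f : c ⟶ c', f ≠ 0}.Finite ∧ {c' : C | ∃ f : c' ⟶ c, f ≠ 0}.Finite

variable (k : Type u) [CommRing k] (C : Type u) [SmallCategory C] [Preadditive C] [Linear k C]

/-- All `C(c, c')` are finitely generated projective `k`-modules. -/
def IsHomFinite : Prop :=
  ∀ c c' : C, Module.Finite k (c ⟶ c') ∧ Module.Projective k (c ⟶ c')

/-- For `C` locally bounded and Hom-finite, `ν` is a Nakayama functor relative to `i_! ⊣ i^*`, where
`i^*` is the evaluation functor `C-Mod ⟶ ∏_c k-Mod`. The endofunctor `P = i_! ∘ i^*` of `C-Mod` is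
Iwanaga-Gorenstein: `L_i ν = 0` and `R^i ν⁻ = 0` for all sufficiently large `i`. -/
def IsIwanagaGorenstein : Prop :=
  ∃ n : ℕ, ∀ i, n < i →
    IsZero ((nakayama k C).leftDerived i) ∧ IsZero ((nakayamaInv k C).rightDerived i)

/-- The endofunctor `P = i_! ∘ i^*` of `C-Mod` is `n`-Gorenstein: it is Iwanaga-Gorenstein, and `n`
is its Gorenstein dimension, the smallest `r` such that `L_i ν = 0` for all `i > r`. -/
def IsGorensteinOfDim (n : ℕ) : Prop :=
  IsIwanagaGorenstein k C ∧
    IsLeast {r : ℕ | ∀ i, r < i → IsZero ((nakayama k C).leftDerived i)} n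

/-- `C` is left `m`-Gorenstein: the global Gorenstein projective dimension of `C-Mod` is the
natural number `m`. -/
def IsLeftGorenstein (m : ℕ) : Prop := glGpdim (LMod k C) = m

end Gorenstein

/-! ### The tensor product of linear categories -/

/-- The objects of the tensor product `C ⊗_k D` of two `k`-linear categories: pairs of objects. -/
@[ext]
structure TensorCat (k : Type u) (C D : Type u) where
  fst : C
  snd : D

section TensorCat

variable {k : Type u} [CommRing k] {C D : Type u}
variable [SmallCategory C] [Preadditive C] [Linear k C] [SmallCategory D] [Preadditive D]
  [Linear k D]

/-- `(C ⊗_k D)((c, d), (c', d')) = C(c, c') ⊗_k D(d, d')`, with composition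
`(f ⊗ g) ≫ (f' ⊗ g') = (f ≫ f') ⊗ (g ≫ g')`. -/
instance : SmallCategory (TensorCat k C D) where
  Hom X Y := (X.fst ⟶ Y.fst) ⊗[k] (X.snd ⟶ Y.snd)
  id X := 𝟙 X.fst ⊗ₜ 𝟙 X.snd
  comp {X Y Z} f g := TensorProduct.map₂ (Linear.comp X.fst Y.fst Z.fst)
    (Linear.comp X.snd Y.snd Z.snd) f g
  id_comp {X Y} f := by
    induction f using TensorProduct.induction_on with
    | zero => simp
    | add x y hx hy => rw [map_add, hx, hy]
    | tmul x y => simp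
  comp_id {X Y} f := by
    induction f using TensorProduct.induction_on with
    | zero => simp
    | add x y hx hy => rw [map_add, LinearMap.add_apply, hx, hy]
    | tmul x y => simp
  assoc f g h := by
    induction f using TensorProduct.induction_on with
    | zero => simp
    | add x y hx hy => simp only [map_add, LinearMap.add_apply, hx, hy]
    | tmul f f' =>
      induction g using TensorProduct.induction_on with
      | zero => simp
      | add x y hx hy => simp only [map_add, LinearMap.add_apply, hx, hy]
      | tmul g g' =>
        induction h using TensorProduct.induction_on with
        | zero => simp
        | add x y hx hy => simp only [map_add, hx, hy]
        | tmul h h' => simp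

instance : Preadditive (TensorCat k C D) where
  homGroup X Y := inferInstanceAs (AddCommGroup ((X.fst ⟶ Y.fst) ⊗[k] (X.snd ⟶ Y.snd)))
  add_comp X Y Z f f' g := LinearMap.map_add₂ (TensorProduct.map₂
    (Linear.comp (S := k) X.fst Y.fst Z.fst) (Linear.comp X.snd Y.snd Z.snd)) f f' g
  comp_add X Y Z f g g' := (TensorProduct.map₂
    (Linear.comp (S := k) X.fst Y.fst Z.fst) (Linear.comp X.snd Y.snd Z.snd) f).map_add g g'

instance : Linear k (TensorCat k C D) where
  homModule X Y := inferInstanceAs (Module k ((X.fst ⟶ Y.fst) ⊗[k] (X.snd ⟶ Y.snd)))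
  smul_comp X Y Z r f g := LinearMap.map_smul₂ (TensorProduct.map₂
    (Linear.comp (S := k) X.fst Y.fst Z.fst) (Linear.comp X.snd Y.snd Z.snd)) r f g
  comp_smul X Y Z f r g := (TensorProduct.map₂
    (Linear.comp (S := k) X.fst Y.fst Z.fst) (Linear.comp X.snd Y.snd Z.snd) f).map_smul r g

end TensorCat

end GorensteinModules

end

/-! Let `A` be abelian with enough projectives and injectives. Finiteness of the global Gorenstein
projective dimension can be read off from ordinary dimensions. If `glGpdim A ≤ n`, then projectives
have injective dimension at most `n` and injectives have projective dimension at most `n`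
(`injectiveDimension_le_of_glGpdim_le`, `projectiveDimension_le_of_glGpdim_le`). Conversely,
`glGpdim_le` needs the bound `n` only for the projectives; for the injectives any finite bound will
do. So it suffices to transport both bounds from `C'` (called `D` in the lemmas) to `C' ⊗ C`, and
only the one for projectives has to be sharp.

The Nakayama functors control the factor `C`. Write `*` for the `k`-dual. Since `ν⁻(G)(c) = Hom(C(-,
c)*, G)`, vanishing of `R^i ν⁻` bounds the projective dimension of `C(-, c)*`
(`projectiveDimension_dualLeft`). For `E` injective over `k`, maps `ν(F)(c) ⟶ E` are maps `F ⟶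
Hom_k(C(c, -)*, E)`, so vanishing of `L_i ν` bounds the injective dimension of `Hom_k(C(c, -)*, E)`
(`injectiveDimension_hom_dual`).

An injective module over `C' ⊗ C` is a retract of a product over `c` of modules `Hom_k(C(-, c),
E_c)` with `E_c` injective over `C'`. Hom-finiteness turns the factors into `C(-, c)* ⊗ E_c`, local
boundedness turns the product into a coproduct, and `projectiveDimension_box` adds the two
projective dimensions. Dually, a projective module is a retract of a coproduct of modules `C(c, -) ⊗
X_c ≅ Hom_k(C(c, -)*, X_c)` with `X_c` projective over `C'`; the coproduct is a product, and
`injectiveDimension_bihom` gives the bound `m + n`. Nothing is assumed about `C'(a, b)` as a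
`k`-module, so exactness comes from projectivity of the Hom-modules of `C` or from pointwise
splittings. -/

noncomputable section

namespace GorensteinModules

/-! ### Short exact sequences in an abelian category: splitting, pushouts, horseshoes. -/

section ShortExact

variable {A : Type u} [Category.{v} A] [Abelian A]

/-- The sequence `0 ⟶ X ⟶ Y ⟶ Z ⟶ 0` given by `f` and `g` is exact. -/
def SES {X Y Z : A} (f : X ⟶ Y) (g : Y ⟶ Z) : Prop :=
  ∃ w : f ≫ g = 0, (ShortComplex.mk f g w).ShortExact

namespace SES

variable {X Y Z : A} {f : X ⟶ Y} {g : Y ⟶ Z}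

lemma comp_eq_zero (h : SES f g) : f ≫ g = 0 := h.choose

lemma mono (h : SES f g) : Mono f := h.choose_spec.mono_f

lemma epi (h : SES f g) : Epi g := h.choose_spec.epi_g

lemma exists_lift (h : SES f g) {T : A} (x : T ⟶ Y) (hx : x ≫ g = 0) : ∃ y, y ≫ f = x :=
  have := h.mono
  ⟨h.choose_spec.exact.lift x hx, h.choose_spec.exact.lift_f x hx⟩

lemma exists_desc (h : SES f g) {T : A} (x : Y ⟶ T) (hx : f ≫ x = 0) : ∃ y, g ≫ y = x :=
  have := h.epi
  ⟨h.choose_spec.exact.desc x hx, h.choose_spec.exact.g_desc x hx⟩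

lemma of_lift (w : f ≫ g = 0) [Mono f] [Epi g]
    (H : ∀ {T : A} (x : T ⟶ Y), x ≫ g = 0 → ∃ y, y ≫ f = x) : SES f g := by
  refine ⟨w, ?_⟩
  have : (ShortComplex.mk f g w).Exact :=
    (ShortComplex.mk f g w).exact_of_f_is_kernel
      (KernelFork.IsLimit.ofι' f w fun x hx => ⟨(H x hx).choose, (H x hx).choose_spec⟩)
  exact { exact := this }

lemma op (h : SES f g) : SES g.op f.op :=
  ⟨by rw [← op_comp, h.comp_eq_zero]; rfl, h.choose_spec.op⟩

lemma unop {X Y Z : Aᵒᵖ} {f : X ⟶ Y} {g : Y ⟶ Z} (h : SES f g) : SES g.unop f.unop :=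
  ⟨by rw [← unop_comp, h.comp_eq_zero]; rfl, h.choose_spec.unop⟩

lemma of_desc (w : f ≫ g = 0) [Mono f] [Epi g]
    (H : ∀ {T : A} (x : Y ⟶ T), f ≫ x = 0 → ∃ y, g ≫ y = x) : SES f g := by
  have : SES g.op f.op := of_lift (by rw [← op_comp, w]; rfl) fun {T} x hx => by
    obtain ⟨y, hy⟩ := H x.unop (Quiver.Hom.op_inj hx)
    exact ⟨y.op, Quiver.Hom.unop_inj hy⟩
  exact this.unop

lemma of_mono (f : X ⟶ Y) [Mono f] : SES f (cokernel.π f) :=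
  of_desc (cokernel.condition f) fun x hx => ⟨cokernel.desc f x hx, cokernel.π_desc f x hx⟩

lemma of_epi (g : Y ⟶ Z) [Epi g] : SES (kernel.ι g) g :=
  of_lift (kernel.condition g) fun x hx => ⟨kernel.lift g x hx, kernel.lift_ι g x hx⟩

lemma of_isZero_right (h : IsZero Z) (f : X ⟶ Y) (g : Y ⟶ Z) [IsIso f] : SES f g :=
  have : Epi g := ⟨fun _ _ _ => h.eq_of_src _ _⟩
  of_lift (h.eq_of_tgt _ _) fun x _ => ⟨x ≫ inv f, by simp⟩

lemma biprod (X Z : A) : SES (biprod.inl : X ⟶ X ⊞ Z) biprod.snd :=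
  of_lift biprod.inl_snd fun x hx => ⟨x ≫ biprod.fst, by ext <;> simp [hx]⟩

lemma iso_right {Z' : A} (h : SES f g) (e : Z ≅ Z') : SES f (g ≫ e.hom) :=
  have := h.mono
  have := h.epi
  of_lift (by rw [← Category.assoc, h.comp_eq_zero, zero_comp]) fun x hx =>
    h.exists_lift x (by rwa [← Category.assoc, ← cancel_mono e.inv, Category.assoc, e.hom_inv_id,
      Category.comp_id, zero_comp] at hx)

/-- If the first term of a short exact sequence has the extension property, the sequence splits,
and the second map admits a complementary monomorphism. -/
lemma rotate_of_retraction (h : SES f g) (r : Y ⟶ X) (hr : f ≫ r = 𝟙 X) :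
    ∃ s : Z ⟶ Y, s ≫ g = 𝟙 Z ∧ SES s r := by
  have := h.mono
  have := h.epi
  -- `𝟙 Y - r ≫ f` is the idempotent complementary to `r ≫ f`. It kills `f`, hence factors through
  -- `g`, and the factor is the section.
  obtain ⟨s, hs⟩ := h.exists_desc (𝟙 Y - r ≫ f)
    (by rw [Preadditive.comp_sub, ← Category.assoc, hr]; simp)
  have hsg : s ≫ g = 𝟙 Z := by
    rw [← cancel_epi g, ← Category.assoc, hs, Preadditive.sub_comp, Category.assoc,
      h.comp_eq_zero]; simp
  have hsr : s ≫ r = 0 := by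
    rw [← cancel_epi g, ← Category.assoc, hs, Preadditive.sub_comp, Category.assoc, hr]; simp
  have : Mono s := mono_of_mono_fac hsg
  have : Epi r := epi_of_epi_fac hr
  refine ⟨s, hsg, of_lift hsr fun x hx => ⟨x ≫ g, ?_⟩⟩
  rw [Category.assoc, hs, Preadditive.comp_sub, ← Category.assoc x r f, hx]; simp

/-- The pushout of a short exact sequence. -/
lemma pushout (h : SES f g) {X' W : A} {a : X ⟶ X'} {r : Y ⟶ W} {b : X' ⟶ W}
    (sq : IsPushout f a r b) : ∃ q : W ⟶ Z, SES b q ∧ r ≫ q = g := by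
  have := h.mono
  have := h.epi
  have : Mono b := MorphismProperty.of_isPushout (P := MorphismProperty.monomorphisms A) sq.flip
    (MorphismProperty.monomorphisms.infer_property f)
  let q := sq.desc g (0 : X' ⟶ Z) (by rw [h.comp_eq_zero, comp_zero])
  have hq : r ≫ q = g := sq.inl_desc _ _ _
  have : Epi q := epi_of_epi_fac hq
  refine ⟨q, of_desc (sq.inr_desc _ _ _) fun x hx => ?_, hq⟩
  obtain ⟨y, hy⟩ := h.exists_desc (r ≫ x) (by rw [← Category.assoc, sq.w, Category.assoc, hx,
    comp_zero])
  refine ⟨y, sq.hom_ext ?_ ?_⟩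
  · rw [← Category.assoc, hq, hy]
  · rw [← Category.assoc, sq.inr_desc, zero_comp, hx]

lemma exists_pushout (h : SES f g) {X' : A} (a : X ⟶ X') :
    ∃ (W : A) (r : Y ⟶ W) (b : X' ⟶ W) (q : W ⟶ Z), IsPushout f a r b ∧ SES b q ∧ r ≫ q = g :=
  have ⟨q, h₁, h₂⟩ := h.pushout (IsPushout.of_hasPushout f a)
  ⟨_, _, _, q, IsPushout.of_hasPushout f a, h₁, h₂⟩

/-- The quotient sequence `0 ⟶ Y/X ⟶ W/X ⟶ W/Y ⟶ 0`, for monomorphisms `X ⟶ Y ⟶ W`. -/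
lemma exists_quotient (h : SES f g) {W G : A} {i : Y ⟶ W} {p : W ⟶ G} (h' : SES i p) :
    ∃ (H : A) (π : W ⟶ H) (j : Z ⟶ H) (q : H ⟶ G), SES (f ≫ i) π ∧ SES j q := by
  obtain ⟨H, π, j, q, sq, hj, hq⟩ := h'.exists_pushout g
  have := h.mono
  have := h.epi
  have := h'.mono
  have := hj.mono
  have : Epi π := MorphismProperty.of_isPushout (P := MorphismProperty.epimorphisms A) sq
    (MorphismProperty.epimorphisms.infer_property g)
  refine ⟨H, π, j, q, of_lift ?_ fun x hx => ?_, hj⟩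
  · rw [Category.assoc, sq.w, ← Category.assoc, h.comp_eq_zero, zero_comp]
  · obtain ⟨y, rfl⟩ := h'.exists_lift x (by rw [← hq, ← Category.assoc, hx, zero_comp])
    rw [Category.assoc, sq.w, ← Category.assoc] at hx
    obtain ⟨z, rfl⟩ := h.exists_lift y (zero_of_comp_mono j hx)
    exact ⟨z, (Category.assoc _ _ _).symm⟩

/-- The exact sequence of kernels of a morphism of short exact sequences with epimorphic
components. -/
lemma kernels {X' Y' Z' : A} {f' : X' ⟶ Y'} {g' : Y' ⟶ Z'} (h : SES f g) (h' : SES f' g')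
    {a : X ⟶ X'} {b : Y ⟶ Y'} {c : Z ⟶ Z'} (hab : f ≫ b = a ≫ f') (hbc : g ≫ c = b ≫ g')
    {K L M : A} {i : K ⟶ X} {j : L ⟶ Y} {l : M ⟶ Z} (hi : SES i a) (hj : SES j b)
    (hl : SES l c) : ∃ (p : K ⟶ L) (q : L ⟶ M), SES p q := by
  have := h.mono
  have := h'.mono
  have := hi.mono
  have := hj.mono
  have := hl.mono
  have := hi.epi
  have := h.epi
  obtain ⟨p, hp⟩ := hj.exists_lift (i ≫ f) (by rw [Category.assoc, hab, ← Category.assoc,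
    hi.comp_eq_zero, zero_comp])
  obtain ⟨q, hq⟩ := hl.exists_lift (j ≫ g) (by rw [Category.assoc, hbc, ← Category.assoc,
    hj.comp_eq_zero, zero_comp])
  have : Mono p := mono_of_mono_fac hp
  -- The diagram chase of the snake lemma: lift an element of `M` to `y` in `Y`. Its image in `Y'`
  -- comes from `X'`, hence, `a` being epi, from some `t` in `X`; then `y` minus the image of `t`
  -- lies in the kernel `L`.
  have hepi : Epi q := by
    rw [epi_iff_surjective_up_to_refinements]
    intro T x
    obtain ⟨T₁, π₁, _, y, hy⟩ := surjective_up_to_refinements_of_epi g (x ≫ l)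
    obtain ⟨z, hz⟩ := h'.exists_lift (y ≫ b) (by
      rw [Category.assoc, ← hbc, ← Category.assoc, ← hy, Category.assoc, Category.assoc,
        hl.comp_eq_zero, comp_zero, comp_zero])
    obtain ⟨T₂, π₂, _, t, ht⟩ := surjective_up_to_refinements_of_epi a z
    obtain ⟨s, hs⟩ := hj.exists_lift (π₂ ≫ y - t ≫ f) (by
      rw [Preadditive.sub_comp, Category.assoc, Category.assoc, hab, ← Category.assoc t, ← ht,
        Category.assoc, hz, sub_self])
    refine ⟨T₂, π₂ ≫ π₁, epi_comp _ _, s, ?_⟩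
    rw [← cancel_mono l, Category.assoc s, hq, ← Category.assoc s, hs, Preadditive.sub_comp,
      Category.assoc t, h.comp_eq_zero, comp_zero, sub_zero]
    simp [hy]
  refine ⟨p, q, of_lift ?_ fun x hx => ?_⟩
  · rw [← cancel_mono l, Category.assoc, hq, ← Category.assoc, hp, Category.assoc,
      h.comp_eq_zero, comp_zero, zero_comp]
  · obtain ⟨y, hy⟩ := h.exists_lift (x ≫ j) (by
      rw [Category.assoc, ← hq, ← Category.assoc, hx, zero_comp])
    obtain ⟨z, hz⟩ := hi.exists_lift y (by
      rw [← cancel_mono f', Category.assoc, ← hab, ← Category.assoc, hy, Category.assoc,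
        hj.comp_eq_zero, comp_zero, zero_comp])
    exact ⟨z, by rw [← cancel_mono j, Category.assoc, hp, ← Category.assoc, hz, hy]⟩

/-- The exact sequence of cokernels of a morphism of short exact sequences with monomorphic
components. -/
lemma cokernels {X' Y' Z' : A} {f' : X' ⟶ Y'} {g' : Y' ⟶ Z'} (h : SES f g) (h' : SES f' g')
    {a : X ⟶ X'} {b : Y ⟶ Y'} {c : Z ⟶ Z'} (hab : f ≫ b = a ≫ f') (hbc : g ≫ c = b ≫ g')
    {K L M : A} {i : X' ⟶ K} {j : Y' ⟶ L} {l : Z' ⟶ M} (hi : SES a i) (hj : SES b j)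
    (hl : SES c l) : ∃ (p : K ⟶ L) (q : L ⟶ M), SES p q := by
  obtain ⟨p, q, hpq⟩ := kernels h'.op h.op (a := c.op) (b := b.op) (c := a.op)
    (by rw [← op_comp, ← hbc, op_comp]) (by rw [← op_comp, ← hab, op_comp]) hl.op hj.op hi.op
  exact ⟨q.unop, p.unop, hpq.unop⟩

/-- The horseshoe lemma, for coresolutions. -/
lemma coresolve (h : SES f g) {E E' F F' : A} {a : X ⟶ E} {a' : E ⟶ E'} {c : Z ⟶ F}
    {c' : F ⟶ F'} (ha : SES a a') (hc : SES c c') (x : Y ⟶ E) (hx : f ≫ x = a) :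
    ∃ (H : A) (b : Y ⟶ E ⊞ F) (b' : E ⊞ F ⟶ H) (p : E' ⟶ H) (q : H ⟶ F'),
      SES b b' ∧ SES p q := by
  have := ha.mono
  have := hc.mono
  have := h.mono
  have hab : f ≫ biprod.lift x (g ≫ c) = a ≫ biprod.inl := by
    ext <;> simp [hx]
    rw [← Category.assoc, h.comp_eq_zero, zero_comp]
  have hbc : g ≫ c = biprod.lift x (g ≫ c) ≫ biprod.snd := by simp
  have : Mono (biprod.lift x (g ≫ c)) := by
    refine Preadditive.mono_of_cancel_zero _ fun {T} t ht => ?_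
    obtain ⟨y, rfl⟩ := h.exists_lift t (by
      rw [← cancel_mono c, Category.assoc, hbc, ← Category.assoc, ht, zero_comp, zero_comp])
    rw [Category.assoc, hab, ← Category.assoc] at ht
    rw [zero_of_comp_mono a (zero_of_comp_mono _ ht), zero_comp]
  obtain ⟨p, q, hpq⟩ := h.cokernels (biprod E F) hab hbc ha (of_mono _) hc
  exact ⟨_, _, _, p, q, of_mono _, hpq⟩

/-- The horseshoe lemma, for resolutions. -/
lemma resolve (h : SES f g) {E E' F F' : A} {a : E ⟶ X} {a' : E' ⟶ E} {c : F ⟶ Z}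
    {c' : F' ⟶ F} (ha : SES a' a) (hc : SES c' c) (x : F ⟶ Y) (hx : x ≫ g = c) :
    ∃ (H : A) (b : E ⊞ F ⟶ Y) (b' : H ⟶ E ⊞ F) (p : E' ⟶ H) (q : H ⟶ F'),
      SES b' b ∧ SES p q := by
  have := ha.epi
  have := hc.epi
  have := h.epi
  have hab : biprod.inl ≫ biprod.desc (a ≫ f) x = a ≫ f := by simp
  have hbc : biprod.snd ≫ c = biprod.desc (a ≫ f) x ≫ g := by
    ext <;> simp [hx]
    rw [h.comp_eq_zero, comp_zero]
  have : Epi (biprod.desc (a ≫ f) x) := by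
    refine Preadditive.epi_of_cancel_zero _ fun {T} t ht => ?_
    have h₁ : a ≫ f ≫ t = 0 := by
      rw [← Category.assoc, ← hab, Category.assoc, ht, comp_zero]
    have h₂ : x ≫ t = 0 := by
      have := biprod.inr ≫= ht
      rwa [← Category.assoc, biprod.inr_desc, comp_zero] at this
    obtain ⟨y, rfl⟩ := h.exists_desc t (zero_of_epi_comp a h₁)
    rw [← Category.assoc, hx] at h₂
    rw [zero_of_epi_comp c h₂, comp_zero]
  obtain ⟨p, q, hpq⟩ := (biprod E F).kernels h hab hbc ha (of_epi _) hc
  exact ⟨_, _, _, p, q, of_epi _, hpq⟩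

end SES

end ShortExact

/-! ### Objects orthogonal to the projectives, their coresolutions and their syzygies. -/

section Perp

open Abelian
open scoped ZeroObject

variable {A : Type u} [Category.{v} A] [Abelian A]

/-- `Ext^i(K, P) = 0` for all projective objects `P` and all `i > n`. -/
def ProjPerp (n : ℕ) (K : A) : Prop :=
  letI := HasExt.standard A
  ∀ P : A, Projective P → ∀ i, n < i → ∀ e : Ext.{max u v} K P i, e = 0

variable {X Y Z : A} {f : X ⟶ Y} {g : Y ⟶ Z}

lemma ProjPerp.mono {m n : ℕ} (h : ProjPerp m X) (hmn : m ≤ n) : ProjPerp n X :=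
  fun P hP i hi => h P hP i (by lia)

lemma projPerp_of_injectiveDimension {n : ℕ}
    (h : ∀ P : A, Projective P → HasInjectiveDimensionLT P (n + 1)) (K : A) : ProjPerp n K := by
  intro P hP i hi e
  have := h P hP
  let := HasExt.standard A
  exact Ext.eq_zero_of_hasInjectiveDimensionLT e (n + 1) hi

lemma injectiveDimension_of_projPerp {n : ℕ} (h : ∀ K : A, ProjPerp n K) (P : A)
    (hP : Projective P) : HasInjectiveDimensionLT P (n + 1) := by
  let := HasExt.standard A
  exact HasInjectiveDimensionLT.mk fun i hi Y e => h Y P hP i hi e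

lemma ProjPerp.of_projective [Projective X] (n : ℕ) : ProjPerp n X := by
  intro P hP i hi e
  let := HasExt.standard A
  obtain ⟨i, rfl⟩ : ∃ j, i = j + 1 := ⟨i - 1, by lia⟩
  exact e.eq_zero_of_projective

namespace SES

lemma projPerp₂ (h : SES f g) {n : ℕ} (h₁ : ProjPerp n X) (h₃ : ProjPerp n Z) :
    ProjPerp n Y := by
  intro P hP i hi e
  let := HasExt.standard A
  obtain ⟨w, h⟩ := h
  obtain ⟨x₃, rfl⟩ := Ext.contravariant_sequence_exact₂ h _ e (h₁ P hP i hi _)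
  rw [h₃ P hP i hi x₃, Ext.comp_zero]

lemma projPerp₁ (h : SES f g) {n : ℕ} (h₂ : ProjPerp n Y) (h₃ : ProjPerp (n + 1) Z) :
    ProjPerp n X := by
  intro P hP i hi e
  let := HasExt.standard A
  obtain ⟨w, h⟩ := h
  obtain ⟨x₂, rfl⟩ := Ext.contravariant_sequence_exact₁ h _ e (add_comm 1 i)
    (h₃ P hP _ (by lia) _)
  rw [h₂ P hP i hi x₂, Ext.comp_zero]

lemma projPerp₃ (h : SES f g) {n : ℕ} (h₁ : ProjPerp n X) (h₂ : ProjPerp (n + 1) Y) :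
    ProjPerp (n + 1) Z := by
  intro P hP i hi e
  let := HasExt.standard A
  obtain ⟨w, h⟩ := h
  obtain ⟨i, rfl⟩ : ∃ j, i = j + 1 := ⟨i - 1, by lia⟩
  obtain ⟨x₁, rfl⟩ := Ext.contravariant_sequence_exact₃ h _ e (h₂ P hP _ hi _) (add_comm 1 i)
  rw [h₁ P hP i (by lia) x₁, Ext.comp_zero]

/-- The obstruction to extending a map along `f` is its image in `Ext¹(Z, P)` under the connecting
map, and that group vanishes. -/
lemma exists_extension (h : SES f g) (h₃ : ProjPerp 0 Z) {P : A} [hP : Projective P] (x : X ⟶ P) :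
    ∃ y, f ≫ y = x := by
  let := HasExt.standard A
  obtain ⟨w, h⟩ := h
  obtain ⟨x₂, hx₂⟩ := Ext.contravariant_sequence_exact₁ h (Y := P) (Ext.mk₀ x) (add_zero 1)
    (h₃ P hP _ (by lia) _)
  obtain ⟨y, rfl⟩ := Ext.mk₀_bijective _ _ |>.2 x₂
  refine ⟨y, ?_⟩
  rw [Ext.mk₀_comp_mk₀] at hx₂
  exact (Ext.mk₀_bijective _ _).1 hx₂

/-- If `Hom(-, P)` is exact on a short exact sequence with projective middle term, then
`Ext¹(Z, P) = 0`. -/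
lemma ext_one_eq_zero [Projective Y] (h : SES f g) {P : A}
    (H : ∀ x : X ⟶ P, ∃ y, f ≫ y = x) :
    letI := HasExt.standard A
    ∀ e : Ext.{max u v} Z P 1, e = 0 := by
  let := HasExt.standard A
  intro e
  obtain ⟨w, h⟩ := h
  obtain ⟨x₁, rfl⟩ := Ext.contravariant_sequence_exact₃ h _ e
    (Ext.eq_zero_of_projective (P := Y) (n := 0) _) (add_zero 1)
  obtain ⟨x, rfl⟩ := Ext.mk₀_bijective _ _ |>.2 x₁
  obtain ⟨y, rfl⟩ := H x
  rw [← Ext.mk₀_comp_mk₀]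
  exact h.extClass_comp_assoc _

end SES

/-- `K` is orthogonal to the projectives and has a coresolution of length `n`
`0 ⟶ K ⟶ P₁ ⟶ ⋯ ⟶ P_n ⟶ K_n ⟶ 0` with `P_i` projective and cocycles orthogonal to the
projectives. -/
def HasPerpCoresolution : ℕ → A → Prop
  | 0, K => ProjPerp 0 K
  | n + 1, K => ProjPerp 0 K ∧ ∃ (P L : A) (i : K ⟶ P) (p : P ⟶ L),
      Projective P ∧ SES i p ∧ HasPerpCoresolution n L

lemma HasPerpCoresolution.projPerp {n : ℕ} (h : HasPerpCoresolution n X) : ProjPerp 0 X := by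
  cases n with
  | zero => exact h
  | succ n => exact h.1

/-- The coresolution `X = X ⟶ 0` continues by zero, since `0` is again projective. -/
lemma HasPerpCoresolution.of_projective [Projective X] (n : ℕ) : HasPerpCoresolution n X := by
  induction n generalizing X with
  | zero => exact .of_projective 0
  | succ n ih =>
    refine ⟨.of_projective 0, X, 0, 𝟙 X, 0, inferInstance, .of_isZero_right (isZero_zero A) _ _, ?_⟩
    exact ih

/-- The horseshoe lemma for coresolutions. It requires the embedding of `X` into a projective to
extend to `Y`, and orthogonality of `Z` provides the extension. -/
lemma HasPerpCoresolution.of_ses {n : ℕ} (h : SES f g) (hX : HasPerpCoresolution n X)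
    (hZ : HasPerpCoresolution n Z) : HasPerpCoresolution n Y := by
  induction n generalizing X Y Z with
  | zero => exact h.projPerp₂ hX hZ
  | succ n ih =>
    obtain ⟨hX₀, P, L, i, p, hP, hip, hL⟩ := hX
    obtain ⟨hZ₀, P', L', i', p', hP', hip', hL'⟩ := hZ
    obtain ⟨x, hx⟩ := h.exists_extension hZ₀ i
    obtain ⟨H, b, b', q, r, hb, hq⟩ := h.coresolve hip hip' x hx
    exact ⟨h.projPerp₂ hX₀ hZ₀, _, H, b, b', inferInstance, hb, ih hq hL hL'⟩

/-- The sequence splits because `Ext¹(Z, X) = 0`. So `Z` embeds in `Y` and then in the projective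
`P` containing `Y`, and `P/Z` is an extension of `P/Y` by the projective `Y/Z ≅ X`. -/
lemma HasPerpCoresolution.of_ses_left {n : ℕ} (h : SES f g) [Projective X]
    (hY : HasPerpCoresolution n Y) (hZ : ProjPerp 0 Z) : HasPerpCoresolution n Z := by
  cases n with
  | zero => exact hZ
  | succ n =>
    obtain ⟨r, hr⟩ := h.exists_extension hZ (𝟙 X)
    obtain ⟨s, -, hs⟩ := h.rotate_of_retraction r hr
    obtain ⟨-, P, L, i, p, hP, hip, hL⟩ := hY
    obtain ⟨H, π, j, q, h₁, h₂⟩ := hs.exists_quotient hip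
    exact ⟨hZ, P, H, s ≫ i, π, hP, h₁, .of_ses h₂ (.of_projective n) hL⟩

/-- Pushing out along `X ⟶ P` gives an object `W` that is both an extension of `L` by the projective
`Y` and an extension of `Z` by the projective `P`. The first description gives `W` a coresolution,
and the second passes it on to `Z`. One unit of length is lost because `L` replaces `X`. -/
lemma HasPerpCoresolution.of_syzygy {n : ℕ} (h : SES f g) [Projective Y]
    (hX : HasPerpCoresolution (n + 1) X) (hZ : ProjPerp 0 Z) : HasPerpCoresolution n Z := by
  obtain ⟨-, P, L, i, p, hP, hip, hL⟩ := hX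
  obtain ⟨W, r, b, q, sq, hbq, -⟩ := h.exists_pushout i
  obtain ⟨q', hq', -⟩ := hip.pushout sq.flip
  exact .of_ses_left hbq (.of_ses hq' (.of_projective n) hL) hZ

/-- `K` is an `n`-th syzygy of `M`. -/
def IsSyzygy : ℕ → A → A → Prop
  | 0, M, K => Nonempty (K ≅ M)
  | n + 1, M, K => ∃ (L P : A) (i : L ⟶ P) (p : P ⟶ M), Projective P ∧ SES i p ∧ IsSyzygy n L K

lemma IsSyzygy.exists [EnoughProjectives A] (n : ℕ) (M : A) : ∃ K, IsSyzygy n M K := by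
  induction n generalizing M with
  | zero => exact ⟨M, ⟨Iso.refl _⟩⟩
  | succ n ih =>
    obtain ⟨K, hK⟩ := ih (kernel (Projective.π M))
    exact ⟨K, _, _, _, Projective.π M, inferInstance, .of_epi _, hK⟩

lemma ProjPerp.of_iso {n : ℕ} (h : ProjPerp n X) (e : X ≅ Y) : ProjPerp n Y :=
  SES.projPerp₂ (SES.of_isZero_right (isZero_zero A) e.hom 0) h (.of_projective n)

/-- Dimension shifting: each syzygy lowers the degree from which `Ext` into projectives vanishes by
one. -/
lemma IsSyzygy.projPerp {n : ℕ} {M K : A} (h : IsSyzygy n M K) (hM : ProjPerp n M) :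
    ProjPerp 0 K := by
  induction n generalizing M with
  | zero => exact hM.of_iso h.some.symm
  | succ n ih =>
    obtain ⟨L, P, i, p, hP, hip, hL⟩ := h
    exact ih hL (hip.projPerp₁ (.of_projective n) hM)

lemma IsSyzygy.projective {n : ℕ} {M K : A} (h : IsSyzygy n M K)
    (hM : HasProjectiveDimensionLT M (n + 1)) : Projective K := by
  induction n generalizing M with
  | zero =>
    have : Projective M := projective_iff_hasProjectiveDimensionLT_one.2 hM
    exact Projective.of_iso h.some.symm this
  | succ n ih =>
    obtain ⟨L, P, i, p, hP, ⟨w, hip⟩, hL⟩ := h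
    exact ih hL (hip.hasProjectiveDimensionLT_X₁ (n + 1) (inferInstanceAs
      (HasProjectiveDimensionLT P (n + 1))) hM)

/-- The iterated horseshoe lemma. The syzygy of the quotient term is prescribed and the other two
are built to fit it, so that a coresolution already found for that syzygy can be prolonged. -/
lemma SES.exists_syzygy [EnoughProjectives A] (h : SES f g) {n : ℕ} {M : A} (hM : IsSyzygy n Z M) :
    ∃ (K L : A) (i : K ⟶ L) (p : L ⟶ M), IsSyzygy n X K ∧ IsSyzygy n Y L ∧ SES i p := by
  induction n generalizing X Y Z with
  | zero =>
    exact ⟨X, Y, f, g ≫ hM.some.inv, ⟨Iso.refl _⟩, ⟨Iso.refl _⟩, h.iso_right hM.some.symm⟩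
  | succ n ih =>
    obtain ⟨L, P, i, p, hP, hip, hL⟩ := hM
    have := h.epi
    obtain ⟨H, b, b', q, r, hb, hq⟩ := h.resolve (.of_epi (Projective.π X)) hip
      (Projective.factorThru p g) (Projective.factorThru_comp p g)
    obtain ⟨K₁, K₂, j, j', h₁, h₂, h₃⟩ := ih hq hL
    exact ⟨K₁, K₂, j, j', ⟨_, _, _, _, inferInstance, .of_epi (Projective.π X), h₁⟩,
      ⟨_, _, _, _, inferInstance, hb, h₂⟩, h₃⟩

/-- Embed `M` in an injective `I`. In the sequence of `n`-th syzygies of `0 ⟶ M ⟶ I ⟶ I/M ⟶ 0` the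
middle term is projective, because `I` has projective dimension at most `n`. This is the first step
of a coresolution, and induction on `j` applies to `I/M`. All the syzygies are orthogonal to the
projectives because projectives have injective dimension at most `n`. -/
lemma IsSyzygy.exists_hasPerpCoresolution [EnoughProjectives A] [EnoughInjectives A] {n : ℕ}
    (hproj : ∀ P : A, Projective P → HasInjectiveDimensionLT P (n + 1))
    (hinj : ∀ I : A, Injective I → HasProjectiveDimensionLT I (n + 1)) (j : ℕ) (M : A) :
    ∃ K, IsSyzygy n M K ∧ HasPerpCoresolution j K := by
  induction j generalizing M with
  | zero =>
    obtain ⟨K, hK⟩ := IsSyzygy.exists n M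
    exact ⟨K, hK, hK.projPerp (projPerp_of_injectiveDimension hproj M)⟩
  | succ j ih =>
    obtain ⟨K, hK, hj⟩ := ih (cokernel (Injective.ι M))
    obtain ⟨K₁, K₂, i, p, h₁, h₂, hip⟩ := (SES.of_mono (Injective.ι M)).exists_syzygy hK
    exact ⟨K₁, h₁, h₁.projPerp (projPerp_of_injectiveDimension hproj M), K₂, K, i, p,
      h₂.projective (hinj _ inferInstance), hip, hj⟩

lemma HasPerpCoresolution.of_iso {n : ℕ} (h : HasPerpCoresolution n X) (e : X ≅ Y) :
    HasPerpCoresolution n Y :=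
  .of_ses (SES.of_isZero_right (isZero_zero A) e.hom 0) h (.of_projective n)

/-- Climb back from the `n`-th syzygy to `M` with `HasPerpCoresolution.of_syzygy`; each of the `n`
steps costs one unit of length. -/
lemma IsSyzygy.hasPerpCoresolution {n j : ℕ} {M K : A} (h : IsSyzygy n M K) (hM : ProjPerp 0 M)
    (hK : HasPerpCoresolution (j + n) K) : HasPerpCoresolution j M := by
  induction n generalizing M j with
  | zero => exact hK.of_iso h.some
  | succ n ih =>
    obtain ⟨L, P, i, p, hP, hip, hL⟩ := h
    refine .of_syzygy hip (ih hL (hip.projPerp₁ (.of_projective 0) (hM.mono (by lia))) ?_) hM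
    convert hK using 1
    lia

/-- Some `n`-th syzygy has a coresolution of length `j + n`; descending to `K` uses up exactly `n`.
-/
lemma ProjPerp.hasPerpCoresolution [EnoughProjectives A] [EnoughInjectives A] {n : ℕ}
    (hproj : ∀ P : A, Projective P → HasInjectiveDimensionLT P (n + 1))
    (hinj : ∀ I : A, Injective I → HasProjectiveDimensionLT I (n + 1)) {K : A}
    (hK : ProjPerp 0 K) (j : ℕ) : HasPerpCoresolution j K := by
  obtain ⟨L, hL, hj⟩ := IsSyzygy.exists_hasPerpCoresolution hproj hinj (j + n) K
  exact hL.hasPerpCoresolution hK hj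

end Perp

/-! ### Gorenstein projective dimension versus dimensions of projectives and injectives. -/

section TotallyAcyclic

open Abelian
open scoped ZeroObject

variable {A : Type u} [Category.{v} A] [Abelian A]

lemma exact_int (Q : ChainComplex A ℤ) {i j l : ℤ} (hij : j + 1 = i) (hjl : l + 1 = j)
    (h : Q.Acyclic) : (ShortComplex.mk (Q.d i j) (Q.d j l) (Q.d_comp_d i j l)).Exact :=
  (Q.exactAt_iff' i j l ((ComplexShape.down ℤ).prev_eq' hij)
    ((ComplexShape.down ℤ).next_eq' hjl)).1 (h j)

/-- Cuts an acyclic complex into short exact sequences of its cycle objects. -/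
lemma acyclic_ses {Q : ChainComplex A ℤ} (h : Q.Acyclic) (i j : ℤ) (hij : j + 1 = i) :
    ∃ p : Q.X i ⟶ Q.cycles j, SES (Q.iCycles i) p ∧ p ≫ Q.iCycles j = Q.d i j := by
  have hker := Q.cyclesIsKernel i j ((ComplexShape.down ℤ).next_eq' hij)
  have hp : Q.toCycles i j ≫ Q.iCycles j = Q.d i j := Q.toCycles_i i j
  have : Epi (Q.toCycles i j) := by
    rw [epi_iff_surjective_up_to_refinements]
    intro T x
    obtain ⟨T', π, hπ, y, hy⟩ := (exact_int Q hij (sub_add_cancel j 1) h).exact_up_to_refinements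
      (x ≫ Q.iCycles j) (by simp)
    exact ⟨T', π, hπ, y, by rw [← cancel_mono (Q.iCycles j)]; simpa using hy⟩
  refine ⟨Q.toCycles i j, SES.of_lift ?_ fun x hx => ?_, hp⟩
  · rw [← cancel_mono (Q.iCycles j), Category.assoc, hp]; simp
  · exact ⟨hker.lift (KernelFork.ofι x (by rw [← hp, ← Category.assoc, hx, zero_comp])),
      hker.fac _ WalkingParallelPair.zero⟩

/-- A map from the cycles `Z_{i+1}` to a projective, pulled back to `Q_{i+2}`, is a cocycle, so
`hom_acyclic` extends it over `Q_{i+1}`; this is the vanishing of `Ext¹(Z_i, P)`. Higher degrees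
follow by dimension shifting, since all the cycle objects are treated at once. -/
lemma IsTotallyAcyclic.projPerp {Q : ChainComplex A ℤ} (h : IsTotallyAcyclic Q) (i : ℤ) :
    ProjPerp 0 (Q.cycles i) := by
  let := HasExt.standard A
  intro P hP n hn e
  obtain ⟨n, rfl⟩ : ∃ m, n = m + 1 := ⟨n - 1, by lia⟩
  induction n generalizing i with
  | zero =>
    obtain ⟨p, hp, -⟩ := acyclic_ses h.acyclic (i + 1) i rfl
    obtain ⟨q, hq, hqd⟩ := acyclic_ses h.acyclic (i + 1 + 1) (i + 1) rfl
    have := h.projective (i + 1)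
    have := hq.epi
    refine hp.ext_one_eq_zero (fun x => ?_) e
    obtain ⟨y, hy⟩ := h.hom_acyclic P hP (i + 1 + 1) (q ≫ x) (by
      obtain ⟨r, hr, hrd⟩ := acyclic_ses h.acyclic (i + 1 + 1 + 1) (i + 1 + 1) rfl
      rw [← hrd, Category.assoc, ← Category.assoc _ q, hq.comp_eq_zero, zero_comp, comp_zero])
    -- `hom_acyclic` returns a map out of `Q.X (i + 1 + 1 - 1)`; here it is only transported to `Q.X
    -- (i + 1)`.
    obtain ⟨z, hz⟩ : ∃ z : Q.X (i + 1) ⟶ P, Q.d (i + 1 + 1) (i + 1) ≫ z = q ≫ x := by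
      have hj : i + 1 + 1 - 1 = i + 1 := by ring
      rw [← hy]
      clear hy
      revert y
      rw [hj]
      exact fun y => ⟨y, rfl⟩
    refine ⟨z, ?_⟩
    rw [← cancel_epi q, ← Category.assoc, hqd, hz]
  | succ n ih =>
    obtain ⟨p, ⟨w, hp⟩, -⟩ := acyclic_ses h.acyclic (i + 1) i rfl
    have := h.projective (i + 1)
    obtain ⟨x₁, rfl⟩ := Ext.contravariant_sequence_exact₃ hp _ e
      (Ext.eq_zero_of_projective (P := Q.X (i + 1)) _) (add_comm 1 (n + 1))
    rw [ih (i + 1) (by lia) x₁, Ext.comp_zero]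

lemma IsTotallyAcyclic.hasPerpCoresolution {Q : ChainComplex A ℤ} (h : IsTotallyAcyclic Q) (n : ℕ)
    (i : ℤ) : HasPerpCoresolution n (Q.cycles i) := by
  induction n generalizing i with
  | zero => exact h.projPerp i
  | succ n ih =>
    obtain ⟨p, hp, -⟩ := acyclic_ses h.acyclic i (i - 1) (sub_add_cancel i 1)
    exact ⟨h.projPerp i, _, _, _, p, h.projective i, hp, ih (i - 1)⟩

lemma gorensteinProjective.hasPerpCoresolution {X : A} (h : gorensteinProjective A X) (n : ℕ) :
    HasPerpCoresolution n X := by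
  obtain ⟨Q, hQ, ⟨e⟩⟩ := h
  exact (hQ.hasPerpCoresolution n 0).of_iso e

/-- A family of short exact sequences `0 ⟶ Z_i ⟶ Q_i ⟶ Z_{i-1} ⟶ 0` with `Q_i` projective and
`Z_i` orthogonal to the projectives splices to a totally acyclic complex. -/
lemma gorensteinProjective_of_splice (Z : ℤ → A) (hZ : ∀ i, ProjPerp 0 (Z i))
    (h : ∀ i, ∃ (P : A) (f : Z i ⟶ P) (g : P ⟶ Z (i - 1)), Projective P ∧ SES f g) :
    gorensteinProjective A (Z 0) := by
  choose Q f g hQ hfg using h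
  -- The projection out of `Q (i + 1)` lands in `Z (i + 1 - 1)`, which equals `Z i` only
  -- propositionally, hence the `eqToHom`.
  let p (i : ℤ) : Q (i + 1) ⟶ Z i := g (i + 1) ≫ eqToHom (by rw [add_sub_cancel_right])
  have hp (i : ℤ) : SES (f (i + 1)) (p i) :=
    (hfg (i + 1)).iso_right (eqToIso (by rw [add_sub_cancel_right]))
  have hepi (i : ℤ) : Epi (p i) := (hp i).epi
  have hmono (i : ℤ) : Mono (f i) := (hfg i).mono
  let K : ChainComplex A ℤ := ChainComplex.of Q (fun i => p i ≫ f i) fun i => by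
    rw [Category.assoc, ← Category.assoc (f (i + 1)), (hp i).comp_eq_zero, zero_comp, comp_zero]
  have hd (i : ℤ) : K.d (i + 1) i = p i ≫ f i :=
    ChainComplex.of_d Q (fun i => p i ≫ f i) i
  have hd' (i j l : ℤ) (hij : j + 1 = i) (hjl : l + 1 = j) {T : A} (x : T ⟶ K.X j)
      (hx : x ≫ K.d j l = 0) : ∃ y : T ⟶ Z j, y ≫ f j = x := by
    subst hjl hij
    rw [hd, ← Category.assoc] at hx
    exact (hp l).exists_lift x (zero_of_comp_mono _ hx)
  have hfd (j l : ℤ) (hjl : l + 1 = j) : f j ≫ K.d j l = 0 := by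
    subst hjl
    rw [hd, ← Category.assoc, (hp l).comp_eq_zero, zero_comp]
  refine ⟨K, ⟨hQ, fun i => ?_, fun P hP i x hx => ?_⟩, ⟨?_⟩⟩
  · rw [K.exactAt_iff' (i + 1) i (i - 1) (by simp) (by simp),
      ShortComplex.exact_iff_exact_up_to_refinements]
    intro T x hx
    obtain ⟨y, rfl⟩ := hd' (i + 1) i (i - 1) rfl (by ring) x hx
    obtain ⟨T', π, hπ, t, ht⟩ := surjective_up_to_refinements_of_epi (p i) y
    refine ⟨T', π, hπ, t, ?_⟩
    change π ≫ y ≫ f i = t ≫ K.d (i + 1) i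
    rw [hd, ← Category.assoc, ht, Category.assoc]
  · rw [hd, Category.assoc] at hx
    obtain ⟨j, rfl⟩ : ∃ j, i = j + 1 := ⟨i - 1, by ring⟩
    obtain ⟨y, hy⟩ := (hp j).exists_desc x (zero_of_epi_comp (p (j + 1)) hx)
    obtain ⟨z, rfl⟩ := (hfg j).exists_extension (hZ _) y
    have hj : j + 1 - 1 = j := by ring
    rw [hj]
    exact ⟨z, by rw [hd, Category.assoc, hy]⟩
  · refine (K.cyclesIsKernel 0 (-1) (by simp)).conePointUniqueUpToIso
      (KernelFork.IsLimit.ofι' (f 0) (hfd 0 (-1) (by simp)) fun x hx => ?_)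
    have := hd' 1 0 (-1) (by simp) (by simp) x hx
    exact ⟨this.choose, this.choose_spec⟩

/-- If every object orthogonal to the projectives embeds in a projective with cokernel orthogonal to
the projectives, then all such objects are Gorenstein projective. -/
lemma gorensteinProjective_of_projPerp [EnoughProjectives A]
    (h : ∀ K : A, ProjPerp 0 K → HasPerpCoresolution 1 K)
    {K : A} (hK : ProjPerp 0 K) : gorensteinProjective A K := by
  have next (K : {K : A // ProjPerp 0 K}) : ∃ (L : {K : A // ProjPerp 0 K}) (P : A) (f : K.1 ⟶ P)
      (g : P ⟶ L.1), Projective P ∧ SES f g := by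
    obtain ⟨-, P, L, f, g, hP, hfg, hL⟩ := h K.1 K.2
    exact ⟨⟨L, hL⟩, P, f, g, hP, hfg⟩
  have prev (K : {K : A // ProjPerp 0 K}) : ∃ (L : {K : A // ProjPerp 0 K}) (P : A) (f : L.1 ⟶ P)
      (g : P ⟶ K.1), Projective P ∧ SES f g :=
    ⟨⟨kernel (Projective.π K.1), (SES.of_epi (Projective.π K.1)).projPerp₁ (.of_projective 0)
      (K.2.mono (by lia))⟩, _, _, _, inferInstance, .of_epi (Projective.π K.1)⟩
  choose N hN using next
  choose V hV using prev
  -- `Z 0 = K`; positive indices are iterated syzygies, chosen by `V`, and negative indices are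
  -- iterated cosyzygies, chosen by `N`.
  let Z : ℤ → {K : A // ProjPerp 0 K}
    | .ofNat n => V^[n] ⟨K, hK⟩
    | .negSucc n => N^[n + 1] ⟨K, hK⟩
  refine gorensteinProjective_of_splice (fun i => (Z i).1) (fun i => (Z i).2) fun i => ?_
  match i with
  | .ofNat 0 => exact hN ⟨K, hK⟩
  | .ofNat (n + 1) =>
    have h₁ : Int.ofNat (n + 1) - 1 = Int.ofNat n := by simp
    have h₂ : Z (Int.ofNat (n + 1)) = V (Z (Int.ofNat n)) :=
      Function.iterate_succ_apply' V n ⟨K, hK⟩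
    rw [h₁, h₂]
    exact hV _
  | .negSucc n =>
    have h₁ : Int.negSucc n - 1 = Int.negSucc (n + 1) := by lia
    have h₂ : Z (Int.negSucc (n + 1)) = N (Z (Int.negSucc n)) :=
      Function.iterate_succ_apply' N (n + 1) ⟨K, hK⟩
    rw [h₁, h₂]
    exact hN _

/-- After `n` projective presentations the remaining kernel is orthogonal to the projectives, hence
Gorenstein projective. -/
lemma HasResolution.of_projPerp [EnoughProjectives A]
    (h : ∀ K : A, ProjPerp 0 K → HasPerpCoresolution 1 K) {n : ℕ}
    {M : A} (hM : ProjPerp n M) : HasResolution (gorensteinProjective A) n M := by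
  induction n generalizing M with
  | zero => exact ⟨M, gorensteinProjective_of_projPerp h hM, ⟨Iso.refl M⟩⟩
  | succ n ih =>
    obtain ⟨w, hw⟩ := SES.of_epi (Projective.π M)
    refine ⟨_, _, _, Projective.π M, w, gorensteinProjective_of_projPerp h (.of_projective 0), hw,
      ih (SES.projPerp₁ ⟨w, hw⟩ (.of_projective n) hM)⟩

/-- If all projectives have injective dimension at most `n`, and the projective dimension of
the injectives is bounded, then the global Gorenstein projective dimension is at most `n`. -/
theorem glGpdim_le [EnoughProjectives A] [EnoughInjectives A] {n t : ℕ}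
    (hproj : ∀ P : A, Projective P → HasInjectiveDimensionLT P (n + 1))
    (hinj : ∀ I : A, Injective I → HasProjectiveDimensionLT I (t + 1)) : glGpdim A ≤ n := by
  refine iSup_le fun M => ?_
  refine iInf₂_le_of_le n (HasResolution.of_projPerp (fun K hK => ?_)
    (projPerp_of_injectiveDimension hproj M)) le_rfl
  -- The coresolution argument wants one common bound for both dimensions, and `n + t` serves. The
  -- length of the Gorenstein projective resolution is governed by `hproj` alone, so `t` does not
  -- enter the result.
  refine hK.hasPerpCoresolution (n := n + t) (fun P hP => ?_) (fun I hI => ?_) 1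
  · have := hproj P hP
    exact hasInjectiveDimensionLT_of_ge P (n + 1) _ (by lia)
  · have := hinj I hI
    exact hasProjectiveDimensionLT_of_ge I (t + 1) _ (by lia)

/-- Dimension shifting along the resolution, starting from the orthogonality of Gorenstein
projectives to projectives. -/
lemma HasResolution.projPerp {n : ℕ} {M : A} (h : HasResolution (gorensteinProjective A) n M) :
    ProjPerp n M := by
  induction n generalizing M with
  | zero =>
    obtain ⟨X, hX, ⟨e⟩⟩ := h
    exact ((hX.hasPerpCoresolution 0).projPerp).of_iso e
  | succ n ih =>
    obtain ⟨K, X, i, p, w, hX, hip, hK⟩ := h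
    exact SES.projPerp₃ ⟨w, hip⟩ (ih hK) ((hX.hasPerpCoresolution 0).projPerp.mono (by lia))

lemma exists_hasResolution_of_glGpdim_le {n : ℕ} (h : glGpdim A ≤ n) (M : A) :
    ∃ r ≤ n, HasResolution (gorensteinProjective A) r M := by
  -- The inequality is made strict so that the infimum yields an actual resolution.
  have hM : resolutionDim (gorensteinProjective A) M < (n + 1 : ℕ) :=
    ((le_iSup _ M).trans h).trans_lt (by exact_mod_cast Nat.lt_succ_self n)
  simp only [resolutionDim, iInf_lt_iff] at hM
  obtain ⟨r, hr, hrn⟩ := hM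
  exact ⟨r, by exact_mod_cast Nat.lt_succ_iff.1 (by exact_mod_cast hrn), hr⟩

/-- Hulls of finite projective dimension. -/
lemma HasResolution.exists_hull {n : ℕ} {M : A} (h : HasResolution (gorensteinProjective A) n M)
    (j : ℕ) : ∃ (H G : A) (i : M ⟶ H) (p : H ⟶ G), SES i p ∧ HasPerpCoresolution j G ∧
      HasProjectiveDimensionLT H (n + 1) := by
  induction n generalizing M j with
  | zero =>
    obtain ⟨X, hX, ⟨e⟩⟩ := h
    -- The hull of a Gorenstein projective is the first projective of its coresolution; the cokernel
    -- keeps the remaining `j` steps.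
    obtain ⟨-, P, L, i, p, hP, hip, hL⟩ := (hX.hasPerpCoresolution (j + 1)).of_iso e
    exact ⟨P, L, i, p, hip, hL, inferInstance⟩
  | succ n ih =>
    obtain ⟨K, X, i, p, w, hX, hip, hK⟩ := h
    obtain ⟨H, G, a, b, hab, hG, hH⟩ := ih hK (j + 1)
    -- With `K ⟶ H` a hull of the kernel, the pushout `W` is an extension of `M` by `H` and also an
    -- extension of `G` by `X`. By the latter it embeds in a projective `P`. Then `P/H` contains
    -- `W/H ≅ M` with quotient `P/W`, and its projective dimension exceeds that of `H` by at most
    -- one.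
    obtain ⟨W, r, c, q, sq, hcq, -⟩ := SES.exists_pushout ⟨w, hip⟩ a
    obtain ⟨q', hq', -⟩ := hab.pushout sq.flip
    obtain ⟨-, P, L, s, t, hP, hst, hL⟩ :=
      HasPerpCoresolution.of_ses hq' (hX.hasPerpCoresolution (j + 1)) hG
    obtain ⟨H', π, l, m, ⟨w', h₁⟩, h₂⟩ := hcq.exists_quotient hst
    refine ⟨H', L, l, m, h₂, hL, h₁.hasProjectiveDimensionLT_X₃ (n + 1) hH ?_⟩
    exact hasProjectiveDimensionLT_of_ge P 1 _ (by lia)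

/-- If the global Gorenstein projective dimension is at most `n`, then the projective objects have
injective dimension at most `n`. -/
theorem injectiveDimension_le_of_glGpdim_le {n : ℕ} (h : glGpdim A ≤ n) (P : A)
    (hP : Projective P) : HasInjectiveDimensionLT P (n + 1) := by
  refine injectiveDimension_of_projPerp (fun K => ?_) P hP
  obtain ⟨r, hr, hK⟩ := exists_hasResolution_of_glGpdim_le h K
  exact hK.projPerp.mono hr

/-- If the global Gorenstein projective dimension is at most `n`, then the injective objects have
projective dimension at most `n`. -/
theorem projectiveDimension_le_of_glGpdim_le {n : ℕ} (h : glGpdim A ≤ n) (I : A)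
    (hI : Injective I) : HasProjectiveDimensionLT I (n + 1) := by
  obtain ⟨r, hr, hK⟩ := exists_hasResolution_of_glGpdim_le h I
  obtain ⟨H, G, i, p, hip, -, hH⟩ := hK.exists_hull 0
  have := hip.mono
  have := hasProjectiveDimensionLT_of_ge H (r + 1) (n + 1) (by lia)
  -- An injective object splits off its hull and so inherits the bound on projective dimension.
  exact (Retract.mk i (Injective.factorThru (𝟙 I) i)
    (Injective.comp_factorThru (𝟙 I) i)).hasProjectiveDimensionLT (n + 1)

end TotallyAcyclic

/-! ### Pointwise exactness, products and coproducts of modules over a linear category. -/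

section LModBasic

variable {k : Type u} [CommRing k] {C : Type u} [SmallCategory C] [Preadditive C] [Linear k C]

namespace LMod

/-- A module over a linear category, given by the modules `M c` and the action of morphisms. -/
def ofAction (M : C → ModuleCat.{u} k) (act : ∀ {c d : C}, (c ⟶ d) →ₗ[k] M c →ₗ[k] M d)
    (act_id : ∀ (c : C) (x : M c), act (𝟙 c) x = x)
    (act_comp : ∀ {c d e : C} (f : c ⟶ d) (g : d ⟶ e) (x : M c), act (f ≫ g) x = act g (act f x)) :
    LMod k C :=
  ⟨{ obj := M
     map := fun f => ModuleCat.ofHom (act f)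
     map_id := fun c => ModuleCat.hom_ext (LinearMap.ext (act_id c))
     map_comp := fun f g => ModuleCat.hom_ext (LinearMap.ext (act_comp f g)) },
    ⟨fun {_ _ f g} => ModuleCat.hom_ext (act.map_add f g)⟩,
    ⟨fun {_ _} f r => ModuleCat.hom_ext (act.map_smul r f)⟩⟩

/-- A morphism of modules, given by linear maps compatible with the action of morphisms. -/
def homOfLinear {F G : LMod k C} (app : ∀ c, F.obj.obj c →ₗ[k] G.obj.obj c)
    (nat : ∀ {c d : C} (f : c ⟶ d) (x : F.obj.obj c),
      app d (F.obj.map f x) = G.obj.map f (app c x)) : F ⟶ G :=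
  ObjectProperty.homMk
    { app := fun c => ModuleCat.ofHom (app c)
      naturality := fun _ _ f => ModuleCat.hom_ext (LinearMap.ext (nat f)) }

lemma hom_ext {F G : LMod k C} {f g : F ⟶ G}
    (h : ∀ (c : C) (x : F.obj.obj c), f.hom.app c x = g.hom.app c x) : f = g := by
  ext c x
  exact h c x

lemma naturality_apply {F G : LMod k C} (φ : F ⟶ G) {c d : C} (f : c ⟶ d) (x : F.obj.obj c) :
    φ.hom.app d (F.obj.map f x) = G.obj.map f (φ.hom.app c x) :=
  congr($(φ.hom.naturality f) x)

lemma comp_apply {F G H : LMod k C} (φ : F ⟶ G) (ψ : G ⟶ H) (c : C) (x : F.obj.obj c) :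
    (φ ≫ ψ).hom.app c x = ψ.hom.app c (φ.hom.app c x) := rfl

lemma map_comp_apply (F : LMod k C) {c d e : C} (f : c ⟶ d) (g : d ⟶ e) (x : F.obj.obj c) :
    F.obj.map (f ≫ g) x = F.obj.map g (F.obj.map f x) :=
  congr($(F.obj.map_comp f g) x)

lemma map_id_apply (F : LMod k C) {c : C} (x : F.obj.obj c) : F.obj.map (𝟙 c) x = x :=
  congr($(F.obj.map_id c) x)

lemma map_add_apply (F : LMod k C) {c d : C} (f g : c ⟶ d) (x : F.obj.obj c) :
    F.obj.map (f + g) x = F.obj.map f x + F.obj.map g x :=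
  congr($(F.obj.map_add (f := f) (g := g)) x)

lemma map_smul_apply (F : LMod k C) {c d : C} (r : k) (f : c ⟶ d) (x : F.obj.obj c) :
    F.obj.map (r • f) x = r • F.obj.map f x :=
  congr($(F.obj.map_smul r f) x)

/-- The element corresponding to a morphism from a representable module. -/
def elem {c : C} {F : LMod k C} (φ : free k c ⟶ F) : F.obj.obj c :=
  φ.hom.app c (show (free k c).obj.obj c from 𝟙 c)

lemma elem_ext {c : C} {F : LMod k C} {φ ψ : free k c ⟶ F} (h : elem φ = elem ψ) : φ = ψ :=
  free_hom_ext h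

lemma elem_freeDesc {c : C} {F : LMod k C} (x : F.obj.obj c) : elem (freeDesc x) = x :=
  map_id_apply F x

lemma elem_comp {c : C} {F G : LMod k C} (φ : free k c ⟶ F) (ψ : F ⟶ G) :
    elem (φ ≫ ψ) = ψ.hom.app c (elem φ) := rfl

lemma isIso_of_bijective {F G : LMod k C} (f : F ⟶ G)
    (hf : ∀ c, Function.Bijective (f.hom.app c)) : IsIso f :=
  have := mono_of_injective f fun c => (hf c).1
  have := epi_of_surjective f fun c => (hf c).2
  isIso_of_mono_of_epi f

/-- Elements of `F(c)` are morphisms from the representable module at `c`, so lifting elements is a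
case of lifting morphisms. Conversely, pointwise lifts are unique and therefore natural. -/
lemma ses_iff {F G H : LMod k C} (f : F ⟶ G) (g : G ⟶ H) :
    SES f g ↔ ∀ c, Function.Injective (f.hom.app c) ∧
      Function.Exact (f.hom.app c) (g.hom.app c) ∧ Function.Surjective (g.hom.app c) := by
  constructor
  · intro h c
    have := h.mono
    have := h.epi
    refine ⟨injective_of_mono f c, fun y => ⟨fun hy => ?_, ?_⟩, surjective_of_epi g c⟩
    · obtain ⟨φ, hφ⟩ := h.exists_lift (freeDesc y) (elem_ext (by
        rw [elem_comp, elem_freeDesc, hy]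
        rfl))
      exact ⟨elem φ, by rw [← elem_comp, hφ, elem_freeDesc]⟩
    · rintro ⟨x, rfl⟩
      rw [← comp_apply, h.comp_eq_zero]
      rfl
  · intro h
    have := mono_of_injective f fun c => (h c).1
    have := epi_of_surjective g fun c => (h c).2.2
    refine SES.of_lift (hom_ext fun c x => ?_) fun {T} x hx => ?_
    · exact (h c).2.1.apply_apply_eq_zero x
    · have hmem (c : C) (t : T.obj.obj c) : x.hom.app c t ∈ LinearMap.range (f.hom.app c).hom := by
        refine ((h c).2.1 _).1 ?_
        rw [← comp_apply, hx]
        rfl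
      let e (c : C) := LinearEquiv.ofInjective (f.hom.app c).hom (h c).1
      let y (c : C) : T.obj.obj c →ₗ[k] F.obj.obj c :=
        (e c).symm.toLinearMap ∘ₗ ((x.hom.app c).hom.codRestrict _ (hmem c))
      have hy (c : C) (t : T.obj.obj c) : f.hom.app c (y c t) = x.hom.app c t :=
        congr($((e c).apply_symm_apply ⟨x.hom.app c t, hmem c t⟩).1)
      refine ⟨homOfLinear y fun {c d} a t => (h d).1 ?_, hom_ext hy⟩
      rw [hy, naturality_apply, naturality_apply, hy]

section Products

instance {ι : Type u} (F : ι → LMod k C) : HasProduct F := inferInstance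

instance {ι : Type u} (F : ι → LMod k C) : HasCoproduct F := inferInstance

variable {ι : Type u} (F : ι → LMod k C)

lemma pi_ext {c : C} {x y : (∏ᶜ F).obj.obj c}
    (h : ∀ i, (Pi.π F i).hom.app c x = (Pi.π F i).hom.app c y) : x = y := by
  have : freeDesc x = freeDesc y := Pi.hom_ext _ _ fun i => elem_ext (by
    rw [elem_comp, elem_comp, elem_freeDesc, elem_freeDesc, h])
  rw [← elem_freeDesc x, this, elem_freeDesc]

lemma pi_exists {c : C} (x : ∀ i, (F i).obj.obj c) :
    ∃ y : (∏ᶜ F).obj.obj c, ∀ i, (Pi.π F i).hom.app c y = x i := by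
  refine ⟨elem (Pi.lift fun i => freeDesc (x i)), fun i => ?_⟩
  rw [← elem_comp, Pi.lift_π, elem_freeDesc]

/-- The evaluation functor. -/
abbrev evaluation (c : C) : LMod k C ⥤ ModuleCat.{u} k :=
  (isLinear k C).ι ⋙ (CategoryTheory.evaluation C (ModuleCat.{u} k)).obj c

/-- Evaluation at `c` preserves coproducts, so the quotient map by `p` is determined on the
summands, where it vanishes. -/
lemma sigma_induction {c : C} {p : Submodule k ((∐ F).obj.obj c)}
    (h : ∀ i x, (Sigma.ι F i).hom.app c x ∈ p) : p = ⊤ := by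
  let hc := isColimitOfPreserves (evaluation (k := k) c) (colimit.isColimit (Discrete.functor F))
  have : ModuleCat.ofHom p.mkQ = 0 := hc.hom_ext fun ⟨i⟩ => ModuleCat.hom_ext <| LinearMap.ext
    fun x => (Submodule.Quotient.mk_eq_zero p).2 (h i x)
  rw [← p.ker_mkQ, LinearMap.ker_eq_top]
  exact congr(($this).hom)

/-- The canonical morphism from the coproduct to the product. -/
def sigmaToPi : ∐ F ⟶ ∏ᶜ F :=
  open scoped Classical in
  Sigma.desc fun i => Pi.lift fun j => if h : i = j then eqToHom (by rw [h]) else 0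

lemma sigmaToPi_apply_self {c : C} (i : ι) (x : (F i).obj.obj c) :
    (Pi.π F i).hom.app c ((sigmaToPi F).hom.app c ((Sigma.ι F i).hom.app c x)) = x := by
  rw [← comp_apply, ← comp_apply, sigmaToPi, Sigma.ι_desc_assoc, Pi.lift_π,
    dif_pos rfl]
  rfl

lemma sigmaToPi_apply_of_ne {c : C} {i j : ι} (hij : i ≠ j) (x : (F i).obj.obj c) :
    (Pi.π F j).hom.app c ((sigmaToPi F).hom.app c ((Sigma.ι F i).hom.app c x)) = 0 := by
  rw [← comp_apply, ← comp_apply, sigmaToPi, Sigma.ι_desc_assoc, Pi.lift_π,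
    dif_neg hij]
  rfl

/-- A partial inverse of the canonical morphism from the coproduct to the product. -/
def piToSigma (c : C) (S : Finset ι) : (∏ᶜ F).obj.obj c →ₗ[k] (∐ F).obj.obj c :=
  ∑ i ∈ S, ((Sigma.ι F i).hom.app c).hom ∘ₗ ((Pi.π F i).hom.app c).hom

lemma piToSigma_apply (c : C) (S : Finset ι) (x : (∏ᶜ F).obj.obj c) :
    piToSigma F c S x = ∑ i ∈ S, (Sigma.ι F i).hom.app c ((Pi.π F i).hom.app c x) := by
  simp [piToSigma]

/-- Elements of a coproduct have finite support: summing the components over any finite set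
containing the support recovers the element. -/
lemma exists_piToSigma_sigmaToPi {c : C} (x : (∐ F).obj.obj c) :
    ∃ S₀ : Finset ι, ∀ S, S₀ ⊆ S → piToSigma F c S ((sigmaToPi F).hom.app c x) = x := by
  classical
  let p : Submodule k ((∐ F).obj.obj c) :=
    { carrier := {x | ∃ S₀ : Finset ι, ∀ S, S₀ ⊆ S →
        piToSigma F c S ((sigmaToPi F).hom.app c x) = x}
      zero_mem' := ⟨∅, fun S _ => by simp⟩
      add_mem' := by
        rintro x y ⟨S, hS⟩ ⟨S', hS'⟩
        refine ⟨S ∪ S', fun T hT => ?_⟩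
        rw [map_add, map_add, hS T (Finset.union_subset_left hT),
          hS' T (Finset.union_subset_right hT)]
      smul_mem' := by
        rintro r x ⟨S, hS⟩
        exact ⟨S, fun T hT => by rw [map_smul, map_smul, hS T hT]⟩ }
  have hp : p = ⊤ := sigma_induction F fun i x => by
    refine ⟨{i}, fun S hS => ?_⟩
    rw [piToSigma_apply, Finset.sum_eq_single i, sigmaToPi_apply_self]
    · intro j _ hj
      rw [sigmaToPi_apply_of_ne F hj.symm, map_zero]
    · intro hi
      exact absurd (hS (Finset.mem_singleton_self i)) hi
  exact hp.ge (Submodule.mem_top (x := x))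

instance : Mono (sigmaToPi F) := mono_of_injective _ fun c => by
  classical
  intro x y hxy
  obtain ⟨S, hS⟩ := exists_piToSigma_sigmaToPi F x
  obtain ⟨T, hT⟩ := exists_piToSigma_sigmaToPi F y
  rw [← hS _ Finset.subset_union_left, hxy, hT _ Finset.subset_union_right]

/-- Locally finite families have isomorphic products and coproducts. -/
lemma isIso_sigmaToPi (h : ∀ c, {i | ∃ x : (F i).obj.obj c, x ≠ 0}.Finite) :
    IsIso (sigmaToPi F) := by
  have : Epi (sigmaToPi F) := by
    refine epi_of_surjective _ fun c x => ?_
    -- Only finitely many factors are nonzero at `c`, so the sum of all components of `x` is a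
    -- finite sum, and it is a preimage.
    refine ⟨piToSigma F c (h c).toFinset x, pi_ext F fun i => ?_⟩
    rw [piToSigma_apply, map_sum, map_sum]
    by_cases hi : i ∈ (h c).toFinset
    · rw [Finset.sum_eq_single i, sigmaToPi_apply_self]
      · intro j _ hj
        rw [sigmaToPi_apply_of_ne F hj]
      · exact fun h => absurd hi h
    · rw [Finset.sum_eq_zero]
      · by_contra hx
        exact hi ((h c).mem_toFinset.2 ⟨_, Ne.symm hx⟩)
      · intro j hj
        rw [sigmaToPi_apply_of_ne F (by rintro rfl; exact hi hj)]
  exact isIso_of_mono_of_epi _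

variable {F} {G : ι → LMod k C}

/-- Products of monomorphisms are monomorphisms, and coproducts embed in products naturally. -/
lemma mono_sigmaMap (f : ∀ i, F i ⟶ G i) [∀ i, Mono (f i)] : Mono (Limits.Sigma.map f) := by
  have h : Limits.Sigma.map f ≫ sigmaToPi G = sigmaToPi F ≫ Limits.Pi.map f := by
    refine Sigma.hom_ext _ _ fun i => Pi.hom_ext _ _ fun j => ?_
    simp only [sigmaToPi, Sigma.ι_map_assoc, Sigma.ι_desc_assoc, Category.assoc, Pi.lift_π,
      Pi.map_π, Pi.lift_π_assoc]
    split_ifs with hij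
    · subst hij
      rw [eqToHom_refl, eqToHom_refl, Category.id_comp, Category.comp_id]
    · rw [zero_comp, comp_zero]
  have : Mono (Limits.Sigma.map f ≫ sigmaToPi G) := by
    rw [h]
    infer_instance
  exact mono_of_mono _ (sigmaToPi G)

lemma epi_piMap (f : ∀ i, F i ⟶ G i) [∀ i, Epi (f i)] : Epi (Limits.Pi.map f) := by
  refine epi_of_surjective _ fun c y => ?_
  choose x hx using fun i => surjective_of_epi (f i) c ((Pi.π G i).hom.app c y)
  obtain ⟨z, hz⟩ := pi_exists F x
  refine ⟨z, pi_ext G fun i => ?_⟩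
  rw [← comp_apply, Pi.map_π, comp_apply, hz, hx]

variable {H : ι → LMod k C}

lemma ses_sigma {f : ∀ i, F i ⟶ G i} {g : ∀ i, G i ⟶ H i} (h : ∀ i, SES (f i) (g i)) :
    SES (Limits.Sigma.map f) (Limits.Sigma.map g) := by
  have (i : ι) : Mono (f i) := (h i).mono
  have (i : ι) : Epi (g i) := (h i).epi
  have := mono_sigmaMap f
  refine SES.of_desc ?_ fun x hx => ?_
  · ext i
    simp [reassoc_of% (h i).comp_eq_zero]
  · have (i : ι) : ∃ y, g i ≫ y = Sigma.ι G i ≫ x := (h i).exists_desc _ (by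
      have := Sigma.ι F i ≫= hx
      rwa [Sigma.ι_map_assoc, comp_zero] at this)
    choose y hy using this
    exact ⟨Sigma.desc y, by ext i; simp [hy]⟩

lemma ses_pi {f : ∀ i, F i ⟶ G i} {g : ∀ i, G i ⟶ H i} (h : ∀ i, SES (f i) (g i)) :
    SES (Limits.Pi.map f) (Limits.Pi.map g) := by
  have (i : ι) : Mono (f i) := (h i).mono
  have (i : ι) : Epi (g i) := (h i).epi
  have := epi_piMap g
  refine SES.of_lift ?_ fun x hx => ?_
  · ext1 i
    simp [(h i).comp_eq_zero]
  · have (i : ι) : ∃ y, y ≫ f i = x ≫ Pi.π G i := (h i).exists_lift _ (by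
      have := hx =≫ Pi.π H i
      rwa [Category.assoc, Pi.map_π, ← Category.assoc, zero_comp] at this)
    choose y hy using this
    exact ⟨Pi.lift y, by ext1 i; simp [hy]⟩

/-- Coproducts are exact and preserve projectives, so projective presentations of the summands shift
the dimension for all of them simultaneously. -/
lemma projectiveDimension_sigma {n : ℕ} (h : ∀ i, HasProjectiveDimensionLT (F i) (n + 1)) :
    HasProjectiveDimensionLT (∐ F) (n + 1) := by
  induction n generalizing F with
  | zero =>
    have (i : ι) : Projective (F i) := projective_iff_hasProjectiveDimensionLT_one.2 (h i)
    exact projective_iff_hasProjectiveDimensionLT_one.1 inferInstance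
  | succ n ih =>
    have hs (i : ι) := SES.of_epi (Projective.π (F i))
    obtain ⟨w, hw⟩ := ses_sigma hs
    refine hw.hasProjectiveDimensionLT_X₃ (n + 1) (ih fun i => ?_) ?_
    · obtain ⟨w, hw⟩ := hs i
      exact hw.hasProjectiveDimensionLT_X₁ (n + 1)
        (hasProjectiveDimensionLT_of_ge (Projective.over (F i)) 1 _ (by lia)) (h i)
    · exact hasProjectiveDimensionLT_of_ge (∐ fun i => Projective.over (F i)) 1 _ (by lia)

lemma injectiveDimension_pi {n : ℕ} (h : ∀ i, HasInjectiveDimensionLT (F i) (n + 1)) :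
    HasInjectiveDimensionLT (∏ᶜ F) (n + 1) := by
  induction n generalizing F with
  | zero =>
    have (i : ι) : Injective (F i) := injective_iff_hasInjectiveDimensionLT_one.2 (h i)
    exact injective_iff_hasInjectiveDimensionLT_one.1 inferInstance
  | succ n ih =>
    have hs (i : ι) := SES.of_mono (Injective.ι (F i))
    obtain ⟨w, hw⟩ := ses_pi hs
    refine hw.hasInjectiveDimensionLT_X₁ (n + 1) (ih fun i => ?_) ?_
    · obtain ⟨w, hw⟩ := hs i
      exact hw.hasInjectiveDimensionLT_X₃ (n + 1)
        (hasInjectiveDimensionLT_of_ge (Injective.under (F i)) 1 _ (by lia)) (h i)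
    · exact hasInjectiveDimensionLT_of_ge (∏ᶜ fun i => Injective.under (F i)) 1 _ (by lia)

end Products

end LMod

end LModBasic

/-! ### Right modules `W` and the left modules `Hom_k(W, E)`. -/

section RightModules

variable (k : Type u) [CommRing k] (C : Type u) [SmallCategory C] [Preadditive C] [Linear k C]

/-- Right modules over a linear category. -/
structure RMod where
  /-- The underlying family of `k`-modules. -/
  obj : C → ModuleCat.{u} k
  /-- The right action of morphisms. -/
  act : ∀ {c d : C}, (c ⟶ d) →ₗ[k] obj d →ₗ[k] obj c
  act_id : ∀ (c : C) (x : obj c), act (𝟙 c) x = x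
  act_comp : ∀ {c d e : C} (f : c ⟶ d) (g : d ⟶ e) (x : obj e), act (f ≫ g) x = act f (act g x)

variable {C}

/-- The representable right module `C(-, c)`. -/
def RMod.free (c : C) : RMod k C where
  obj d := ModuleCat.of k (d ⟶ c)
  act {d d'} := Linear.comp d d' c
  act_id _ x := Category.id_comp x
  act_comp f g x := Category.assoc f g x

/-- The right module `D(C(c, -))`. -/
def RMod.dual (c : C) : RMod k C where
  obj d := ModuleCat.of k (Module.Dual k (c ⟶ d))
  act {d d'} := Module.Dual.transpose ∘ₗ (Linear.comp c d d').flip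
  act_id d φ := LinearMap.ext fun (g : c ⟶ d) =>
    congrArg (show Module.Dual k (c ⟶ d) from φ) (Category.comp_id g)
  act_comp {d _ e} f g φ := LinearMap.ext fun (x : c ⟶ d) =>
    congrArg (show Module.Dual k (c ⟶ e) from φ) (Category.assoc x f g).symm

variable {k}

/-- The left module `d ↦ Hom_k(W(d), E)`. -/
def RMod.hom (W : RMod k C) (E : ModuleCat.{u} k) : LMod k C :=
  LMod.ofAction (fun d => ModuleCat.of k (W.obj d →ₗ[k] E))
    (fun {c d} => (LinearMap.llcomp k (W.obj d) (W.obj c) E).flip ∘ₗ W.act)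
    (fun c φ => LinearMap.ext fun x => congrArg (show W.obj c →ₗ[k] E from φ) (W.act_id c x))
    (fun {c _ _} f g φ => LinearMap.ext fun x =>
      congrArg (show W.obj c →ₗ[k] E from φ) (W.act_comp f g x))

/-- The evaluation of an element of `Hom_k(W(d), E)`. -/
abbrev RMod.ap {W : RMod k C} {E : ModuleCat.{u} k} {d : C} (φ : (W.hom E).obj.obj d) :
    W.obj d →ₗ[k] E := φ

end RightModules

/-! ### Homological dimensions from vanishing derived Nakayama functors. -/

section Derived

variable {k : Type u} [CommRing k] {C : Type u} [SmallCategory C] [Preadditive C] [Linear k C]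

open Abelian

lemma LMod.exact_apply {S : ShortComplex (LMod k C)} (hS : S.Exact) {c : C} (y : S.X₂.obj.obj c)
    (hy : S.g.hom.app c y = 0) : ∃ x, S.f.hom.app c x = y := by
  have h : freeDesc y ≫ S.g = 0 := elem_ext (by
    rw [elem_comp, elem_freeDesc, hy]
    rfl)
  refine ⟨elem (hS.liftFromProjective (freeDesc y) h), ?_⟩
  rw [← elem_comp, hS.liftFromProjective_comp, elem_freeDesc]

lemma exact_of_isZero_rightDerived {A B : Type*} [Category* A] [Category* B] [Abelian A] [Abelian B]
    [EnoughInjectives A] {F : A ⥤ B} [F.Additive] {X : A} (R : InjectiveResolution X) (p : ℕ)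
    (h : IsZero (F.rightDerived (p + 1))) :
    (ShortComplex.mk (F.map (R.cocomplex.d p (p + 1))) (F.map (R.cocomplex.d (p + 1) (p + 1 + 1)))
      (by rw [← F.map_comp, R.cocomplex.d_comp_d, F.map_zero])).Exact := by
  have hz := (R.isoRightDerivedObj F (p + 1)).isZero_iff.1
    ((Functor.isZero_iff _).1 h X)
  have := (HomologicalComplex.exactAt_iff_isZero_homology _ _).2 hz
  rwa [HomologicalComplex.exactAt_iff' _ p (p + 1) (p + 1 + 1) (by simp) (by simp)] at this

lemma exact_of_isZero_leftDerived {A B : Type*} [Category* A] [Category* B] [Abelian A] [Abelian B]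
    [EnoughProjectives A] {F : A ⥤ B} [F.Additive] {X : A} (R : ProjectiveResolution X) (p : ℕ)
    (h : IsZero (F.leftDerived (p + 1))) :
    (ShortComplex.mk (F.map (R.complex.d (p + 1 + 1) (p + 1))) (F.map (R.complex.d (p + 1) p))
      (by rw [← F.map_comp, R.complex.d_comp_d, F.map_zero])).Exact := by
  have hz := (R.isoLeftDerivedObj F (p + 1)).isZero_iff.1
    ((Functor.isZero_iff _).1 h X)
  have := (HomologicalComplex.exactAt_iff_isZero_homology _ _).2 hz
  rwa [HomologicalComplex.exactAt_iff' _ (p + 1 + 1) (p + 1) p (by simp) (by simp)] at this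

/-- If `R^i ν⁻ = 0` for `i = n + 1`, the modules `D(C(-, c))` have projective dimension at
most `n`. -/
lemma projectiveDimension_dualLeft {n : ℕ} (h : IsZero ((nakayamaInv k C).rightDerived (n + 1)))
    (c : C) : HasProjectiveDimensionLT ((dualLeft k C).obj (op c)) (n + 1) := by
  let := HasExt.standard (LMod k C)
  refine hasProjectiveDimensionLT_of_enoughInjectives _ (n + 1) fun Y => ⟨fun α β => ?_⟩
  suffices H : ∀ α : Ext ((dualLeft k C).obj (op c)) Y (n + 1), α = 0 by rw [H α, H β]
  intro α
  let R := InjectiveResolution.of Y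
  -- A cocycle `f` from `D(C(-, c))` to the term of degree `n + 1` of the injective resolution is an
  -- element of `ν⁻` of that term at `c`, killed by the differential. Exactness of `ν⁻` of the
  -- resolution makes it a coboundary.
  obtain ⟨f, hf, rfl⟩ := R.extMk_surjective α (n + 1 + 1) rfl
  rw [R.extMk_eq_zero_iff _ _ _ _ n rfl]
  exact LMod.exact_apply (exact_of_isZero_rightDerived R n h) (c := c) f hf

lemma flip_hom_dual_balanced {c : C} {E : ModuleCat.{u} k} {F : LMod k C}
    (f : F ⟶ (RMod.dual k c).hom E) {d d' : C} (g : d ⟶ d') (φ : Module.Dual k (c ⟶ d'))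
    (x : F.obj.obj d) :
    RMod.ap (f.hom.app d x) (((dualRight k C).obj c).map g.op φ) =
      RMod.ap (f.hom.app d' (F.obj.map g x)) φ :=
  congr(RMod.ap $(LMod.naturality_apply f g x) φ).symm

/-- The linear map `D(C(c, -)) ⊗_C F ⟶ E` corresponding to a morphism
`F ⟶ Hom_k(D(C(c, -)), E)`. -/
def nakayamaEval {c : C} {E : ModuleCat.{u} k} {F : LMod k C}
    (f : F ⟶ (RMod.dual k c).hom E) : ((nakayama k C).obj F).obj.obj c ⟶ E :=
  ModuleCat.ofHom <| tensorLift (M := (dualRight k C).obj c) (F := F.obj) (N := E)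
    (fun d => LinearMap.flip (f.hom.app d).hom) (flip_hom_dual_balanced f)

lemma nakayamaEval_mk {c : C} {E : ModuleCat.{u} k} {F : LMod k C}
    (f : F ⟶ (RMod.dual k c).hom E) (d : C) (φ : Module.Dual k (c ⟶ d)) (x : F.obj.obj d) :
    nakayamaEval f (tensorMk ((dualRight k C).obj c) F.obj d φ x) = RMod.ap (f.hom.app d x) φ :=
  tensorLift_mk (M := (dualRight k C).obj c) (fun d => LinearMap.flip (f.hom.app d).hom)
    (flip_hom_dual_balanced f) d φ x

/-- The morphism `F ⟶ Hom_k(D(C(c, -)), E)` corresponding to a linear map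
`D(C(c, -)) ⊗_C F ⟶ E`. -/
def nakayamaCurry {c : C} {E : ModuleCat.{u} k} {F : LMod k C}
    (g : ((nakayama k C).obj F).obj.obj c ⟶ E) : F ⟶ (RMod.dual k c).hom E :=
  LMod.homOfLinear (G := (RMod.dual k c).hom E)
    (fun d => ((tensorMk ((dualRight k C).obj c) F.obj d).compr₂ g.hom).flip)
    (fun {_ d'} a x => LinearMap.ext fun (φ : Module.Dual k (c ⟶ d')) =>
      congrArg g.hom (tensorMk_balanced ((dualRight k C).obj c) F.obj a φ x).symm)

lemma nakayamaCurry_apply {c : C} {E : ModuleCat.{u} k} {F : LMod k C}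
    (g : ((nakayama k C).obj F).obj.obj c ⟶ E) (d : C) (φ : Module.Dual k (c ⟶ d))
    (x : F.obj.obj d) : RMod.ap ((nakayamaCurry g).hom.app d x) φ =
      g (tensorMk ((dualRight k C).obj c) F.obj d φ x) := rfl

/-- If `L_i ν = 0` for `i = n + 1`, the modules `Hom_k(D(C(c, -)), E)` have injective dimension at
most `n` for injective `E`. -/
lemma injectiveDimension_hom_dual {n : ℕ} (h : IsZero ((nakayama k C).leftDerived (n + 1)))
    (c : C) (E : ModuleCat.{u} k) [Injective E] :
    HasInjectiveDimensionLT ((RMod.dual k c).hom E) (n + 1) := by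
  let := HasExt.standard (LMod k C)
  refine hasInjectiveDimensionLT_of_enoughProjectives _ (n + 1) fun Y => ⟨fun α β => ?_⟩
  suffices H : ∀ α : Ext Y ((RMod.dual k c).hom E) (n + 1), α = 0 by rw [H α, H β]
  intro α
  let R := ProjectiveResolution.of Y
  obtain ⟨f, hf, rfl⟩ := R.extMk_surjective α (n + 1 + 1) rfl
  rw [R.extMk_eq_zero_iff _ _ _ _ n rfl]
  -- By adjunction the cocycle `f` becomes a linear map from `ν` of the degree `n + 1` term, at `c`,
  -- to `E`, vanishing on boundaries. The complex `ν(R)(c)` is exact in that degree.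
  have hex := exact_of_isZero_leftDerived R n h
  let S : ShortComplex (ModuleCat.{u} k) := ShortComplex.mk
    (((nakayama k C).map (R.complex.d (n + 1 + 1) (n + 1))).hom.app c)
    (((nakayama k C).map (R.complex.d (n + 1) n)).hom.app c) (by
      have h₀ : (nakayama k C).map (R.complex.d (n + 1 + 1) (n + 1)) ≫
          (nakayama k C).map (R.complex.d (n + 1) n) = 0 := by
        rw [← Functor.map_comp, R.complex.d_comp_d, Functor.map_zero]
      exact congr(($h₀).hom.app c))
  have hS : S.Exact := (ShortComplex.moduleCat_exact_iff S).2 fun y hy =>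
    LMod.exact_apply hex (c := c) y hy
  have hSf : S.f ≫ nakayamaEval f = 0 := tensorOver_hom_ext fun d φ x => by
    have h₁ := congrArg (nakayamaEval f) (nakayama_map_app_mk (R.complex.d (n + 1 + 1) (n + 1))
      c d φ x)
    refine h₁.trans ((nakayamaEval_mk f d φ _).trans ?_)
    exact congr(RMod.ap (($hf).hom.app d x) φ)
  -- Exactness and injectivity of `E` extend the linear map over the next term of `ν(R)(c)`;
  -- currying it back shows that `f` is a coboundary.
  refine ⟨nakayamaCurry (hS.descToInjective (nakayamaEval f) hSf), LMod.hom_ext fun d x => ?_⟩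
  refine LinearMap.ext fun (φ : Module.Dual k (c ⟶ d)) => ?_
  change RMod.ap ((nakayamaCurry _).hom.app d ((R.complex.d (n + 1) n).hom.app d x)) φ = _
  refine (nakayamaCurry_apply _ d φ _).trans ?_
  have h₁ := nakayama_map_app_mk (R.complex.d (n + 1) n) c d φ x
  refine (congrArg (hS.descToInjective (nakayamaEval f) hSf) h₁).symm.trans ?_
  exact (congr($(hS.comp_descToInjective (nakayamaEval f) hSf)
    (tensorMk ((dualRight k C).obj c) _ d φ x))).trans (nakayamaEval_mk f d φ x)

end Derived

/-! ### Modules over a tensor product of categories and the external tensor product. -/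

section Bimodules

variable {k : Type u} [CommRing k] {D C : Type u} [SmallCategory D] [Preadditive D] [Linear k D]
  [SmallCategory C] [Preadditive C] [Linear k C]

/-- The morphism `f ⊗ g` of `D ⊗_k C`. -/
def TensorCat.tmul {X Y : TensorCat k D C} (f : X.fst ⟶ Y.fst) (g : X.snd ⟶ Y.snd) : X ⟶ Y :=
  f ⊗ₜ[k] g

lemma TensorCat.tmul_comp_tmul {X Y Z : TensorCat k D C} (f : X.fst ⟶ Y.fst) (g : X.snd ⟶ Y.snd)
    (f' : Y.fst ⟶ Z.fst) (g' : Y.snd ⟶ Z.snd) :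
    tmul f g ≫ tmul f' g' = (tmul (f ≫ f') (g ≫ g') : X ⟶ Z) := rfl

lemma TensorCat.induction {X Y : TensorCat k D C} {p : (X ⟶ Y) → Prop} (h : X ⟶ Y) (zero : p 0)
    (tmul : ∀ f g, p (tmul f g)) (add : ∀ h h', p h → p h' → p (h + h')) : p h :=
  TensorProduct.induction_on (show (X.fst ⟶ Y.fst) ⊗[k] (X.snd ⟶ Y.snd) from h) zero tmul add

variable (k) in
/-- The bilinear map `(f, g) ↦ f ⊗ g`. -/
def TensorCat.tmulBilin (X Y : TensorCat k D C) :
    (X.fst ⟶ Y.fst) →ₗ[k] (X.snd ⟶ Y.snd) →ₗ[k] (X ⟶ Y) :=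
  TensorProduct.mk k (X.fst ⟶ Y.fst) (X.snd ⟶ Y.snd)

namespace LMod

/-- The action of morphisms on a module. -/
def act (F : LMod k C) {c d : C} : (c ⟶ d) →ₗ[k] F.obj.obj c →ₗ[k] F.obj.obj d where
  toFun f := (F.obj.map f).hom
  map_add' f g := LinearMap.ext (map_add_apply F f g)
  map_smul' r f := LinearMap.ext (map_smul_apply F r f)

lemma act_apply (F : LMod k C) {c d : C} (f : c ⟶ d) (x : F.obj.obj c) :
    F.act f x = F.obj.map f x := rfl

/-- A module over `D ⊗_k C`, given by the action of the morphisms `f ⊗ g`. -/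
def ofTensorAction (M : TensorCat k D C → ModuleCat.{u} k)
    (act : ∀ {X Y : TensorCat k D C}, (X.fst ⟶ Y.fst) →ₗ[k] (X.snd ⟶ Y.snd) →ₗ[k] M X →ₗ[k] M Y)
    (act_id : ∀ (X : TensorCat k D C) (x : M X), act (𝟙 X.fst) (𝟙 X.snd) x = x)
    (act_comp : ∀ {X Y Z : TensorCat k D C} (f : X.fst ⟶ Y.fst) (g : X.snd ⟶ Y.snd)
      (f' : Y.fst ⟶ Z.fst) (g' : Y.snd ⟶ Z.snd) (x : M X),
      act (f ≫ f') (g ≫ g') x = act f' g' (act f g x)) : LMod k (TensorCat k D C) :=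
  ofAction M (fun {X Y} => show (X.fst ⟶ Y.fst) ⊗[k] (X.snd ⟶ Y.snd) →ₗ[k] M X →ₗ[k] M Y from
      TensorProduct.lift act) act_id
    (by
      intro X Y Z h h' x
      induction h using TensorCat.induction with
      | zero =>
        rw [zero_comp, map_zero, map_zero, LinearMap.zero_apply, LinearMap.zero_apply, map_zero]
      | add h₁ h₂ ih₁ ih₂ =>
        rw [Preadditive.add_comp, map_add, map_add, LinearMap.add_apply, LinearMap.add_apply,
          map_add, ih₁, ih₂]
      | tmul f g =>
        induction h' using TensorCat.induction with
        | zero => rw [comp_zero, map_zero, map_zero, LinearMap.zero_apply, LinearMap.zero_apply]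
        | add h₁ h₂ ih₁ ih₂ =>
          rw [Preadditive.comp_add, map_add, map_add, LinearMap.add_apply, LinearMap.add_apply,
            ih₁, ih₂]
        | tmul f' g' => exact act_comp f g f' g' x)

/-- A morphism of modules over `D ⊗_k C`, given by linear maps compatible with the action of the
morphisms `f ⊗ g`. -/
def homOfTensor {F G : LMod k (TensorCat k D C)} (app : ∀ X, F.obj.obj X →ₗ[k] G.obj.obj X)
    (nat : ∀ {X Y : TensorCat k D C} (f : X.fst ⟶ Y.fst) (g : X.snd ⟶ Y.snd) (x : F.obj.obj X),
      app Y (F.obj.map (TensorCat.tmul f g) x) = G.obj.map (TensorCat.tmul f g) (app X x)) :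
    F ⟶ G :=
  homOfLinear app fun {X Y} h x => by
    rw [← act_apply, ← act_apply]
    induction h using TensorCat.induction with
    | zero => rw [map_zero, map_zero, LinearMap.zero_apply, LinearMap.zero_apply, map_zero]
    | add h₁ h₂ ih₁ ih₂ =>
      rw [map_add, map_add, LinearMap.add_apply, LinearMap.add_apply, map_add, ih₁, ih₂]
    | tmul f g => exact nat f g x

lemma map_tmul_comp_apply (F : LMod k (TensorCat k D C)) {X Y Z : TensorCat k D C}
    (f : X.fst ⟶ Y.fst) (g : X.snd ⟶ Y.snd) (f' : Y.fst ⟶ Z.fst) (g' : Y.snd ⟶ Z.snd)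
    (x : F.obj.obj X) : F.obj.map (TensorCat.tmul f' g') (F.obj.map (TensorCat.tmul f g) x) =
      F.obj.map (TensorCat.tmul (f ≫ f') (g ≫ g')) x := by
  rw [← map_comp_apply, TensorCat.tmul_comp_tmul]

/-- The restriction of a module over `D ⊗_k C` to `D`, at an object of `C`. -/
def left (F : LMod k (TensorCat k D C)) (c : C) : LMod k D :=
  ofAction (fun a => F.obj.obj ⟨a, c⟩)
    (fun {a b} => F.act ∘ₗ (TensorCat.tmulBilin k ⟨a, c⟩ ⟨b, c⟩).flip (𝟙 c))
    (fun a x => map_id_apply F x)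
    (fun {a b e} f g x => by
      refine Eq.symm ((map_tmul_comp_apply F (X := ⟨a, c⟩) (Y := ⟨b, c⟩) (Z := ⟨e, c⟩)
        f (𝟙 c) g (𝟙 c) x).trans ?_)
      rw [Category.comp_id]
      rfl)

/-- The restriction of a module over `D ⊗_k C` to `C`, at an object of `D`. -/
def right (F : LMod k (TensorCat k D C)) (a : D) : LMod k C :=
  ofAction (fun c => F.obj.obj ⟨a, c⟩)
    (fun {c d} => F.act ∘ₗ (TensorCat.tmulBilin k ⟨a, c⟩ ⟨a, d⟩) (𝟙 a))
    (fun a x => map_id_apply F x)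
    (fun {c d e} f g x => by
      refine Eq.symm ((map_tmul_comp_apply F (X := ⟨a, c⟩) (Y := ⟨a, d⟩) (Z := ⟨a, e⟩)
        (𝟙 a) f (𝟙 a) g x).trans ?_)
      rw [Category.comp_id]
      rfl)

/-- The restriction of a morphism of modules over `D ⊗_k C` to `D`. -/
def leftMap {F G : LMod k (TensorCat k D C)} (φ : F ⟶ G) (c : C) : F.left c ⟶ G.left c :=
  homOfLinear (F := F.left c) (G := G.left c) (fun a => (φ.hom.app ⟨a, c⟩).hom)
    (fun {a b} f x => naturality_apply φ (TensorCat.tmul (X := ⟨a, c⟩) (Y := ⟨b, c⟩) f (𝟙 c)) x)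

/-- The restriction of a morphism of modules over `D ⊗_k C` to `C`. -/
def rightMap {F G : LMod k (TensorCat k D C)} (φ : F ⟶ G) (a : D) : F.right a ⟶ G.right a :=
  homOfLinear (F := F.right a) (G := G.right a) (fun c => (φ.hom.app ⟨a, c⟩).hom)
    (fun {c d} f x => naturality_apply φ (TensorCat.tmul (X := ⟨a, c⟩) (Y := ⟨a, d⟩) (𝟙 a) f) x)

/-- The action of the morphisms of `C` on the restrictions of a module over `D ⊗_k C` to `D`. -/
def leftAct (F : LMod k (TensorCat k D C)) {c d : C} : (c ⟶ d) →ₗ[k] (F.left c ⟶ F.left d) where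
  toFun g := homOfLinear (F := F.left c) (G := F.left d)
    (fun a => F.act (TensorCat.tmul (X := ⟨a, c⟩) (Y := ⟨a, d⟩) (𝟙 a) g))
    (fun {a b} f x => by
      refine (map_tmul_comp_apply F (X := ⟨a, c⟩) (Y := ⟨b, c⟩) (Z := ⟨b, d⟩)
        f (𝟙 c) (𝟙 b) g x).trans (Eq.trans ?_ (map_tmul_comp_apply F (X := ⟨a, c⟩) (Y := ⟨a, d⟩)
          (Z := ⟨b, d⟩) (𝟙 a) g f (𝟙 d) x).symm)
      rw [Category.comp_id, Category.comp_id, Category.id_comp, Category.id_comp])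
  map_add' g h := hom_ext fun a x =>
    congr($(((F.act ∘ₗ (TensorCat.tmulBilin k ⟨a, c⟩ ⟨a, d⟩) (𝟙 a)).map_add g h)) x)
  map_smul' r g := hom_ext fun a x =>
    congr($(((F.act ∘ₗ (TensorCat.tmulBilin k ⟨a, c⟩ ⟨a, d⟩) (𝟙 a)).map_smul r g)) x)

/-- The `C`-module `c ↦ Hom_D(X, F(-, c))`. -/
def ihom (X : LMod k D) (F : LMod k (TensorCat k D C)) : LMod k C :=
  ofAction (fun c => ModuleCat.of k (X ⟶ F.left c))
    (fun {c d} => (Linear.comp X (F.left c) (F.left d)).flip ∘ₗ F.leftAct)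
    (fun c φ => hom_ext fun a x => map_id_apply F _)
    (fun {c d e} g h φ => hom_ext fun a x => by
      refine Eq.trans ?_ (map_tmul_comp_apply F (X := ⟨a, c⟩) (Y := ⟨a, d⟩) (Z := ⟨a, e⟩)
        (𝟙 a) g (𝟙 a) h _).symm
      rw [Category.comp_id]
      rfl)

/-- The functoriality of `c ↦ Hom_D(X, F(-, c))`. -/
def ihomMap (X : LMod k D) {F G : LMod k (TensorCat k D C)} (φ : F ⟶ G) : ihom X F ⟶ ihom X G :=
  homOfLinear (F := ihom X F) (G := ihom X G)
    (fun c => Linear.rightComp k X (leftMap φ c))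
    (fun {c d} g _ => hom_ext fun a _ =>
      naturality_apply φ (TensorCat.tmul (X := ⟨a, c⟩) (Y := ⟨a, d⟩) (𝟙 a) g) _)

instance (X : LMod k D) [Projective X] {F G : LMod k (TensorCat k D C)} (φ : F ⟶ G) [Epi φ] :
    Epi (ihomMap X φ) :=
  epi_of_surjective _ fun c (ψ : X ⟶ G.left c) => by
    have : Epi (leftMap φ c) := epi_of_surjective _ fun a => surjective_of_epi φ ⟨a, c⟩
    exact ⟨Projective.factorThru ψ (leftMap φ c), Projective.factorThru_comp ψ (leftMap φ c)⟩

/-- The external tensor product `(a, c) ↦ V(c) ⊗_k X(a)`. -/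
def box (X : LMod k D) (V : LMod k C) : LMod k (TensorCat k D C) :=
  ofTensorAction (fun Z => ModuleCat.of k (V.obj.obj Z.snd ⊗[k] X.obj.obj Z.fst))
    (fun {Z Z'} => (TensorProduct.mapBilinear (RingHom.id k) (V.obj.obj Z.snd) (X.obj.obj Z.fst)
      (V.obj.obj Z'.snd) (X.obj.obj Z'.fst)).flip.compl₁₂ X.act V.act)
    (fun Z x => LinearMap.congr_fun (f := TensorProduct.map (V.act (𝟙 Z.snd)) (X.act (𝟙 Z.fst)))
      (g := LinearMap.id) (TensorProduct.ext' fun v y =>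
        congr($(map_id_apply V v) ⊗ₜ[k] $(map_id_apply X y))) x)
    (fun f g f' g' x => LinearMap.congr_fun
      (f := TensorProduct.map (V.act (g ≫ g')) (X.act (f ≫ f')))
      (g := TensorProduct.map (V.act g') (X.act f') ∘ₗ TensorProduct.map (V.act g) (X.act f))
      (TensorProduct.ext' fun v y =>
        congr($(map_comp_apply V g g' v) ⊗ₜ[k] $(map_comp_apply X f f' y))) x)

/-- The functoriality of the external tensor product. -/
def boxMap {X X' : LMod k D} {V V' : LMod k C} (φ : X ⟶ X') (ψ : V ⟶ V') : box X V ⟶ box X' V' :=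
  homOfTensor (F := box X V) (G := box X' V')
    (fun Z => TensorProduct.map (ψ.hom.app Z.snd).hom (φ.hom.app Z.fst).hom)
    (fun {Z Z'} f g x => LinearMap.congr_fun
      (f := TensorProduct.map (ψ.hom.app Z'.snd).hom (φ.hom.app Z'.fst).hom ∘ₗ
        TensorProduct.map (V.act g) (X.act f))
      (g := TensorProduct.map (V'.act g) (X'.act f) ∘ₗ
        TensorProduct.map (ψ.hom.app Z.snd).hom (φ.hom.app Z.fst).hom)
      (TensorProduct.ext' fun v y =>
        congr($(naturality_apply ψ g v) ⊗ₜ[k] $(naturality_apply φ f y))) x)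

/-- The components of `boxDesc`. -/
def boxDescApp {X : LMod k D} {V : LMod k C} {F : LMod k (TensorCat k D C)} (φ : V ⟶ ihom X F)
    (Z : TensorCat k D C) : V.obj.obj Z.snd ⊗[k] X.obj.obj Z.fst →ₗ[k] F.obj.obj Z :=
  TensorProduct.lift (LinearMap.mk₂ k
    (fun v x => (show X ⟶ F.left Z.snd from φ.hom.app Z.snd v).hom.app Z.fst x)
    (fun v w x => congr((show X ⟶ F.left Z.snd from
      $(map_add (φ.hom.app Z.snd).hom v w)).hom.app Z.fst x))
    (fun r v x => congr((show X ⟶ F.left Z.snd from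
      $(map_smul (φ.hom.app Z.snd).hom r v)).hom.app Z.fst x))
    (fun v x y => map_add ((show X ⟶ F.left Z.snd from φ.hom.app Z.snd v).hom.app Z.fst).hom x y)
    (fun r v x =>
      map_smul ((show X ⟶ F.left Z.snd from φ.hom.app Z.snd v).hom.app Z.fst).hom r x))

/-- The morphism of modules over `D ⊗_k C` given by a morphism `V ⟶ Hom_D(X, F)`. -/
def boxDesc {X : LMod k D} {V : LMod k C} {F : LMod k (TensorCat k D C)} (φ : V ⟶ ihom X F) :
    box X V ⟶ F :=
  homOfTensor (F := box X V) (boxDescApp φ)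
    (fun {Z Z'} f g x => LinearMap.congr_fun
      (f := boxDescApp φ Z' ∘ₗ TensorProduct.map (V.act g) (X.act f))
      (g := F.act (TensorCat.tmul f g) ∘ₗ boxDescApp φ Z)
      (TensorProduct.ext' fun v y => by
        have h₁ : φ.hom.app Z'.snd (V.act g v) = _ := naturality_apply φ g v
        have h₂ := naturality_apply (show X ⟶ F.left Z'.snd from φ.hom.app Z'.snd (V.act g v)) f y
        refine h₂.trans ?_
        rw [h₁]
        refine (map_tmul_comp_apply F (X := Z) (Y := ⟨Z.fst, Z'.snd⟩) (Z := Z') (𝟙 _) g f (𝟙 _)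
          _).trans ?_
        rw [Category.comp_id, Category.id_comp]
        rfl) x)

lemma box_hom_ext {X : LMod k D} {V : LMod k C} {F : LMod k (TensorCat k D C)} {f g : box X V ⟶ F}
    (h : ∀ (Z : TensorCat k D C) (v : V.obj.obj Z.snd) (x : X.obj.obj Z.fst),
      f.hom.app Z (show (box X V).obj.obj Z from v ⊗ₜ[k] x) =
        g.hom.app Z (show (box X V).obj.obj Z from v ⊗ₜ[k] x)) : f = g :=
  hom_ext fun Z => LinearMap.congr_fun
    (f := (show V.obj.obj Z.snd ⊗[k] X.obj.obj Z.fst →ₗ[k] F.obj.obj Z from (f.hom.app Z).hom))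
    (g := (show V.obj.obj Z.snd ⊗[k] X.obj.obj Z.fst →ₗ[k] F.obj.obj Z from (g.hom.app Z).hom))
    (TensorProduct.ext' (h Z))

/-- The morphism `V ⟶ Hom_D(X, F)` given by a morphism of modules over `D ⊗_k C`. -/
def boxCurry {X : LMod k D} {V : LMod k C} {F : LMod k (TensorCat k D C)} (f : box X V ⟶ F) :
    V ⟶ ihom X F :=
  homOfLinear (F := V) (G := ihom X F)
    (fun c =>
      { toFun := fun v => homOfLinear (F := X) (G := F.left c)
          (fun a => (f.hom.app ⟨a, c⟩).hom ∘ₗ TensorProduct.mk k (V.obj.obj c) (X.obj.obj a) v)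
          (fun {a b} h x => by
            refine Eq.trans ?_ (naturality_apply f (TensorCat.tmul (X := ⟨a, c⟩) (Y := ⟨b, c⟩) h (𝟙 c))
              (show V.obj.obj c ⊗[k] X.obj.obj a from v ⊗ₜ x))
            exact congrArg (f.hom.app ⟨b, c⟩)
              congr($(map_id_apply V v) ⊗ₜ[k] X.obj.map h x).symm)
        map_add' := fun v w => hom_ext fun a x =>
          (congrArg (f.hom.app ⟨a, c⟩) (TensorProduct.add_tmul v w x)).trans
            (map_add (f.hom.app ⟨a, c⟩).hom _ _)
        map_smul' := fun r v => hom_ext fun a x => map_smul (f.hom.app ⟨a, c⟩).hom r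
          (show (box X V).obj.obj ⟨a, c⟩ from v ⊗ₜ[k] x) })
    (fun {c d} g v => hom_ext fun a x => by
      refine Eq.trans ?_ (naturality_apply f (TensorCat.tmul (X := ⟨a, c⟩) (Y := ⟨a, d⟩) (𝟙 a) g)
        (show V.obj.obj c ⊗[k] X.obj.obj a from v ⊗ₜ x))
      exact congrArg (f.hom.app ⟨a, d⟩) congr(V.obj.map g v ⊗ₜ[k] $(map_id_apply X x)).symm)

/-- `V ↦ box X V` is left adjoint to `ihom X`, which preserves epimorphisms when `X` is projective.
-/
instance (X : LMod k D) (V : LMod k C) [Projective X] [Projective V] : Projective (box X V) where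
  factors {F G} f e _ := by
    refine ⟨boxDesc (Projective.factorThru (boxCurry f) (ihomMap X e)), box_hom_ext fun Z v x => ?_⟩
    have := congr((show X ⟶ G.left Z.snd from
      ($(Projective.factorThru_comp (boxCurry f) (ihomMap X e)).hom.app Z.snd v)).hom.app Z.fst x)
    exact this

end LMod

end Bimodules

/-! ### Projective dimension of injective modules over the tensor product. -/

section ProjectiveDimension

variable {k : Type u} [CommRing k] {D C : Type u} [SmallCategory D] [Preadditive D] [Linear k D]
  [SmallCategory C] [Preadditive C] [Linear k C]

namespace LMod

/-- The functoriality of coinduced modules. -/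
def cofreeMap (c : C) {E E' : ModuleCat.{u} k} (f : E ⟶ E') : cofree c E ⟶ cofree c E' :=
  homOfLinear (F := cofree c E) (G := cofree c E') (fun d => LinearMap.compRight (M := (d ⟶ c)) k f.hom)
    (fun _ _ => rfl)

/-- Evaluation at `c` has the right adjoint `cofree c`, which preserves epimorphisms because the
Hom-modules are projective; so evaluation preserves projectives. -/
lemma projective_obj (hC : ∀ c d : C, Module.Projective k (c ⟶ d)) (V : LMod k C) [Projective V]
    (c : C) : Module.Projective k (V.obj.obj c) := by
  refine (IsProjective.iff_projective (R := k) (V.obj.obj c)).2 ⟨fun {E E'} f e _ => ?_⟩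
  have : Epi (cofreeMap c e) := epi_of_surjective _ fun d (φ : (d ⟶ c) →ₗ[k] E') => by
    obtain ⟨ψ, hψ⟩ := Module.projective_lifting_property e.hom φ ((ModuleCat.epi_iff_surjective e).1 ‹_›)
    exact ⟨ψ, hψ⟩
  let ψ := Projective.factorThru (cofreeLift f) (cofreeMap c e)
  refine ⟨(evaluation c).map ψ ≫ ModuleCat.ofHom (X := ((c ⟶ c) →ₗ[k] E)) (Y := E)
    (LinearMap.applyₗ (𝟙 c)), ?_⟩
  ext x
  have := congr((show (c ⟶ c) →ₗ[k] E' from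
    ($(Projective.factorThru_comp (cofreeLift f) (cofreeMap c e))).hom.app c x) (𝟙 c))
  refine this.trans ?_
  exact congrArg f (map_id_apply V x)

variable {F G H : LMod k C} {f : F ⟶ G} {g : G ⟶ H}

lemma exists_retraction_of_projective (h : SES f g) (c : C) [Module.Projective k (H.obj.obj c)] :
    ∃ r : G.obj.obj c →ₗ[k] F.obj.obj c, r ∘ₗ (f.hom.app c).hom = LinearMap.id := by
  obtain ⟨h₁, h₂, h₃⟩ := (ses_iff f g).1 h c
  obtain ⟨s, hs⟩ := Module.projective_lifting_property (g.hom.app c).hom LinearMap.id h₃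
  have h₄ : Function.Exact (f.hom.app c).hom (g.hom.app c).hom := h₂
  have h₅ := h₄.split_tfae'.out 0 1
  exact (h₅.1 ⟨h₁, s, hs⟩).2

lemma projective_obj_left (h : SES f g) (c : C) [Module.Projective k (G.obj.obj c)]
    [Module.Projective k (H.obj.obj c)] : Module.Projective k (F.obj.obj c) := by
  obtain ⟨r, hr⟩ := exists_retraction_of_projective h c
  exact Module.Projective.of_split _ r hr

/-- No flatness of `X` over `k` is available, so exactness comes from a pointwise splitting, due to
projectivity of the values of `H`. -/
lemma ses_box_right (X : LMod k D) (h : SES f g) (hH : ∀ c, Module.Projective k (H.obj.obj c)) :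
    SES (boxMap (𝟙 X) f) (boxMap (𝟙 X) g) := by
  refine (ses_iff _ _).2 fun Z => ?_
  obtain ⟨h₁, h₂, h₃⟩ := (ses_iff f g).1 h Z.snd
  obtain ⟨r, hr⟩ := exists_retraction_of_projective h Z.snd
  refine ⟨?_, ?_, ?_⟩
  · refine Function.LeftInverse.injective (g := LinearMap.rTensor (X.obj.obj Z.fst) r) fun x => ?_
    refine LinearMap.congr_fun (f := LinearMap.rTensor (X.obj.obj Z.fst) r ∘ₗ
      LinearMap.rTensor (X.obj.obj Z.fst) (f.hom.app Z.snd).hom) (g := LinearMap.id) ?_ x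
    rw [← LinearMap.rTensor_comp, hr, LinearMap.rTensor_id]
  · exact rTensor_exact (X.obj.obj Z.fst) (f := (f.hom.app Z.snd).hom) (g := (g.hom.app Z.snd).hom)
      h₂ h₃
  · exact LinearMap.rTensor_surjective (X.obj.obj Z.fst) (g := (g.hom.app Z.snd).hom) h₃

lemma ses_box_left (X : LMod k D) [∀ a, Module.Flat k (X.obj.obj a)] (h : SES f g) :
    SES (boxMap f (𝟙 X)) (boxMap g (𝟙 X)) := by
  refine (ses_iff _ _).2 fun Z => ?_
  obtain ⟨h₁, h₂, h₃⟩ := (ses_iff f g).1 h Z.fst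
  refine ⟨?_, ?_, ?_⟩
  · exact Module.Flat.lTensor_preserves_injective_linearMap (f.hom.app Z.fst).hom h₁
  · exact lTensor_exact (X.obj.obj Z.snd) (f := (f.hom.app Z.fst).hom) (g := (g.hom.app Z.fst).hom)
      h₂ h₃
  · exact LinearMap.lTensor_surjective (X.obj.obj Z.snd) (g := (g.hom.app Z.fst).hom) h₃

/-- A projective `V` has values projective over `k`, hence flat, so tensoring with it is exact and
takes projectives to projectives. -/
lemma projectiveDimension_box_of_projective (hC : ∀ c d : C, Module.Projective k (c ⟶ d))
    (X : LMod k D) (V : LMod k C) [Projective V] {m : ℕ} (hX : HasProjectiveDimensionLT X (m + 1)) :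
    HasProjectiveDimensionLT (box X V) (m + 1) := by
  induction m generalizing X with
  | zero =>
    have : Projective X := projective_iff_hasProjectiveDimensionLT_one.2 hX
    exact projective_iff_hasProjectiveDimensionLT_one.1 inferInstance
  | succ m ih =>
    have := projective_obj hC V
    have hs := SES.of_epi (Projective.π X)
    obtain ⟨w, hw⟩ := ses_box_left V hs
    refine hw.hasProjectiveDimensionLT_X₃ (m + 1) (ih _ ?_) ?_
    · obtain ⟨w, hw⟩ := hs
      exact hw.hasProjectiveDimensionLT_X₁ (m + 1)
        (hasProjectiveDimensionLT_of_ge (Projective.over X) 1 _ (by lia)) hX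
    · exact hasProjectiveDimensionLT_of_ge (box (Projective.over X) V) 1 _ (by lia)

/-- Induction on the dimension of `V`. The hypothesis on the values of `V` keeps the presentation
exact after tensoring with `X`, and it passes to the syzygy, because a pointwise split kernel of a
map between pointwise projective modules is pointwise projective. -/
lemma projectiveDimension_box (hC : ∀ c d : C, Module.Projective k (c ⟶ d))
    (X : LMod k D) (V : LMod k C) (hV : ∀ c, Module.Projective k (V.obj.obj c)) {m n : ℕ}
    (hX : HasProjectiveDimensionLT X (m + 1)) (hn : HasProjectiveDimensionLT V (n + 1)) :
    HasProjectiveDimensionLT (box X V) (m + n + 1) := by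
  induction n generalizing V with
  | zero =>
    have : Projective V := projective_iff_hasProjectiveDimensionLT_one.2 hn
    exact projectiveDimension_box_of_projective hC X V hX
  | succ n ih =>
    have hs := SES.of_epi (Projective.π V)
    obtain ⟨w, hw⟩ := ses_box_right X hs hV
    have hP := projective_obj hC (Projective.over V)
    refine hw.hasProjectiveDimensionLT_X₃ (m + n + 1) (ih _
      (fun c => projective_obj_left hs c) ?_) ?_
    · obtain ⟨w, hw⟩ := hs
      exact hw.hasProjectiveDimensionLT_X₁ (n + 1)
        (hasProjectiveDimensionLT_of_ge (Projective.over V) 1 _ (by lia)) hn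
    · have := projectiveDimension_box_of_projective hC X (Projective.over V) hX
      exact hasProjectiveDimensionLT_of_ge _ (m + 1) _ (by lia)

/-- The module `(a, c) ↦ Hom_k(W(c), X(a))` over `D ⊗_k C`. -/
def bihom (W : RMod k C) (X : LMod k D) : LMod k (TensorCat k D C) :=
  ofTensorAction (fun Z => ModuleCat.of k (W.obj Z.snd →ₗ[k] X.obj.obj Z.fst))
    (fun {Z _} => LinearMap.mk₂ k
      (fun f g => LinearMap.compRight k (X.act f) ∘ₗ LinearMap.lcomp k (X.obj.obj Z.fst) (W.act g))
      (fun f f' _ => LinearMap.ext fun _ => LinearMap.ext fun _ => map_add_apply X f f' _)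
      (fun r f _ => LinearMap.ext fun _ => LinearMap.ext fun _ => map_smul_apply X r f _)
      (fun f g g' => LinearMap.ext fun (φ : W.obj Z.snd →ₗ[k] X.obj.obj Z.fst) =>
        LinearMap.ext fun w =>
          (congrArg ((X.act f) ∘ₗ φ) congr($(W.act.map_add g g') w)).trans (map_add _ _ _))
      (fun r f g => LinearMap.ext fun (φ : W.obj Z.snd →ₗ[k] X.obj.obj Z.fst) =>
        LinearMap.ext fun w =>
          (congrArg ((X.act f) ∘ₗ φ) congr($(W.act.map_smul r g) w)).trans (map_smul _ _ _)))
    (fun Z φ => LinearMap.ext fun w => (map_id_apply X _).trans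
      (congrArg (show W.obj Z.snd →ₗ[k] X.obj.obj Z.fst from φ) (W.act_id Z.snd w)))
    (fun {Z _ _} f g f' g' φ => LinearMap.ext fun w => (map_comp_apply X f f' _).trans
      (congrArg (X.act f' ∘ₗ X.act f ∘ₗ (show W.obj Z.snd →ₗ[k] X.obj.obj Z.fst from φ))
        (W.act_comp g g' w)))

/-- The evaluation of an element of `Hom_k(W(c), X(a))`. -/
abbrev bihomAp {W : RMod k C} {X : LMod k D} {Z : TensorCat k D C} (φ : (bihom W X).obj.obj Z) :
    W.obj Z.snd →ₗ[k] X.obj.obj Z.fst := φ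

/-- The morphism `F ⟶ Hom_k(C(-, c), E)` given by a morphism `F(-, c) ⟶ E`. -/
def bihomLift {F : LMod k (TensorCat k D C)} {c : C} {E : LMod k D} (φ : F.left c ⟶ E) :
    F ⟶ bihom (RMod.free k c) E :=
  homOfTensor (G := bihom (RMod.free k c) E)
    (fun Z => ((φ.hom.app Z.fst).hom.compRight k (M := F.obj.obj Z)) ∘ₗ
      (F.act ∘ₗ TensorCat.tmulBilin k Z ⟨Z.fst, c⟩ (𝟙 Z.fst))
      |>.flip)
    (fun {Z Z'} f g x => LinearMap.ext fun (h : Z'.snd ⟶ c) => by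
      refine Eq.trans ?_ (naturality_apply φ f
        (F.obj.map (TensorCat.tmul (X := Z) (Y := ⟨Z.fst, c⟩) (𝟙 Z.fst) (g ≫ h)) x))
      refine congrArg (φ.hom.app Z'.fst) ?_
      refine (map_tmul_comp_apply F (X := Z) (Y := Z') (Z := ⟨Z'.fst, c⟩) f g (𝟙 _) h x).trans
        (Eq.trans ?_ (map_tmul_comp_apply F (X := Z) (Y := ⟨Z.fst, c⟩) (Z := ⟨Z'.fst, c⟩)
          (𝟙 _) (g ≫ h) f (𝟙 c) x).symm)
      rw [Category.comp_id, Category.comp_id, Category.id_comp])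

lemma bihomLift_apply_id {F : LMod k (TensorCat k D C)} {c : C} {E : LMod k D} (φ : F.left c ⟶ E)
    (a : D) (x : F.obj.obj ⟨a, c⟩) :
    bihomAp ((bihomLift φ).hom.app ⟨a, c⟩ x) (show (RMod.free k c).obj c from 𝟙 c) =
      φ.hom.app a x :=
  congrArg (φ.hom.app a) (map_id_apply F x)

/-- The factor indexed by `c`, evaluated at `𝟙 c`, recovers `φ c`, so it already separates the
elements of `F(a, c)`. -/
lemma mono_piLift_bihomLift {F : LMod k (TensorCat k D C)} {E : C → LMod k D}
    (φ : ∀ c, F.left c ⟶ E c) [∀ c, Mono (φ c)] : Mono (Pi.lift fun c => bihomLift (φ c)) :=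
  mono_of_injective _ fun ⟨a, c⟩ x y hxy => by
    refine injective_of_mono (φ c) a ?_
    have h := congrArg ((Pi.π (fun c => bihom (RMod.free k c) (E c)) c).hom.app ⟨a, c⟩) hxy
    rw [← comp_apply, ← comp_apply, Pi.lift_π] at h
    rw [← bihomLift_apply_id, h, bihomLift_apply_id]

/-- The canonical morphism `D(C(-, c)) ⊗_k E ⟶ Hom_k(C(-, c), E)`. -/
def dualBox (c : C) (E : LMod k D) : box E ((dualLeft k C).obj (op c)) ⟶ bihom (RMod.free k c) E :=
  homOfTensor (F := box E ((dualLeft k C).obj (op c))) (G := bihom (RMod.free k c) E)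
    (fun Z => dualTensorHom k (Z.snd ⟶ c) (E.obj.obj Z.fst))
    (fun {Z Z'} f g x => LinearMap.congr_fun
      (f := dualTensorHom k (Z'.snd ⟶ c) (E.obj.obj Z'.fst) ∘ₗ TensorProduct.map
        (Linear.leftComp k c g).dualMap (E.act f))
      (g := (bihom (RMod.free k c) E).act (TensorCat.tmul f g) ∘ₗ
        dualTensorHom k (Z.snd ⟶ c) (E.obj.obj Z.fst))
      (TensorProduct.ext' fun φ y => LinearMap.ext fun h =>
        ((E.act f).map_smul (φ (g ≫ h)) y).symm) x)

lemma isIso_dualBox (hC : IsHomFinite k C) (c : C) (E : LMod k D) : IsIso (dualBox c E) :=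
  isIso_of_bijective _ fun Z => by
    have := (hC Z.snd c).1
    have := (hC Z.snd c).2
    exact dualTensorHom_bijective

lemma projectiveDimension_of_injective (hb : IsLocallyBounded C) (hC : IsHomFinite k C) {m n : ℕ}
    (hE : ∀ E : LMod k D, Injective E → HasProjectiveDimensionLT E (m + 1))
    (hn : ∀ c, HasProjectiveDimensionLT ((dualLeft k C).obj (op c)) (n + 1))
    (F : LMod k (TensorCat k D C)) [Injective F] : HasProjectiveDimensionLT F (m + n + 1) := by
  let E (c : C) := Injective.under (F.left c)
  have := mono_piLift_bihomLift fun c => Injective.ι (F.left c)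
  let r : Retract F (∏ᶜ fun c => bihom (RMod.free k c) (E c)) :=
    { i := Pi.lift fun c => bihomLift (Injective.ι (F.left c))
      r := Injective.factorThru (𝟙 F) (Pi.lift fun c => bihomLift (Injective.ι (F.left c)))
      retract := Injective.comp_factorThru _ _ }
  suffices HasProjectiveDimensionLT (∏ᶜ fun c => bihom (RMod.free k c) (E c)) (m + n + 1) from
    r.hasProjectiveDimensionLT _
  -- At an object `Z` the factor at `c` vanishes unless there is a nonzero morphism `Z.snd ⟶ c`;
  -- local boundedness leaves finitely many.
  have := isIso_sigmaToPi (fun c => bihom (RMod.free k c) (E c)) fun Z =>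
    (hb Z.snd).1.subset fun c ⟨φ, hφ⟩ => by
      by_contra h
      simp only [Set.mem_ofPred_eq, not_exists, not_not] at h
      exact hφ (LinearMap.ext fun (g : Z.snd ⟶ c) =>
        (congrArg (bihomAp φ) (h g)).trans (map_zero (bihomAp φ)))
  have (c : C) : HasProjectiveDimensionLT (bihom (RMod.free k c) (E c)) (m + n + 1) := by
    have := isIso_dualBox hC c (E c)
    have := projectiveDimension_box (fun c d => (hC c d).2) (E c) ((dualLeft k C).obj (op c))
      (fun d => by
        have := (hC d c).1
        have := (hC d c).2
        exact inferInstanceAs (Module.Projective k (Module.Dual k (d ⟶ c))))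
      (hE (E c) inferInstance) (hn c)
    exact hasProjectiveDimensionLT_of_iso (asIso (dualBox c (E c))) _
  have := projectiveDimension_sigma this
  exact hasProjectiveDimensionLT_of_iso
    (asIso (sigmaToPi fun c => bihom (RMod.free k c) (E c))) _

end LMod

end ProjectiveDimension

/-! ### Injective dimension of the modules `Hom_k(W, X)`. -/

section InjectiveDimension

variable {k : Type u} [CommRing k] {D C : Type u} [SmallCategory D] [Preadditive D] [Linear k D]
  [SmallCategory C] [Preadditive C] [Linear k C]

/-- `Hom_k(M, -)` is right adjoint to tensoring with the flat module `M`, which preserves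
monomorphisms. -/
lemma injective_linearMap (M : Type u) [AddCommGroup M] [Module k M] [Module.Flat k M]
    (E : ModuleCat.{u} k) [Injective E] : Injective (ModuleCat.of k (M →ₗ[k] E)) where
  factors {A B} f e _ := by
    have he : Function.Injective e.hom := (ModuleCat.mono_iff_injective e).1 ‹_›
    let e' : ModuleCat.of k (A ⊗[k] M) ⟶ ModuleCat.of k (B ⊗[k] M) :=
      ModuleCat.ofHom (e.hom.rTensor M)
    have : Mono e' := (ModuleCat.mono_iff_injective e').2
      (Module.Flat.rTensor_preserves_injective_linearMap e.hom he)
    let f' : ModuleCat.of k (A ⊗[k] M) ⟶ E := ModuleCat.ofHom (TensorProduct.lift f.hom)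
    refine ⟨ModuleCat.ofHom (X := B) (Y := (M →ₗ[k] E))
      (TensorProduct.curry (show B ⊗[k] M →ₗ[k] E from (Injective.factorThru f' e').hom)), ?_⟩
    exact ModuleCat.hom_ext <| LinearMap.ext fun x => LinearMap.ext fun (m : M) =>
      congr($(Injective.comp_factorThru f' e') (x ⊗ₜ[k] m))

namespace LMod

/-- The induced module `d ↦ C(c, d) ⊗_k E`. -/
def freeTensor (c : C) (E : ModuleCat.{u} k) : LMod k C :=
  ofAction (fun d => ModuleCat.of k ((c ⟶ d) ⊗[k] E))
    (fun {d d'} => LinearMap.rTensorHom E ∘ₗ (Linear.comp c d d').flip)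
    (fun d x => LinearMap.congr_fun (f := LinearMap.rTensor E (Linear.rightComp k c (𝟙 d)))
      (g := LinearMap.id) (TensorProduct.ext' fun g y =>
        congr($(Category.comp_id g) ⊗ₜ[k] y)) x)
    (fun f g x => LinearMap.congr_fun (f := LinearMap.rTensor E (Linear.rightComp k c (f ≫ g)))
      (g := LinearMap.rTensor E (Linear.rightComp k c g) ∘ₗ
        LinearMap.rTensor E (Linear.rightComp k c f)) (TensorProduct.ext' fun h y =>
        congr($((Category.assoc h f g).symm) ⊗ₜ[k] y)) x)

/-- The functoriality of induced modules. -/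
def freeTensorMap (c : C) {E E' : ModuleCat.{u} k} (f : E ⟶ E') :
    freeTensor c E ⟶ freeTensor c E' :=
  homOfLinear (F := freeTensor c E) (G := freeTensor c E') (fun d => f.hom.lTensor (c ⟶ d))
    (fun {d d'} g x => LinearMap.congr_fun
      (f := f.hom.lTensor (c ⟶ d') ∘ₗ LinearMap.rTensor E (Linear.rightComp k c g))
      (g := LinearMap.rTensor E' (Linear.rightComp k c g) ∘ₗ f.hom.lTensor (c ⟶ d))
      (TensorProduct.ext' fun _ _ => rfl) x)

/-- The morphism `C(c, -) ⊗_k E ⟶ F` given by a morphism `E ⟶ F(c)`. -/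
def freeTensorDesc {c : C} {E : ModuleCat.{u} k} {F : LMod k C} (f : E ⟶ F.obj.obj c) :
    freeTensor c E ⟶ F :=
  homOfLinear (F := freeTensor c E)
    (fun d => TensorProduct.lift ((LinearMap.lcomp k (F.obj.obj d) f.hom) ∘ₗ F.act (c := c) (d := d)))
    (fun {d d'} g x => LinearMap.congr_fun
      (f := TensorProduct.lift ((LinearMap.lcomp k (F.obj.obj d') f.hom) ∘ₗ F.act (c := c) (d := d'))
        ∘ₗ LinearMap.rTensor E (Linear.rightComp k c g))
      (g := F.act g ∘ₗ
        TensorProduct.lift ((LinearMap.lcomp k (F.obj.obj d) f.hom) ∘ₗ F.act (c := c) (d := d)))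
      (TensorProduct.ext' fun h y => map_comp_apply F h g (f y)) x)

/-- Evaluation at `c` has the left adjoint `freeTensor c`, which preserves monomorphisms because the
Hom-modules are flat. -/
lemma injective_obj (hC : ∀ c d : C, Module.Flat k (c ⟶ d)) (V : LMod k C) [Injective V]
    (c : C) : Injective (V.obj.obj c) where
  factors {A B} f e _ := by
    have he : Function.Injective e.hom := (ModuleCat.mono_iff_injective e).1 ‹_›
    have : Mono (freeTensorMap c e) := mono_of_injective _ fun d =>
      Module.Flat.lTensor_preserves_injective_linearMap (M := (c ⟶ d)) e.hom he
    let ψ := Injective.factorThru (freeTensorDesc f) (freeTensorMap c e)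
    refine ⟨ModuleCat.ofHom ((ψ.hom.app c).hom ∘ₗ TensorProduct.mk k (c ⟶ c) B (𝟙 c)), ?_⟩
    ext x
    refine Eq.trans ?_ (map_id_apply V (f x))
    exact congr(($(Injective.comp_factorThru (freeTensorDesc f) (freeTensorMap c e))).hom.app c
      (𝟙 c ⊗ₜ[k] x))

variable {F G H : LMod k C} {f : F ⟶ G} {g : G ⟶ H}

lemma exists_section_of_injective (h : SES f g) (c : C) [Injective (F.obj.obj c)] :
    ∃ s : H.obj.obj c →ₗ[k] G.obj.obj c, (g.hom.app c).hom ∘ₗ s = LinearMap.id := by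
  obtain ⟨h₁, h₂, h₃⟩ := (ses_iff f g).1 h c
  have : Mono (f.hom.app c) := (ModuleCat.mono_iff_injective _).2 h₁
  have h₄ : Function.Exact (f.hom.app c).hom (g.hom.app c).hom := h₂
  have h₅ := h₄.split_tfae'.out 0 1
  exact (h₅.2 ⟨h₃, (Injective.factorThru (𝟙 _) (f.hom.app c)).hom,
    congr(($(Injective.comp_factorThru (𝟙 _) (f.hom.app c))).hom)⟩).2

/-- The sequence splits at `c`. This keeps cosyzygies pointwise injective in
`injectiveDimension_coind`. -/
lemma injective_obj_right (h : SES f g) (c : C) [Injective (F.obj.obj c)]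
    [Injective (G.obj.obj c)] : Injective (H.obj.obj c) := by
  obtain ⟨s, hs⟩ := exists_section_of_injective h c
  let r : Retract (H.obj.obj c) (G.obj.obj c) :=
    { i := ModuleCat.ofHom s
      r := g.hom.app c
      retract := ModuleCat.hom_ext hs }
  exact r.injective

/-- The module `(b, c) ↦ Hom_k(D(b, a), V(c))` over `D ⊗_k C`. -/
def coind (a : D) (V : LMod k C) : LMod k (TensorCat k D C) :=
  ofTensorAction (fun Z => ModuleCat.of k ((Z.fst ⟶ a) →ₗ[k] V.obj.obj Z.snd))
    (fun {Z Z'} => LinearMap.mk₂ k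
      (fun f g => LinearMap.compRight k (V.act g) ∘ₗ
        LinearMap.lcomp k (V.obj.obj Z.snd) (Linear.leftComp k a f))
      (fun f f' g => LinearMap.ext fun (φ : (Z.fst ⟶ a) →ₗ[k] V.obj.obj Z.snd) =>
        LinearMap.ext fun (h : Z'.fst ⟶ a) =>
          (congrArg ((V.act g) ∘ₗ φ) (Preadditive.add_comp _ _ _ f f' h)).trans (map_add _ _ _))
      (fun r f g => LinearMap.ext fun (φ : (Z.fst ⟶ a) →ₗ[k] V.obj.obj Z.snd) =>
        LinearMap.ext fun (h : Z'.fst ⟶ a) =>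
          (congrArg ((V.act g) ∘ₗ φ) (Linear.smul_comp _ _ _ r f h)).trans (map_smul _ _ _))
      (fun _ g g' => LinearMap.ext fun _ => LinearMap.ext fun _ => map_add_apply V g g' _)
      (fun r _ g => LinearMap.ext fun _ => LinearMap.ext fun _ => map_smul_apply V r g _))
    (fun Z φ => LinearMap.ext fun (h : Z.fst ⟶ a) => (map_id_apply V _).trans
      (congrArg (show (Z.fst ⟶ a) →ₗ[k] V.obj.obj Z.snd from φ) (Category.id_comp h)))
    (fun {Z _ Z''} f g f' g' φ => LinearMap.ext fun (h : Z''.fst ⟶ a) =>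
      (map_comp_apply V g g' _).trans (congrArg
        (V.act g' ∘ₗ V.act g ∘ₗ (show (Z.fst ⟶ a) →ₗ[k] V.obj.obj Z.snd from φ))
        (Category.assoc f f' h)))

/-- The evaluation of an element of `Hom_k(D(b, a), V(c))`. -/
abbrev coindAp {a : D} {V : LMod k C} {Z : TensorCat k D C} (φ : (coind a V).obj.obj Z) :
    (Z.fst ⟶ a) →ₗ[k] V.obj.obj Z.snd := φ

lemma coind_map_apply {a : D} {V : LMod k C} {Z Z' : TensorCat k D C} (f : Z.fst ⟶ Z'.fst)
    (g : Z.snd ⟶ Z'.snd) (φ : (coind a V).obj.obj Z) (h : Z'.fst ⟶ a) :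
    coindAp ((coind a V).obj.map (TensorCat.tmul f g) φ) h =
      V.obj.map g (coindAp φ (f ≫ h)) := rfl

/-- The functoriality of `V ↦ Hom_k(D(-, a), V)`. -/
def coindMap (a : D) {V V' : LMod k C} (ψ : V ⟶ V') : coind a V ⟶ coind a V' :=
  homOfTensor (F := coind a V) (G := coind a V')
    (fun Z => LinearMap.compRight (M := (Z.fst ⟶ a)) k (ψ.hom.app Z.snd).hom)
    (fun {_ Z'} _ g _ => LinearMap.ext fun (_ : Z'.fst ⟶ a) => naturality_apply ψ g _)

/-- The morphism `F ⟶ Hom_k(D(-, a), V)` given by a morphism `F(a, -) ⟶ V`. -/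
def coindLift {F : LMod k (TensorCat k D C)} {a : D} {V : LMod k C} (ψ : F.right a ⟶ V) :
    F ⟶ coind a V :=
  homOfTensor (G := coind a V)
    (fun Z => (((ψ.hom.app Z.snd).hom.compRight k (M := F.obj.obj Z)) ∘ₗ
      (F.act ∘ₗ (TensorCat.tmulBilin k Z ⟨a, Z.snd⟩).flip (𝟙 Z.snd))).flip)
    (fun {Z Z'} f g x => LinearMap.ext fun (h : Z'.fst ⟶ a) => by
      refine Eq.trans ?_ (naturality_apply ψ g
        (F.obj.map (TensorCat.tmul (X := Z) (Y := ⟨a, Z.snd⟩) (f ≫ h) (𝟙 Z.snd)) x))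
      refine congrArg (ψ.hom.app Z'.snd) ?_
      refine (map_tmul_comp_apply F (X := Z) (Y := Z') (Z := ⟨a, Z'.snd⟩) f g h (𝟙 _) x).trans
        (Eq.trans ?_ (map_tmul_comp_apply F (X := Z) (Y := ⟨a, Z.snd⟩) (Z := ⟨a, Z'.snd⟩)
          (f ≫ h) (𝟙 _) (𝟙 a) g x).symm)
      rw [Category.comp_id, Category.comp_id, Category.id_comp])

/-- The morphism `F(a, -) ⟶ V` given by a morphism `F ⟶ Hom_k(D(-, a), V)`. -/
def coindEval {F : LMod k (TensorCat k D C)} {a : D} {V : LMod k C} (φ : F ⟶ coind a V) :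
    F.right a ⟶ V :=
  homOfLinear (F := F.right a)
    (fun c => LinearMap.applyₗ (R := k) (M := (a ⟶ a)) (M₂ := V.obj.obj c) (𝟙 a) ∘ₗ
      (φ.hom.app ⟨a, c⟩).hom)
    (fun {c d} g x => by
      have h := congr(coindAp $(naturality_apply φ (TensorCat.tmul (X := ⟨a, c⟩) (Y := ⟨a, d⟩)
        (𝟙 a) g) x) (𝟙 a))
      refine h.trans ((coind_map_apply (Z := ⟨a, c⟩) (Z' := ⟨a, d⟩) (𝟙 a) g
        (φ.hom.app ⟨a, c⟩ x) (𝟙 a)).trans ?_)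
      rw [Category.comp_id]
      rfl)

lemma coindLift_coindEval {F : LMod k (TensorCat k D C)} {a : D} {V : LMod k C}
    (φ : F ⟶ coind a V) : coindLift (coindEval φ) = φ :=
  hom_ext fun Z x => LinearMap.ext fun (h : Z.fst ⟶ a) => by
    have h₁ := congr(coindAp $(naturality_apply φ (TensorCat.tmul (X := Z) (Y := ⟨a, Z.snd⟩)
      h (𝟙 Z.snd)) x) (𝟙 a))
    refine h₁.trans ((coind_map_apply (Z := Z) (Z' := ⟨a, Z.snd⟩) h (𝟙 Z.snd)
      (φ.hom.app Z x) (𝟙 a)).trans ?_)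
    rw [Category.comp_id]
    exact map_id_apply V _

/-- `coind a` is right adjoint to the restriction `F ↦ F(a, -)`, which preserves monomorphisms. -/
instance (a : D) (V : LMod k C) [Injective V] : Injective (coind a V) where
  factors {F G} f e _ := by
    have : Mono (rightMap e a) := mono_of_injective _ fun c => injective_of_mono e ⟨a, c⟩
    refine ⟨coindLift (Injective.factorThru (coindEval f) (rightMap e a)), ?_⟩
    refine (coindLift_coindEval _).symm.trans (Eq.trans ?_ (coindLift_coindEval f))
    refine congrArg coindLift (Eq.trans (hom_ext fun c x => ?_)
      (Injective.comp_factorThru (coindEval f) (rightMap e a)))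
    exact congrArg ((Injective.factorThru (coindEval f) (rightMap e a)).hom.app c)
      (map_id_apply G _)

/-- The `k`-modules `D(b, a)` are arbitrary, so `Hom_k(D(b, a), -)` need not be exact; injectivity
of the values of `F` splits the sequence pointwise. -/
lemma ses_coind (a : D) (h : SES f g) (hF : ∀ c, Injective (F.obj.obj c)) :
    SES (coindMap a f) (coindMap a g) := by
  refine (ses_iff _ _).2 fun Z => ?_
  obtain ⟨h₁, h₂, h₃⟩ := (ses_iff f g).1 h Z.snd
  obtain ⟨s, hs⟩ := exists_section_of_injective h Z.snd
  refine ⟨fun φ ψ hφψ => LinearMap.ext fun (x : Z.fst ⟶ a) => h₁ congr(coindAp $hφψ x),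
    fun (φ : (Z.fst ⟶ a) →ₗ[k] G.obj.obj Z.snd) => ⟨fun hφ => ?_, ?_⟩,
    fun φ => ⟨s ∘ₗ coindAp φ, LinearMap.ext fun (x : Z.fst ⟶ a) => congr($hs (coindAp φ x))⟩⟩
  · have hmem (x) : φ x ∈ LinearMap.range (f.hom.app Z.snd).hom := (h₂ _).1 congr(coindAp $hφ x)
    refine ⟨(LinearEquiv.ofInjective (f.hom.app Z.snd).hom h₁).symm.toLinearMap ∘ₗ
      φ.codRestrict _ hmem, LinearMap.ext fun (x : Z.fst ⟶ a) => ?_⟩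
    exact congr($((LinearEquiv.ofInjective (f.hom.app Z.snd).hom h₁).apply_symm_apply
      ⟨φ x, hmem x⟩).1)
  · rintro ⟨ψ, rfl⟩
    exact LinearMap.ext fun (x : Z.fst ⟶ a) => h₂.apply_apply_eq_zero (coindAp ψ x)

lemma injectiveDimension_coind (hC : ∀ c d : C, Module.Flat k (c ⟶ d)) (a : D) (V : LMod k C)
    (hV : ∀ c, Injective (V.obj.obj c)) {n : ℕ} (hn : HasInjectiveDimensionLT V (n + 1)) :
    HasInjectiveDimensionLT (coind a V) (n + 1) := by
  induction n generalizing V with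
  | zero =>
    have : Injective V := injective_iff_hasInjectiveDimensionLT_one.2 hn
    exact injective_iff_hasInjectiveDimensionLT_one.1 inferInstance
  | succ n ih =>
    have hs := SES.of_mono (Injective.ι V)
    have hI := injective_obj hC (Injective.under V)
    obtain ⟨w, hw⟩ := ses_coind a hs hV
    refine hw.hasInjectiveDimensionLT_X₁ (n + 1) (ih _ (fun c => injective_obj_right hs c) ?_) ?_
    · obtain ⟨w, hw⟩ := hs
      exact hw.hasInjectiveDimensionLT_X₃ (n + 1)
        (hasInjectiveDimensionLT_of_ge (Injective.under V) 1 _ (by lia)) hn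
    · exact hasInjectiveDimensionLT_of_ge (coind a (Injective.under V)) 1 _ (by lia)

/-- The isomorphism `Hom_k(W, Hom_k(D(-, a), E)) ⟶ Hom_k(D(-, a), Hom_k(W, E))`. -/
def bihomCofree (W : RMod k C) (a : D) (E : ModuleCat.{u} k) :
    bihom W (cofree a E) ⟶ coind a (W.hom E) :=
  homOfTensor (F := bihom W (cofree a E)) (G := coind a (W.hom E))
    (fun Z => LinearMap.lflip.toLinearMap (M := (W.obj Z.snd →ₗ[k] (Z.fst ⟶ a) →ₗ[k] E)))
    (fun _ _ _ => rfl)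

instance (W : RMod k C) (a : D) (E : ModuleCat.{u} k) : IsIso (bihomCofree W a E) :=
  isIso_of_bijective _ fun Z =>
    (LinearMap.lflip (R₀ := k) (M := W.obj Z.snd) (N := (Z.fst ⟶ a)) (P := E)).bijective

/-- The functoriality of `X ↦ Hom_k(W, X)`. -/
def bihomMap (W : RMod k C) {X X' : LMod k D} (φ : X ⟶ X') : bihom W X ⟶ bihom W X' :=
  homOfTensor (F := bihom W X) (G := bihom W X')
    (fun Z => LinearMap.compRight (M := W.obj Z.snd) k (φ.hom.app Z.fst).hom)
    (fun f _ _ => LinearMap.ext fun _ => naturality_apply φ f _)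

lemma bihomMap_apply (W : RMod k C) {X X' : LMod k D} (φ : X ⟶ X') {Z : TensorCat k D C}
    (x : (bihom W X).obj.obj Z) (w : W.obj Z.snd) :
    bihomAp ((bihomMap W φ).hom.app Z x) w = φ.hom.app Z.fst (bihomAp x w) := rfl

/-- A retract of `X` yields a retract of `Hom_k(W, X)`. -/
def bihomRetract (W : RMod k C) {X Y : LMod k D} (r : Retract X Y) :
    Retract (bihom W X) (bihom W Y) where
  i := bihomMap W r.i
  r := bihomMap W r.r
  retract := hom_ext fun Z φ => LinearMap.ext fun w =>
    congr(($(r.retract)).hom.app Z.fst (bihomAp φ w))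

lemma ses_bihom (W : RMod k C) (hW : ∀ c, Module.Projective k (W.obj c)) {X Y Z : LMod k D}
    {f : X ⟶ Y} {g : Y ⟶ Z} (h : SES f g) : SES (bihomMap W f) (bihomMap W g) := by
  refine (ses_iff _ _).2 fun T => ?_
  obtain ⟨h₁, h₂, h₃⟩ := (ses_iff f g).1 h T.fst
  refine ⟨fun φ ψ hφψ => LinearMap.ext fun x => h₁ congr(bihomAp $hφψ x),
    fun (φ : W.obj T.snd →ₗ[k] Y.obj.obj T.fst) => ⟨fun hφ => ?_, ?_⟩,
    fun φ => Module.projective_lifting_property (g.hom.app T.fst).hom (bihomAp φ) h₃⟩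
  · have hmem (x) : φ x ∈ LinearMap.range (f.hom.app T.fst).hom := (h₂ _).1 congr(bihomAp $hφ x)
    refine ⟨(LinearEquiv.ofInjective (f.hom.app T.fst).hom h₁).symm.toLinearMap ∘ₗ
      φ.codRestrict _ hmem, LinearMap.ext fun x => ?_⟩
    exact congr($((LinearEquiv.ofInjective (f.hom.app T.fst).hom h₁).apply_symm_apply
      ⟨φ x, hmem x⟩).1)
  · rintro ⟨ψ, rfl⟩
    exact LinearMap.ext fun x => h₂.apply_apply_eq_zero (bihomAp ψ x)

/-- The canonical morphism `Hom_k(W, ∏ X_i) ⟶ ∏ Hom_k(W, X_i)`. -/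
def bihomPi (W : RMod k C) {ι : Type u} (X : ι → LMod k D) :
    bihom W (∏ᶜ X) ⟶ ∏ᶜ fun i => bihom W (X i) :=
  Pi.lift fun i => bihomMap W (Pi.π X i)

lemma bihomPi_apply (W : RMod k C) {ι : Type u} (X : ι → LMod k D) {Z : TensorCat k D C}
    (φ : (bihom W (∏ᶜ X)).obj.obj Z) (i : ι) (w : W.obj Z.snd) :
    bihomAp ((Pi.π (fun i => bihom W (X i)) i).hom.app Z ((bihomPi W X).hom.app Z φ)) w =
      (Pi.π X i).hom.app Z.fst (bihomAp φ w) := by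
  rw [← comp_apply, bihomPi, Pi.lift_π, bihomMap_apply]

instance (W : RMod k C) {ι : Type u} (X : ι → LMod k D) : IsIso (bihomPi W X) :=
  isIso_of_bijective _ fun Z => by
    refine ⟨fun φ ψ h => LinearMap.ext fun w => pi_ext X fun i => ?_, fun y => ?_⟩
    · change (Pi.π X i).hom.app Z.fst (bihomAp φ w) = (Pi.π X i).hom.app Z.fst (bihomAp ψ w)
      rw [← bihomPi_apply, h, bihomPi_apply]
    · choose φ hφ using fun w : W.obj Z.snd => pi_exists X (c := Z.fst)
        fun i => bihomAp ((Pi.π (fun i => bihom W (X i)) i).hom.app Z y) w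
      let ψ : W.obj Z.snd →ₗ[k] (∏ᶜ X).obj.obj Z.fst :=
        { toFun := φ
          map_add' := fun v w => pi_ext X fun i => by
            rw [map_add, hφ, hφ, hφ, map_add]
          map_smul' := fun r w => pi_ext X fun i => by
            rw [map_smul, hφ, hφ, map_smul, RingHom.id_apply] }
      refine ⟨ψ, pi_ext _ fun i => LinearMap.ext fun w => ?_⟩
      exact (bihomPi_apply W X (Z := Z) ψ i w).trans (hφ w i)

lemma mono_piLift_cofreeLift {F : LMod k D} {E : D → ModuleCat.{u} k}
    (φ : ∀ a, F.obj.obj a ⟶ E a) [∀ a, Mono (φ a)] : Mono (Pi.lift fun a => cofreeLift (φ a)) :=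
  mono_of_injective _ fun a x y hxy => by
    refine (ModuleCat.mono_iff_injective (φ a)).1 inferInstance ?_
    have h := congrArg ((Pi.π (fun a => cofree a (E a)) a).hom.app a) hxy
    rw [← comp_apply, ← comp_apply, Pi.lift_π] at h
    have h₁ : φ a (F.obj.map (𝟙 a) x) = φ a (F.obj.map (𝟙 a) y) :=
      congr((show (a ⟶ a) →ₗ[k] E a from $h) (𝟙 a))
    rwa [map_id_apply, map_id_apply] at h₁

/-- An injective `X` is a retract of a product of coinduced modules `cofree a E`. Since `Hom_k(W,
-)` commutes with products, and exchanging the two arguments turns `Hom_k(W, cofree a E)` into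
`coind a (W.hom E)`, the bound `n` on `W.hom E` carries over. The general case follows by induction
on the injective dimension of `X`, as `Hom_k(W, -)` is exact for pointwise projective `W`. -/
lemma injectiveDimension_bihom (hC : ∀ c d : C, Module.Flat k (c ⟶ d)) (W : RMod k C)
    (hW : ∀ c, Module.Projective k (W.obj c)) {m n : ℕ}
    (hn : ∀ E : ModuleCat.{u} k, Injective E → HasInjectiveDimensionLT (W.hom E) (n + 1))
    (X : LMod k D) (hm : HasInjectiveDimensionLT X (m + 1)) :
    HasInjectiveDimensionLT (bihom W X) (m + n + 1) := by
  have base (X : LMod k D) [Injective X] : HasInjectiveDimensionLT (bihom W X) (n + 1) := by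
    let E (a : D) := Injective.under (X.obj.obj a)
    have := mono_piLift_cofreeLift fun a => Injective.ι (X.obj.obj a)
    let r : Retract X (∏ᶜ fun a => cofree a (E a)) :=
      { i := Pi.lift fun a => cofreeLift (Injective.ι (X.obj.obj a))
        r := Injective.factorThru (𝟙 X) (Pi.lift fun a => cofreeLift (Injective.ι (X.obj.obj a)))
        retract := Injective.comp_factorThru _ _ }
    suffices HasInjectiveDimensionLT (bihom W (∏ᶜ fun a => cofree a (E a))) (n + 1) from
      (bihomRetract W r).hasInjectiveDimensionLT _
    have (a : D) : HasInjectiveDimensionLT (bihom W (cofree a (E a))) (n + 1) := by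
      have := injectiveDimension_coind hC a (W.hom (E a))
        (fun c => injective_linearMap (W.obj c) (E a)) (hn (E a) inferInstance)
      exact hasInjectiveDimensionLT_of_iso (asIso (bihomCofree W a (E a))).symm _
    have := injectiveDimension_pi this
    exact hasInjectiveDimensionLT_of_iso (asIso (bihomPi W fun a => cofree a (E a))).symm _
  induction m generalizing X with
  | zero =>
    have : Injective X := injective_iff_hasInjectiveDimensionLT_one.2 hm
    rw [Nat.zero_add]
    exact base X
  | succ m ih =>
    have hs := SES.of_mono (Injective.ι X)
    obtain ⟨w, hw⟩ := ses_bihom W hW hs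
    rw [Nat.add_right_comm m 1 n]
    refine hw.hasInjectiveDimensionLT_X₁ (m + n + 1) (ih _ ?_) ?_
    · obtain ⟨w, hw⟩ := hs
      exact hw.hasInjectiveDimensionLT_X₃ (m + 1)
        (hasInjectiveDimensionLT_of_ge (Injective.under X) 1 _ (by lia)) hm
    · have := base (Injective.under X)
      exact hasInjectiveDimensionLT_of_ge _ (n + 1) _ (by lia)

end LMod

end InjectiveDimension

/-! ### Injective dimension of projectives over the tensor product, and the conclusion. -/

section TensorGorenstein

variable {k : Type u} [CommRing k] {D C : Type u} [SmallCategory D] [Preadditive D] [Linear k D]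
  [SmallCategory C] [Preadditive C] [Linear k C]

namespace LMod

/-- The morphism `C(c, -) ⊗_k X ⟶ F` given by a morphism `X ⟶ F(-, c)`. -/
def boxFreeDesc {F : LMod k (TensorCat k D C)} {X : LMod k D} {c : C} (φ : X ⟶ F.left c) :
    box X (free k c) ⟶ F :=
  boxDesc (freeDesc (F := ihom X F) (show (ihom X F).obj.obj c from φ))

lemma boxFreeDesc_apply {F : LMod k (TensorCat k D C)} {X : LMod k D} {c : C} (φ : X ⟶ F.left c)
    (a : D) (x : X.obj.obj a) :
    (boxFreeDesc φ).hom.app ⟨a, c⟩ (show (box X (free k c)).obj.obj ⟨a, c⟩ from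
      (show (c ⟶ c) ⊗[k] X.obj.obj a from 𝟙 c ⊗ₜ x)) = φ.hom.app a x :=
  map_id_apply F _

/-- An element of `F(a, c)` is already the image of some `𝟙 c ⊗ x` in the summand indexed by `c`. -/
lemma epi_sigmaDesc_boxFreeDesc {F : LMod k (TensorCat k D C)} {X : C → LMod k D}
    (φ : ∀ c, X c ⟶ F.left c) [∀ c, Epi (φ c)] : Epi (Sigma.desc fun c => boxFreeDesc (φ c)) :=
  epi_of_surjective _ fun ⟨a, c⟩ y => by
    obtain ⟨x, rfl⟩ := surjective_of_epi (φ c) a y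
    refine ⟨(Sigma.ι (fun c => box (X c) (free k c)) c).hom.app ⟨a, c⟩
      (show (c ⟶ c) ⊗[k] (X c).obj.obj a from 𝟙 c ⊗ₜ x), ?_⟩
    refine Eq.trans ?_ (boxFreeDesc_apply (φ c) a x)
    exact congr(($(Sigma.ι_desc (fun c => boxFreeDesc (φ c)) c)).hom.app ⟨a, c⟩
      (show (box (X c) (free k c)).obj.obj ⟨a, c⟩ from
        (show (c ⟶ c) ⊗[k] (X c).obj.obj a from 𝟙 c ⊗ₜ x)))

/-- The canonical morphism `C(c, -) ⊗_k X ⟶ Hom_k(D(C(c, -)), X)`. -/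
def boxBidual (c : C) (X : LMod k D) : box X (free k c) ⟶ bihom (RMod.dual k c) X :=
  homOfTensor (F := box X (free k c)) (G := bihom (RMod.dual k c) X)
    (fun Z => dualTensorHom k (Module.Dual k (c ⟶ Z.snd)) (X.obj.obj Z.fst) ∘ₗ
      (Module.Dual.eval k (c ⟶ Z.snd)).rTensor (X.obj.obj Z.fst))
    (fun {Z Z'} f g x => LinearMap.congr_fun
      (f := (dualTensorHom k (Module.Dual k (c ⟶ Z'.snd)) (X.obj.obj Z'.fst) ∘ₗ
        (Module.Dual.eval k (c ⟶ Z'.snd)).rTensor (X.obj.obj Z'.fst)) ∘ₗ TensorProduct.map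
        (Linear.rightComp k c g) (X.act f))
      (g := (bihom (RMod.dual k c) X).act (TensorCat.tmul f g) ∘ₗ
        dualTensorHom k (Module.Dual k (c ⟶ Z.snd)) (X.obj.obj Z.fst) ∘ₗ
          (Module.Dual.eval k (c ⟶ Z.snd)).rTensor (X.obj.obj Z.fst))
      (TensorProduct.ext' fun h y => LinearMap.ext fun (ψ : Module.Dual k (c ⟶ Z'.snd)) =>
        ((X.act f).map_smul (ψ (h ≫ g)) y).symm) x)

/-- Finitely generated projective modules are reflexive, and tensoring with their duals computes
`Hom_k` out of them. -/
lemma isIso_boxBidual (hC : IsHomFinite k C) (c : C) (X : LMod k D) : IsIso (boxBidual c X) :=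
  isIso_of_bijective _ fun Z => by
    have := (hC c Z.snd).1
    have := (hC c Z.snd).2
    refine (dualTensorHom_bijective (R := k) (M := Module.Dual k (c ⟶ Z.snd))
      (N := X.obj.obj Z.fst)).comp ?_
    exact ((Module.evalEquiv k (c ⟶ Z.snd)).rTensor (X.obj.obj Z.fst)).bijective

lemma injectiveDimension_of_projective (hb : IsLocallyBounded C) (hC : IsHomFinite k C) {m n : ℕ}
    (hm : ∀ X : LMod k D, Projective X → HasInjectiveDimensionLT X (m + 1))
    (hn : ∀ (c : C) (E : ModuleCat.{u} k), Injective E →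
      HasInjectiveDimensionLT ((RMod.dual k c).hom E) (n + 1))
    (F : LMod k (TensorCat k D C)) [Projective F] : HasInjectiveDimensionLT F (m + n + 1) := by
  let X (c : C) := Projective.over (F.left c)
  have := epi_sigmaDesc_boxFreeDesc fun c => Projective.π (F.left c)
  let r : Retract F (∐ fun c => box (X c) (free k c)) :=
    { i := Projective.factorThru (𝟙 F) (Sigma.desc fun c => boxFreeDesc (Projective.π (F.left c)))
      r := Sigma.desc fun c => boxFreeDesc (Projective.π (F.left c))
      retract := Projective.factorThru_comp _ _ }
  suffices HasInjectiveDimensionLT (∐ fun c => box (X c) (free k c)) (m + n + 1) from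
    r.hasInjectiveDimensionLT _
  -- Here the summand at `c` lives on nonzero morphisms `c ⟶ Z.snd`, so the other half of local
  -- boundedness is used. The coproduct becomes a product, to which bounds on injective dimension
  -- pass.
  have := isIso_sigmaToPi (fun c => box (X c) (free k c)) fun Z =>
    (hb Z.snd).2.subset fun c ⟨x, hx⟩ => by
      by_contra h
      simp only [Set.mem_ofPred_eq, not_exists, not_not] at h
      refine hx (LinearMap.congr_fun (f := LinearMap.id)
        (g := (0 : (c ⟶ Z.snd) ⊗[k] (X c).obj.obj Z.fst →ₗ[k] _))
        (TensorProduct.ext' fun g y => ?_) x)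
      rw [h g, TensorProduct.zero_tmul, map_zero, map_zero]
  have (c : C) : HasInjectiveDimensionLT (box (X c) (free k c)) (m + n + 1) := by
    have := isIso_boxBidual hC c (X c)
    have hflat (c d : C) : Module.Flat k (c ⟶ d) := by
      have := (hC c d).2
      infer_instance
    have := injectiveDimension_bihom hflat (RMod.dual k c)
      (fun d => by
        have := (hC c d).1
        have := (hC c d).2
        exact inferInstanceAs (Module.Projective k (Module.Dual k (c ⟶ d))))
      (hn c) (X c) (hm (X c) inferInstance)
    exact hasInjectiveDimensionLT_of_iso (asIso (boxBidual c (X c))).symm _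
  have := injectiveDimension_pi this
  exact hasInjectiveDimensionLT_of_iso (asIso (sigmaToPi fun c => box (X c) (free k c))).symm _

end LMod

/-- The tensor product with a locally bounded Hom-finite category whose associated endofunctor is
`n`-Gorenstein raises the global Gorenstein projective dimension by at most `n`. -/
lemma glGpdim_tensorCat_le (hb : IsLocallyBounded C) (hC : IsHomFinite k C) {m n : ℕ}
    (hm : glGpdim (LMod k D) ≤ m) (hn : IsGorensteinOfDim k C n) :
    glGpdim (LMod k (TensorCat k D C)) ≤ (m + n : ℕ) := by
  obtain ⟨⟨N, hN⟩, hn, -⟩ := hn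
  -- The bound `m + n` for projectives uses the exact Gorenstein dimension `n`; for injectives a
  -- crude finite bound obtained from `N` is enough.
  refine glGpdim_le (n := m + n) (t := m + (N + 1)) (fun F _ => ?_) (fun F _ => ?_)
  · exact LMod.injectiveDimension_of_projective hb hC
      (injectiveDimension_le_of_glGpdim_le hm)
      (fun c E _ => injectiveDimension_hom_dual (hn (n + 1) (by lia)) c E) F
  · exact LMod.projectiveDimension_of_injective hb hC
      (projectiveDimension_le_of_glGpdim_le hm)
      (fun c => projectiveDimension_dualLeft (hN (N + 1 + 1) (by lia)).2 c) F

end TensorGorenstein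

end GorensteinModules

end

theorem theorem6 (k : Type u) [CommRing k]
    (C' : Type u) [SmallCategory C'] [Preadditive C'] [Linear k C']
    (C : Type u) [SmallCategory C] [Preadditive C] [Linear k C]
    (hbounded : GorensteinModules.IsLocallyBounded C) (hfinite : GorensteinModules.IsHomFinite k C)
    (m n : ℕ) (hC' : GorensteinModules.IsLeftGorenstein k C' m)
    (hC : GorensteinModules.IsGorensteinOfDim k C n) :
    ∃ p : ℕ, p ≤ m + n ∧
      GorensteinModules.IsLeftGorenstein k (GorensteinModules.TensorCat k C' C) p := by
  have h := GorensteinModules.glGpdim_tensorCat_le hbounded hfinite (le_of_eq hC') hC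
  -- Being at most `m + n`, the dimension is finite, and `p` is its actual value.
  obtain ⟨p, hp⟩ := ENat.ne_top_iff_exists.1 (ne_top_of_le_ne_top (ENat.natCast_ne_top _) h)
  exact ⟨p, by rwa [← hp, Nat.cast_le] at h, hp.symm⟩
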